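/- **Setting.** Let $\Omega\subset\mathbb R^2$ be open and let $\mathcal T_h$ be a finite mesh of non-overlapping closed nondegenerate triangles and rectangles with $\bigcup_{\kappa}\kappa=\overline\Omega$ and $\operatorname{int}\kappa\subset\Omega$ (hanging nodes allowed), with set of edges $\mathcal E_h=\mathcal E_{h,I}\cup\mathcal E_{h,\partial}$: the edges are non-overlapping segments, each interior edge is shared by two elements and each boundary edge lies in $\partial\Omega$, and the boundary of each element is a union of edges. Let $h_e$ be the length of $e$ and let $N_l\in\mathbb N$ be such that every element has at most $N_l$ edges. The mesh is called $\sigma$-shape-regular if each $\kappa$ contains a disc of radius $\sigma\operatorname{diam}\kappa$. On an interior edge shared by $\kappa,\kappa'$ with outward unit normals $\nu_\kappa,\nu_{\kappa'}$ let $[\![w]\!]=w_\kappa\nu_\kappa+w_{\kappa'}\nu_{\kappa'}$, $\{\tau\}=\frac12(\tau_\kappa+\tau_{\kappa'})$, $[\![\tau]\!]=\tau_\kappa\cdot\nu_\kappa+\tau_{\kappa'}\cdot\nu_{\kappa'}$; on a boundary edge let $[\![w]\!]=w\nu_\kappa$, $\{\tau\}=\tau$. Let $q\ge1$ and $p\in\{q,q-1\}$.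 Let $V_{h,q}$ be the space of functions that are polynomials of total degree $\le q$ on each element, $\Sigma_{h,p}$ the space of vector fields whose components are polynomials of total degree $\le p$ on each element, and $V(h)=V_{h,q}+H^2(\Omega)\cap H^1_0(\Omega)$. Define the liftings $r^e(\varphi),r(\varphi),l(\varphi)\in\Sigma_{h,p}$ by $$\int_\Omega r^e(\varphi)\cdot\tau=-\int_e\varphi\cdot\{\tau\},\qquad \int_\Omega r(\varphi)\cdot\tau=-\sum_{e\in\mathcal E_h}\int_e\varphi\cdot\{\tau\},\qquad \int_\Omega l(\varphi)\cdot\tau=-\sum_{e\in\mathcal E_{h,I}}\int_e\varphi[\![\tau]\!]\qquad\forall\tau\in\Sigma_{h,p},$$ and, with $\nabla_h$ the element-wise gradient, $$\|v\|_h^2=\|\nabla_hv\|_{L_2(\Omega)}^2+\sum_{e\in\mathcal E_h}\|r^e([\![v]\!])\|_{L_2(\Omega)}^2,\qquad v\in V(h).$$ A number $C_R>0$ is called a lifting constant of the mesh if $\|r^e([\![w]\!])\|_{L_2(\Omega)}\le C_Rh_e^{-1/2}\|[\![w]\!]\|_{L_2(e)}$ for all $w\in V_{h,q}$ and $e\in\mathcal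 E_h$. Let $0<\lambda\le\Lambda$ and let $\mathbf a:\Omega\times\mathbb R\times\mathbb R^2\to\mathbb R^2$ be continuous and differentiable in its last argument, with symmetric Jacobian $\mathbf a_z$ all of whose eigenvalues lie in $[\lambda,\Lambda]$ everywhere, and with $\mathbf a(x,\eta,0)=0$ for all $x,\eta$. No monotonicity is assumed. Write $\theta_h(v)=\nabla_hv+r([\![v]\!])$ for SIPG and BR2, $\theta_h(v)=\nabla_hv+r([\![v]\!])+l(\beta\cdot[\![v]\!])$ for LDG, where $\beta$ is a vector that is constant on each edge, and $\mathbf a(u,\tau)=\mathbf a(\cdot,u,\tau)$. The primal forms are $$\mathcal B_{\rm LDG}(u,v)=\int_\Omega\mathbf a(u,\theta_h(u))\cdot\theta_h(v)\,dx+\sum_{e}\frac{\mu_e}{h_e}\int_e[\![u]\!]\cdot[\![v]\!]\,ds,$$ $$\mathcal B_{\rm SIPG}(u,v)=\int_\Omega\mathbf a(u,\theta_h(u))\cdot\nabla_hv+\mathbf a(u,\nabla_hu)\cdot r([\![v]\!])\,dx+\sum_e\frac{\mu_e}{h_e}\int_e[\![u]\!]\cdot[\![v]\!]\,ds,$$ $$\mathcal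 B_{\rm BR2}(u,v)=\int_\Omega\mathbf a(u,\theta_h(u))\cdot\nabla_hv+\mathbf a(u,\nabla_hu)\cdot r([\![v]\!])\,dx+\sum_e\eta_e\int_\Omega\mathbf a(u,r^e([\![u]\!]))\cdot r^e([\![v]\!])\,dx,$$ and $\mathcal F(v)=\int_\Omega fv\,dx$ with $f\in L_2(\Omega)$. A discrete solution is a $u_h\in V_{h,q}$ with $\mathcal B(u_h,v)=\mathcal F(v)$ for all $v\in V_{h,q}$. **Lemma 6.1.** 1. For every $\sigma>0$ there is a $C_R>0$, depending only on $\sigma,p,q$, that is a lifting constant of all $\sigma$-shape-regular meshes. On every mesh there is a $C_F>0$, independent of $f$, with $$|\mathcal F(v)|\le C_F\|f\|_{L_2(\Omega)}\|v\|_h\qquad\forall v\in V(h).\tag{1}$$ 2. There is a $C_{co}>0$ with $$C_{co}\|v\|_h^2\le\mathcal B(v,v)\qquad\forall v\in V_{h,q}\tag{2}$$ in each of the following cases: * LDG, if $\mu_e\ge\mu_0$ for all $e$ with some $\mu_0>0$, the mesh is $\sigma$-shape-regular and $|\beta|\le b$; here $C_{co}$ depends only on $q,p,\sigma,N_l,\lambda,b,\mu_0$;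 * SIPG, if $\mu_e\ge\mu_0$ for all $e$ with some $\mu_0>C_R^2\Lambda N_l$, where $C_R$ is any lifting constant of the mesh; here $C_{co}$ depends only on $q,p,\lambda,\Lambda,C_R,N_l,\mu_0$; * BR2, if $\eta_e\ge\eta_0$ for all $e$ with some $\eta_0>N_l\Lambda/\lambda$; here $C_{co}$ depends only on $q,p,\lambda,\Lambda,N_l,\eta_0$. (As a mesh has finitely many edges, these conditions on a given mesh are $\mu_e>0$, $\mu_e>C_R^2\Lambda N_l$ and $\eta_e>N_l\Lambda/\lambda$ for all $e$.) 3. In each of these cases every discrete solution $u_h$ with right-hand side $f\in L_2(\Omega)$ satisfies $$\|u_h\|_h\le\frac{C_F}{C_{co}}\|f\|_{L_2(\Omega)}$$ for every $C_F\ge0$ with (1) and every $C_{co}>0$ with (2). -/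

import Mathlib

open MeasureTheory Set Filter Topology
open scoped ContDiff RealInnerProductSpace

noncomputable section

namespace DG

/-- The plane with its Euclidean norm. -/
abbrev Plane : Type := EuclideanSpace ℝ (Fin 2)

/-- Closed nondegenerate triangles. -/
def IsTriangle (K : Set Plane) : Prop :=
  ∃ v : Fin 3 → Plane, AffineIndependent ℝ v ∧ K = convexHull ℝ (range v)

/-- Closed nondegenerate rectangles (not necessarily parallel to the axes). -/
def IsRectangle (K : Set Plane) : Prop :=
  ∃ c u v : Plane, u ≠ 0 ∧ v ≠ 0 ∧ ⟪u, v⟫ = 0 ∧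
    K = {x | ∃ s ∈ Icc (0 : ℝ) 1, ∃ t ∈ Icc (0 : ℝ) 1, x = c + s • u + t • v}

/-- A mesh of `Ω` by non-overlapping triangles and rectangles, hanging nodes being allowed,
together with its skeleton. Every edge `e` is a nondegenerate straight segment with a chosen
unit normal `normal e`; it lies on the boundary of the element `left e`, to which `normal e` is
outward, and either on the boundary of exactly one further element `k`, to which `-normal e` is
outward (`right e = some k`, an interior edge), or on `∂Ω` (`right e = none`, a boundary edge).
Edges do not overlap, and the edges of an element make up its boundary. With a hanging node an
edge may be a proper part of a side of an element. -/
structure Mesh (Ω : Set Plane) where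
  Elem : Type
  Edge : Type
  [fintypeElem : Fintype Elem]
  [fintypeEdge : Fintype Edge]
  elem : Elem → Set Plane
  shape : ∀ k, IsTriangle (elem k) ∨ IsRectangle (elem k)
  cover : ⋃ k, elem k = closure Ω
  interior_elem_subset : ∀ k, interior (elem k) ⊆ Ω
  disjoint_interior : ∀ k k', k ≠ k' → Disjoint (interior (elem k)) (interior (elem k'))
  src : Edge → Plane
  tgt : Edge → Plane
  src_ne_tgt : ∀ e, src e ≠ tgt e
  left : Edge → Elem
  right : Edge → Option Elem
  normal : Edge → Plane
  norm_normal : ∀ e, ‖normal e‖ = 1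
  normal_orthogonal : ∀ e, ⟪normal e, tgt e - src e⟫ = 0
  segment_subset_left : ∀ e, segment ℝ (src e) (tgt e) ⊆ elem (left e)
  normal_left : ∀ e, ∀ x ∈ elem (left e), ⟪normal e, x - src e⟫ ≤ 0
  segment_subset_right : ∀ e k, right e = some k → segment ℝ (src e) (tgt e) ⊆ elem k
  normal_right : ∀ e k, right e = some k → ∀ x ∈ elem k, 0 ≤ ⟪normal e, x - src e⟫
  interior_edge : ∀ e k, right e = some k → openSegment ℝ (src e) (tgt e) ⊆ Ω
  boundary_edge : ∀ e, right e = none → segment ℝ (src e) (tgt e) ⊆ frontier Ω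
  disjoint_edges : ∀ e e', e ≠ e' →
    Disjoint (openSegment ℝ (src e) (tgt e)) (openSegment ℝ (src e') (tgt e'))
  frontier_elem : ∀ k, frontier (elem k) =
    ⋃ e ∈ {e | left e = k ∨ right e = some k}, segment ℝ (src e) (tgt e)

attribute [instance] Mesh.fintypeElem Mesh.fintypeEdge

/-- `f` is a polynomial function of total degree at most `k` on the plane. -/
def IsPoly (k : ℕ) (f : Plane → ℝ) : Prop :=
  ∃ P : MvPolynomial (Fin 2) ℝ, P.totalDegree ≤ k ∧ ∀ x, f x = MvPolynomial.eval (fun i => x i) P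

namespace Mesh

variable {Ω : Set Plane} (M : Mesh Ω)

/-- The edges of the element `k`. -/
def edgesOf (k : M.Elem) : Set M.Edge := {e | M.left e = k ∨ M.right e = some k}

/-- Every element has at most `N` edges (`N = 3` for triangles and `N = 4` for rectangles if there
are no hanging nodes). -/
def EdgeBound (N : ℕ) : Prop := ∀ k, (M.edgesOf k).ncard ≤ N

/-- Shape regularity: every element contains a disc whose radius is at least `σ` times the
diameter of the element. -/
def ShapeRegular (σ : ℝ) : Prop :=
  ∀ k, ∃ c, Metric.closedBall c (σ * Metric.diam (M.elem k)) ⊆ M.elem k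

/-- The length `h_e` of an edge. -/
def len (e : M.Edge) : ℝ := dist (M.src e) (M.tgt e)

/-- `∫_e g ds`, by arc length. -/
def edgeInt (e : M.Edge) (g : Plane → ℝ) : ℝ :=
  M.len e * ∫ t in (0 : ℝ)..1, g (AffineMap.lineMap (M.src e) (M.tgt e) t)

/-! Functions that may jump across edges are families indexed by the elements; only the values of
the member `k` on the closed element `k` matter, those on an edge being its trace there. -/

/-- The jump `⟦w⟧ = w_κ ν_κ + w_κ' ν_κ'` of a scalar function (`w_κ ν_κ` on boundary edges). -/
def jump (w : M.Elem → Plane → ℝ) (e : M.Edge) (x : Plane) : Plane :=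
  match M.right e with
  | none => w (M.left e) x • M.normal e
  | some k => w (M.left e) x • M.normal e + w k x • (-M.normal e)

/-- The average of a vector field on an edge (its trace on boundary edges). -/
def avg (τ : M.Elem → Plane → Plane) (e : M.Edge) (x : Plane) : Plane :=
  match M.right e with
  | none => τ (M.left e) x
  | some k => (1 / 2 : ℝ) • (τ (M.left e) x + τ k x)

/-- The jump `⟦τ⟧ = τ_κ · ν_κ + τ_κ' · ν_κ'` of a vector field (used on interior edges only). -/
def jumpNormal (τ : M.Elem → Plane → Plane) (e : M.Edge) (x : Plane) : ℝ :=
  match M.right e with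
  | none => ⟪τ (M.left e) x, M.normal e⟫
  | some k => ⟪τ (M.left e) x, M.normal e⟫ + ⟪τ k x, -M.normal e⟫

/-- The space `V_{h,q}`. -/
def IsV (q : ℕ) (v : M.Elem → Plane → ℝ) : Prop := ∀ k, IsPoly q (v k)

/-- The space `Σ_{h,p}`. -/
def IsSigma (p : ℕ) (τ : M.Elem → Plane → Plane) : Prop := ∀ k i, IsPoly p (fun x => τ k x i)

/-- The inner product of `[L₂(Ω)]²`. -/
def l2Inner (τ ρ : M.Elem → Plane → Plane) : ℝ := ∑ k, ∫ x in M.elem k, ⟪τ k x, ρ k x⟫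

/-- The norm of `[L₂(Ω)]²`. -/
def l2Norm (τ : M.Elem → Plane → Plane) : ℝ := √(∑ k, ∫ x in M.elem k, ‖τ k x‖ ^ 2)

/-- The element `R` of `Σ_{h,p}` with `∫_Ω R · τ dx = ℓ τ` for all `τ` in `Σ_{h,p}`; it exists and
is unique for every functional `ℓ` that is linear on `Σ_{h,p}`, see `riesz_spec`. -/
def riesz (p : ℕ) (ℓ : (M.Elem → Plane → Plane) → ℝ) : M.Elem → Plane → Plane :=
  open Classical in
  if h : ∃ R, M.IsSigma p R ∧ ∀ τ, M.IsSigma p τ → M.l2Inner R τ = ℓ τ then h.choose else 0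

/-- The edge-wise lifting `r^e`: `∫_Ω r^e(φ) · τ dx = -∫_e φ · {τ} ds`. -/
def liftREdge (p : ℕ) (e : M.Edge) (φ : Plane → Plane) : M.Elem → Plane → Plane :=
  M.riesz p fun τ => -M.edgeInt e fun x => ⟪φ x, M.avg τ e x⟫

/-- The lifting `r`: `∫_Ω r(φ) · τ dx = -∑_e ∫_e φ · {τ} ds`, the sum being over all edges. -/
def liftR (p : ℕ) (φ : M.Edge → Plane → Plane) : M.Elem → Plane → Plane :=
  M.riesz p fun τ => -∑ e, M.edgeInt e fun x => ⟪φ e x, M.avg τ e x⟫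

/-- The lifting `l`: `∫_Ω l(φ) · τ dx = -∑_e ∫_e φ ⟦τ⟧ ds`, the sum being over interior edges. -/
def liftL (p : ℕ) (φ : M.Edge → Plane → ℝ) : M.Elem → Plane → Plane :=
  M.riesz p fun τ =>
    -∑ e, if (M.right e).isSome then M.edgeInt e fun x => φ e x * M.jumpNormal τ e x else 0

/-- The element-wise gradient `∇_h v` of an element-wise differentiable function. -/
def grad (v : M.Elem → Plane → ℝ) : M.Elem → Plane → Plane := fun k x => gradient (v k) x

/-- The energy norm `‖w‖_h` of a function `w` with element-wise (weak) gradient `g`: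
`‖w‖_h² = ‖g‖²_{L₂(Ω)} + ∑_e ‖r^e(⟦w⟧)‖²_{L₂(Ω)}`. -/
def energyNorm (p : ℕ) (w : M.Elem → Plane → ℝ) (g : M.Elem → Plane → Plane) : ℝ :=
  √(M.l2Norm g ^ 2 + ∑ e, M.l2Norm (M.liftREdge p e (M.jump w e)) ^ 2)

/-- `C` is a constant in the upper lifting estimate
`‖r^e(⟦w⟧)‖_{L₂(Ω)} ≤ C h_e^{-1/2} ‖⟦w⟧‖_{L₂(e)}` on this mesh. -/
def IsLiftConst (q p : ℕ) (C : ℝ) : Prop :=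
  ∀ w, M.IsV q w → ∀ e, M.l2Norm (M.liftREdge p e (M.jump w e)) ≤
    C * (√(M.len e))⁻¹ * √(M.edgeInt e fun x => ‖M.jump w e x‖ ^ 2)

/-- `∇_h v + r(⟦v⟧)`, the discrete gradient `θ_h(v)` of the BR2 and SIPG methods. -/
def theta (p : ℕ) (v : M.Elem → Plane → ℝ) : M.Elem → Plane → Plane :=
  M.grad v + M.liftR p (M.jump v)

/-- `∇_h v + r(⟦v⟧) + l(β · ⟦v⟧)`, the discrete gradient `θ_h(v)` of the LDG method. -/
def thetaLDG (p : ℕ) (β : M.Edge → Plane) (v : M.Elem → Plane → ℝ) : M.Elem → Plane → Plane :=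
  M.grad v + M.liftR p (M.jump v) + M.liftL p (fun e x => ⟪β e, M.jump v e x⟫)

/-- `∑_e (μ_e / h_e) ∫_e ⟦u⟧ · ⟦v⟧ ds`. -/
def penalty (μ : M.Edge → ℝ) (u v : M.Elem → Plane → ℝ) : ℝ :=
  ∑ e, μ e / M.len e * M.edgeInt e fun x => ⟪M.jump u e x, M.jump v e x⟫

/-- `∫_Ω a(x, u, τ) · ρ dx`. -/
def flux (a : Plane → ℝ → Plane → Plane) (u : M.Elem → Plane → ℝ)
    (τ ρ : M.Elem → Plane → Plane) : ℝ :=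
  M.l2Inner (fun k x => a x (u k x) (τ k x)) ρ

/-- The primal form of the LDG method. -/
def formLDG (p : ℕ) (a : Plane → ℝ → Plane → Plane) (β : M.Edge → Plane) (μ : M.Edge → ℝ)
    (u v : M.Elem → Plane → ℝ) : ℝ :=
  M.flux a u (M.thetaLDG p β u) (M.thetaLDG p β v) + M.penalty μ u v

/-- The primal form of the SIPG method. -/
def formSIPG (p : ℕ) (a : Plane → ℝ → Plane → Plane) (μ : M.Edge → ℝ)
    (u v : M.Elem → Plane → ℝ) : ℝ :=
  M.flux a u (M.theta p u) (M.grad v) + M.flux a u (M.grad u) (M.liftR p (M.jump v))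
    + M.penalty μ u v

/-- The primal form of the second method of Bassi and Rebay. -/
def formBR2 (p : ℕ) (a : Plane → ℝ → Plane → Plane) (η : M.Edge → ℝ)
    (u v : M.Elem → Plane → ℝ) : ℝ :=
  M.flux a u (M.theta p u) (M.grad v) + M.flux a u (M.grad u) (M.liftR p (M.jump v))
    + ∑ e, η e * M.flux a u (M.liftREdge p e (M.jump u e)) (M.liftREdge p e (M.jump v e))

/-- The linear form `𝓕(w) = ∫_Ω f w dx`. -/
def load (f : Plane → ℝ) (w : M.Elem → Plane → ℝ) : ℝ := ∑ k, ∫ x in M.elem k, f x * w k x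

end Mesh

/-- `f ∈ L₂(Ω)`. -/
def InL2 (Ω : Set Plane) (f : Plane → ℝ) : Prop := MemLp f 2 (volume.restrict Ω)

/-- `‖f‖_{L₂(Ω)}`. -/
def normL2 (Ω : Set Plane) (f : Plane → ℝ) : ℝ := √(∫ x in Ω, f x ^ 2)

/-- `ψ ∈ C_c^∞(Ω)`. -/
def IsTest (Ω : Set Plane) (ψ : Plane → ℝ) : Prop :=
  ContDiff ℝ ∞ ψ ∧ HasCompactSupport ψ ∧ tsupport ψ ⊆ Ω

/-- `d` is the weak partial derivative `∂φ/∂x_i` in `Ω`. -/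
def IsWeakPartial (Ω : Set Plane) (i : Fin 2) (φ d : Plane → ℝ) : Prop :=
  ∀ ψ, IsTest Ω ψ →
    ∫ x in Ω, φ x * fderiv ℝ ψ x (EuclideanSpace.single i 1) = -∫ x in Ω, d x * ψ x

/-- `φ` is the continuous representative of an element of `H²(Ω) ∩ H₀¹(Ω)` and `g` is its weak
gradient; `H₀¹(Ω)` is the closure of `C_c^∞(Ω)` in `H¹(Ω)`. On the polygonal domains considered
here every element of `H²(Ω)` has a representative that is continuous on the closure of `Ω`, and
those in `H₀¹(Ω)` vanish on `∂Ω`. -/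
structure IsH2H10 (Ω : Set Plane) (φ : Plane → ℝ) (g : Plane → Plane) : Prop where
  memLp : InL2 Ω φ
  memLp_grad : ∀ i, InL2 Ω (fun x => g x i)
  weak_grad : ∀ i, IsWeakPartial Ω i φ (fun x => g x i)
  weak_hess : ∀ i j, ∃ d, InL2 Ω d ∧ IsWeakPartial Ω j (fun x => g x i) d
  approx : ∃ ψ : ℕ → Plane → ℝ, (∀ n, IsTest Ω (ψ n)) ∧
    Tendsto (fun n => eLpNorm (φ - ψ n) 2 (volume.restrict Ω)) atTop (𝓝 0) ∧
    Tendsto (fun n => eLpNorm (g - gradient (ψ n)) 2 (volume.restrict Ω)) atTop (𝓝 0)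
  continuousOn : ContinuousOn φ (closure Ω)
  eq_zero : ∀ x ∈ frontier Ω, φ x = 0

/-- The hypotheses on the diffusion operator `a(x, η, ξ)`: it is continuous on `Ω × ℝ × ℝ²`,
differentiable in `ξ` with a symmetric Jacobian `a_z`, all eigenvalues of which lie in
`[lam, Lam]`, and it satisfies `a(x, η, 0) = 0`. -/
structure IsDiffusion (Ω : Set Plane) (lam Lam : ℝ) (a : Plane → ℝ → Plane → Plane) : Prop where
  continuousOn : ContinuousOn (fun y : Plane × ℝ × Plane => a y.1 y.2.1 y.2.2) (Ω ×ˢ univ)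
  differentiable : ∀ x ∈ Ω, ∀ η, Differentiable ℝ (a x η)
  symmetric : ∀ x ∈ Ω, ∀ η ξ v w,
    ⟪fderiv ℝ (a x η) ξ v, w⟫ = ⟪v, fderiv ℝ (a x η) ξ w⟫
  lower : ∀ x ∈ Ω, ∀ η ξ v, lam * ‖v‖ ^ 2 ≤ ⟪fderiv ℝ (a x η) ξ v, v⟫
  upper : ∀ x ∈ Ω, ∀ η ξ v, ⟪fderiv ℝ (a x η) ξ v, v⟫ ≤ Lam * ‖v‖ ^ 2
  zero : ∀ x ∈ Ω, ∀ η, a x η 0 = 0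

namespace Mesh

variable {Ω : Set Plane} (M : Mesh Ω)

/-- `w` belongs to `V(h) = V_{h,q} + H²(Ω) ∩ H₀¹(Ω)` and `g` is its element-wise weak gradient. -/
def IsVh (q : ℕ) (w : M.Elem → Plane → ℝ) (g : M.Elem → Plane → Plane) : Prop :=
  ∃ v φ γ, M.IsV q v ∧ IsH2H10 Ω φ γ ∧
    (∀ k x, w k x = v k x + φ x) ∧ (∀ k x, g k x = M.grad v k x + γ x)

/-- `C` is a continuity constant of the linear form `𝓕`:
`|𝓕(w)| ≤ C ‖f‖_{L₂(Ω)} ‖w‖_h` for all `w ∈ V(h)`. -/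
def IsContinuityConst (q p : ℕ) (f : Plane → ℝ) (C : ℝ) : Prop :=
  ∀ w g, M.IsVh q w g → |M.load f w| ≤ C * normL2 Ω f * M.energyNorm p w g

/-- `C` is a coercivity constant of the form `B`: `C ‖v‖_h² ≤ B(v, v)` for all `v ∈ V_{h,q}`. -/
def IsCoercivityConst (q p : ℕ)
    (B : (M.Elem → Plane → ℝ) → (M.Elem → Plane → ℝ) → ℝ) (C : ℝ) : Prop :=
  ∀ v, M.IsV q v → C * M.energyNorm p v (M.grad v) ^ 2 ≤ B v v

/-- `u ∈ V_{h,q}` is a discrete solution: `B(u, v) = 𝓕(v)` for all `v ∈ V_{h,q}`. -/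
def IsDiscreteSolution (q : ℕ) (B : (M.Elem → Plane → ℝ) → (M.Elem → Plane → ℝ) → ℝ)
    (f : Plane → ℝ) (u : M.Elem → Plane → ℝ) : Prop :=
  M.IsV q u ∧ ∀ v, M.IsV q v → B u v = M.load f v

/-- The stability estimate: every discrete solution `u` with right-hand side `f ∈ L₂(Ω)` satisfies
`‖u‖_h ≤ (C_F / C_co) ‖f‖_{L₂(Ω)}`, for all nonnegative continuity constants `C_F` of `𝓕` and all positive
coercivity constants `C_co` of `B`. -/
def StabilityEstimate (q p : ℕ)
    (B : (M.Elem → Plane → ℝ) → (M.Elem → Plane → ℝ) → ℝ) : Prop :=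
  ∀ f u CF Cco, InL2 Ω f → M.IsDiscreteSolution q B f u → 0 ≤ CF → M.IsContinuityConst q p f CF →
    0 < Cco → M.IsCoercivityConst q p B Cco →
    M.energyNorm p u (M.grad u) ≤ CF / Cco * normL2 Ω f

end Mesh

end DG

namespace DG

theorem IsPoly.continuous {k : ℕ} {f : Plane → ℝ} (hf : IsPoly k f) : Continuous f := by
  obtain ⟨P, -, h⟩ := hf
  rw [funext h]
  have := (MvPolynomial.continuous_eval P)
  exact this.comp (by fun_prop)

theorem IsPoly.eq_zero {k : ℕ} {f : Plane → ℝ} (hf : IsPoly k f) {U : Set Plane} (hU : IsOpen U)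
    (hne : U.Nonempty) (h0 : ∀ x ∈ U, f x = 0) : f = 0 := by
  obtain ⟨P, -, h⟩ := hf
  have han : AnalyticOnNhd ℝ f univ := by
    have : f = fun x : Plane => MvPolynomial.aeval (fun i => x i) P := by
      ext x; rw [h x, MvPolynomial.aeval_eq_eval]
    rw [this]
    refine AnalyticOnNhd.aeval_mvPolynomial (fun i => ?_) P
    exact fun x _ => (EuclideanSpace.proj (𝕜 := ℝ) i : Plane →L[ℝ] ℝ).analyticAt x
  obtain ⟨z, hz⟩ := hne
  have := han.eqOn_zero_of_preconnected_of_eventuallyEq_zero isPreconnected_univ (mem_univ z)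
    (by filter_upwards [hU.mem_nhds hz] with x hx using h0 x hx)
  ext x; exact this (mem_univ x)

theorem IsTriangle.interior_nonempty {K : Set Plane} (h : IsTriangle K) :
    (interior K).Nonempty := by
  obtain ⟨v, hv, rfl⟩ := h
  rw [interior_convexHull_nonempty_iff_affineSpan_eq_top,
    hv.affineSpan_eq_top_iff_card_eq_finrank_add_one]
  simp

theorem IsTriangle.isCompact {K : Set Plane} (h : IsTriangle K) : IsCompact K := by
  obtain ⟨v, -, rfl⟩ := h
  exact (finite_range v).isCompact_convexHull ℝ

theorem IsRectangle.isCompact {K : Set Plane} (h : IsRectangle K) : IsCompact K := by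
  obtain ⟨c, u, v, -, -, -, rfl⟩ := h
  have : {x : Plane | ∃ s ∈ Icc (0 : ℝ) 1, ∃ t ∈ Icc (0 : ℝ) 1, x = c + s • u + t • v} =
      (fun y : ℝ × ℝ => c + y.1 • u + y.2 • v) '' (Icc 0 1 ×ˢ Icc 0 1) := by
    ext x; constructor
    · rintro ⟨s, hs, t, ht, rfl⟩; exact ⟨(s, t), ⟨hs, ht⟩, rfl⟩
    · rintro ⟨⟨s, t⟩, ⟨hs, ht⟩, rfl⟩; exact ⟨s, hs, t, ht, rfl⟩
  rw [this]
  exact (isCompact_Icc.prod isCompact_Icc).image (by fun_prop)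

theorem IsRectangle.interior_nonempty {K : Set Plane} (h : IsRectangle K) :
    (interior K).Nonempty := by
  obtain ⟨c, u, v, hu, hv, huv, rfl⟩ := h
  set K := {x : Plane | ∃ s ∈ Icc (0 : ℝ) 1, ∃ t ∈ Icc (0 : ℝ) 1, x = c + s • u + t • v}
  have hli : LinearIndependent ℝ ![u, v] := by
    refine linearIndependent_of_ne_zero_of_inner_eq_zero (𝕜 := ℝ) ?_ ?_
    · intro i; fin_cases i <;> simpa
    · intro i j hij
      fin_cases i <;> fin_cases j <;> simp_all [real_inner_comm]
  have hcard := hli.span_eq_top_of_card_eq_finrank (by simp)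
  have htop : affineSpan ℝ ({c, c + u, c + v} : Set Plane) = ⊤ := by
    rw [AffineSubspace.affineSpan_eq_top_iff_vectorSpan_eq_top_of_nonempty ℝ _ _ (by simp), eq_top_iff, ← hcard,
      Submodule.span_le]
    rintro _ ⟨i, rfl⟩
    fin_cases i
    · have := vsub_mem_vectorSpan ℝ (s := ({c, c + u, c + v} : Set Plane)) (p₁ := c + u) (p₂ := c)
        (by simp) (by simp)
      simpa using this
    · have := vsub_mem_vectorSpan ℝ (s := ({c, c + u, c + v} : Set Plane)) (p₁ := c + v) (p₂ := c)
        (by simp) (by simp)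
      simpa using this
  have hconv : Convex ℝ K := by
    rintro _ ⟨s, hs, t, ht, rfl⟩ _ ⟨s', hs', t', ht', rfl⟩ a b ha hb hab
    refine ⟨a * s + b * s', convex_Icc (0 : ℝ) 1 hs hs' ha hb hab, a * t + b * t',
      convex_Icc (0 : ℝ) 1 ht ht' ha hb hab, ?_⟩
    have : c = a • c + b • c := by rw [← add_smul, hab, one_smul]
    nth_rw 3 [this]
    module
  refine ((interior_convexHull_nonempty_iff_affineSpan_eq_top (V := Plane)).2 htop).mono
    (interior_mono (convexHull_min ?_ hconv))
  rintro x (rfl | rfl | rfl)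
  · exact ⟨0, by simp, 0, by simp, by simp⟩
  · exact ⟨1, by simp, 0, by simp, by simp⟩
  · exact ⟨0, by simp, 1, by simp, by simp⟩

namespace Mesh

variable {Ω : Set Plane} (M : Mesh Ω)

theorem isCompact_elem (k : M.Elem) : IsCompact (M.elem k) :=
  (M.shape k).elim IsTriangle.isCompact IsRectangle.isCompact

theorem interior_elem_nonempty (k : M.Elem) : (interior (M.elem k)).Nonempty :=
  (M.shape k).elim IsTriangle.interior_nonempty IsRectangle.interior_nonempty

variable {M} in
theorem IsSigma.continuous {p : ℕ} {τ : M.Elem → Plane → Plane} (h : M.IsSigma p τ) (k : M.Elem) :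
    Continuous (τ k) :=
  (PiLp.continuous_toLp 2 (fun _ : Fin 2 => ℝ)).comp (continuous_pi fun i => (h k i).continuous)

variable {M} in
theorem IsSigma.eq_zero {p : ℕ} {τ : M.Elem → Plane → Plane} (h : M.IsSigma p τ)
    (h0 : M.l2Inner τ τ = 0) : τ = 0 := by
  have hk : ∀ k, ∫ x in M.elem k, ⟪τ k x, τ k x⟫ = 0 := by
    have := (Finset.sum_eq_zero_iff_of_nonneg (s := Finset.univ)
      (f := fun k => ∫ x in M.elem k, ⟪τ k x, τ k x⟫)
      (fun k _ => integral_nonneg fun x => real_inner_self_nonneg)).1 h0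
    exact fun k => this k (Finset.mem_univ k)
  ext1 k
  have hc := h.continuous k
  have h1 := (setIntegral_eq_zero_iff_of_nonneg_ae
    (Eventually.of_forall fun x => real_inner_self_nonneg)
    ((hc.inner (𝕜 := ℝ) hc).continuousOn.integrableOn_compact (M.isCompact_elem k))).1 (hk k)
  have h2 := Measure.eqOn_open_of_ae_eq (ae_restrict_of_ae_restrict_of_subset interior_subset h1)
    isOpen_interior (hc.inner (𝕜 := ℝ) hc).continuousOn continuousOn_const
  have h3 : ∀ i, (fun x => τ k x i) = 0 := fun i =>
    (h k i).eq_zero isOpen_interior (M.interior_elem_nonempty k) fun x hx => by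
      have h4 : ⟪τ k x, τ k x⟫ = 0 := h2 hx
      rw [inner_self_eq_zero] at h4
      simp [h4]
  ext x i
  exact congrFun (h3 i) x

/-- `Σ_{h,p}` as a subspace. -/
def sigma (p : ℕ) : Submodule ℝ (M.Elem → Plane → Plane) where
  carrier := {τ | M.IsSigma p τ}
  zero_mem' := fun _ _ => ⟨0, by simp, by simp⟩
  add_mem' := by
    intro τ ρ hτ hρ k i
    obtain ⟨P, hP, h⟩ := hτ k i
    obtain ⟨Q, hQ, h'⟩ := hρ k i
    exact ⟨P + Q, (MvPolynomial.totalDegree_add P Q).trans (max_le hP hQ), by simp [h, h']⟩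
  smul_mem' := by
    intro c τ hτ k i
    obtain ⟨P, hP, h⟩ := hτ k i
    exact ⟨c • P, (MvPolynomial.totalDegree_smul_le c P).trans hP, by
      simp [h, MvPolynomial.smul_eval]⟩

theorem finiteDimensional_sigma (p : ℕ) : FiniteDimensional ℝ (M.sigma p) := by
  let L : (M.Elem → Fin 2 → MvPolynomial.restrictTotalDegree (Fin 2) ℝ p) →ₗ[ℝ] (M.sigma p) :=
    { toFun := fun P => ⟨fun k x => WithLp.toLp 2 fun i =>
          MvPolynomial.eval (fun j => x j) (P k i : MvPolynomial (Fin 2) ℝ), fun k i =>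
            ⟨P k i, (MvPolynomial.mem_restrictTotalDegree _ _ _).1 (P k i).2, fun x => rfl⟩⟩
      map_add' := fun P Q => by ext k x i; simp
      map_smul' := fun c P => by ext k x i; simp [MvPolynomial.smul_eval] }
  refine Module.Finite.of_surjective L ?_
  rintro ⟨τ, hτ⟩
  have hτ' : M.IsSigma p τ := hτ
  choose P hP h using hτ'
  refine ⟨fun k i => ⟨P k i, (MvPolynomial.mem_restrictTotalDegree _ _ _).2 (hP k i)⟩, ?_⟩
  ext k x i
  exact (h k i x).symm

/-- The lifting problems are well posed: if `ℓ` is linear on `Σ_{h,p}`, then `riesz p ℓ` is the one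
and only element of `Σ_{h,p}` that represents `ℓ`. -/
theorem riesz_spec (p : ℕ) (ℓ : (M.Elem → Plane → Plane) → ℝ)
    (hadd : ∀ τ ρ, M.IsSigma p τ → M.IsSigma p ρ → ℓ (τ + ρ) = ℓ τ + ℓ ρ)
    (hsmul : ∀ (c : ℝ) τ, M.IsSigma p τ → ℓ (c • τ) = c * ℓ τ) :
    (M.IsSigma p (M.riesz p ℓ) ∧ ∀ τ, M.IsSigma p τ → M.l2Inner (M.riesz p ℓ) τ = ℓ τ) ∧
    ∀ R, M.IsSigma p R → (∀ τ, M.IsSigma p τ → M.l2Inner R τ = ℓ τ) → R = M.riesz p ℓ := by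
  have hint : ∀ {τ ρ}, M.IsSigma p τ → M.IsSigma p ρ → ∀ k,
      IntegrableOn (fun x => ⟪τ k x, ρ k x⟫) (M.elem k) := fun hτ hρ k =>
    ((hτ.continuous k).inner (𝕜 := ℝ) (hρ.continuous k)).continuousOn.integrableOn_compact
      (M.isCompact_elem k)
  have hal : ∀ {τ τ' ρ}, M.IsSigma p τ → M.IsSigma p τ' → M.IsSigma p ρ →
      M.l2Inner (τ + τ') ρ = M.l2Inner τ ρ + M.l2Inner τ' ρ := by
    intro τ τ' ρ h h' h''
    simp only [l2Inner, ← Finset.sum_add_distrib]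
    refine Finset.sum_congr rfl fun k _ => ?_
    rw [← integral_add (hint h h'' k) (hint h' h'' k)]
    simp [inner_add_left]
  have hsl : ∀ (c : ℝ) (τ ρ), M.l2Inner (c • τ) ρ = c * M.l2Inner τ ρ := by
    intro c τ ρ
    simp only [l2Inner, Finset.mul_sum]
    refine Finset.sum_congr rfl fun k _ => ?_
    rw [← integral_const_mul]
    simp [real_inner_smul_left]
  have hcomm : ∀ τ ρ, M.l2Inner τ ρ = M.l2Inner ρ τ := by
    intro τ ρ; simp [l2Inner, real_inner_comm]
  have := M.finiteDimensional_sigma p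
  let b : M.sigma p →ₗ[ℝ] Module.Dual ℝ (M.sigma p) := LinearMap.mk₂ ℝ
    (fun R τ => M.l2Inner R τ) (fun R R' τ => hal R.2 R'.2 τ.2) (fun c R τ => hsl c R τ)
    (fun R τ τ' => by
      change M.l2Inner _ (_ + _) = _
      rw [hcomm, hal τ.2 τ'.2 R.2, hcomm, hcomm _ (R : M.Elem → Plane → Plane)])
    (fun c R τ => by
      change M.l2Inner _ (c • _) = _
      rw [hcomm, hsl, hcomm]; rfl)
  have hinj : Function.Injective b := by
    rw [injective_iff_map_eq_zero]
    intro R hR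
    have : M.l2Inner R R = 0 := LinearMap.congr_fun hR R
    exact Subtype.ext (IsSigma.eq_zero R.2 this)
  have hsurj : Function.Surjective b :=
    (LinearMap.injective_iff_surjective_of_finrank_eq_finrank
      Subspace.dual_finrank_eq.symm).1 hinj
  let ℓ' : Module.Dual ℝ (M.sigma p) :=
    { toFun := fun τ => ℓ τ
      map_add' := fun τ ρ => hadd _ _ τ.2 ρ.2
      map_smul' := fun c τ => hsmul c _ τ.2 }
  obtain ⟨R, hR⟩ := hsurj ℓ'
  have hex : ∃ R, M.IsSigma p R ∧ ∀ τ, M.IsSigma p τ → M.l2Inner R τ = ℓ τ :=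
    ⟨R, R.2, fun τ hτ => LinearMap.congr_fun hR ⟨τ, hτ⟩⟩
  have hspec : M.IsSigma p (M.riesz p ℓ) ∧
      ∀ τ, M.IsSigma p τ → M.l2Inner (M.riesz p ℓ) τ = ℓ τ := by
    rw [riesz, dif_pos hex]; exact hex.choose_spec
  refine ⟨hspec, fun R' h1 h2 => ?_⟩
  have : (⟨R', h1⟩ : M.sigma p) = ⟨_, hspec.1⟩ := hinj <| by
    ext τ; exact (h2 _ τ.2).trans (hspec.2 _ τ.2).symm
  exact congrArg Subtype.val this

end Mesh

end DG

end

noncomputable section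

namespace DG

/-! Lifting constants. On polynomials of bounded degree all norms are equivalent, so scaling to a
unit configuration gives a discrete trace inequality whose constant depends only on `σ` and `p`
(`exists_trace_bound`). Testing `r^e(φ)` with itself and absorbing half of its square norm bounds it
by the scaled `L²` norm of `φ` on the edge; `l` is treated in the same way.

Coercivity. By the mean value theorem, `a(z)·z ≥ λ|z|²` and `(a(z) - a(w))·(z - w) ≤ Λ|z - w|²`.
With `r = θ - ∇v` the volume terms of SIPG and BR2 equal `a(θ)·θ - (a(θ) - a(∇v))·r`, hence are at
least `λ|θ|² - Λ|r|²`. Each `r^e` lives on the elements at `e`, so `‖r‖² ≤ N ∑ ‖r^e‖²`, and this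
loss is beaten by the penalty under the stated thresholds. In LDG both terms are already
nonnegative. The gradient is recovered from `θ` by subtracting the liftings. Stability then follows
by testing with `u_h`.

Continuity of the linear form amounts to a Poincaré–Friedrichs inequality on `V(h)`, proved without
compactness. Let `G` be the span of the gradients of test functions in `L²`, so that `Gᗮᗮ` is its
closure. If `∇_h v` lies in `Gᗮᗮ`, it is orthogonal to every rotated gradient of a bump at an edge,
since gradients are; integrating by parts on the two half-discs shows that the jump of `v` is
constant along the edge. If the edge means of the jumps vanish too, `v` has no jumps, and for a test
function `ψ` integrating `∂_d(⟪d, x⟫ (v - ψ)²)` along lines gives the Poincaré inequality for `v -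
ψ` (`exists_poincare`). A limit in `ψ` replaces it by a function of `H² ∩ H₀¹`. The remaining
directions of `V_{h,q}` are finitely many and are controlled by the projection of `∇_h v` onto `Gᗮ`
and by the edge means (`exists_bound_add`). The edge means are in turn controlled by `r^e`, because
constants belong to `Σ_{h,p}` for every `p` (`exists_meanJump_bound`). -/

/-! ### Polynomials of bounded degree and the scaled trace inequality -/

theorem IsPoly.zero (k : ℕ) : IsPoly k 0 := ⟨0, by simp, by simp⟩

theorem IsPoly.const (k : ℕ) (c : ℝ) : IsPoly k fun _ => c :=
  ⟨MvPolynomial.C c, by simp, by simp⟩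

theorem IsPoly.add {k : ℕ} {f g : Plane → ℝ} (hf : IsPoly k f) (hg : IsPoly k g) :
    IsPoly k (f + g) := by
  obtain ⟨P, hP, h⟩ := hf
  obtain ⟨Q, hQ, h'⟩ := hg
  exact ⟨P + Q, (MvPolynomial.totalDegree_add P Q).trans (max_le hP hQ), by simp [h, h']⟩

theorem IsPoly.smul {k : ℕ} {f : Plane → ℝ} (hf : IsPoly k f) (c : ℝ) : IsPoly k (c • f) := by
  obtain ⟨P, hP, h⟩ := hf
  exact ⟨c • P, (MvPolynomial.totalDegree_smul_le c P).trans hP, by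
    simp [h, MvPolynomial.smul_eval]⟩

theorem IsPoly.sub {k : ℕ} {f g : Plane → ℝ} (hf : IsPoly k f) (hg : IsPoly k g) :
    IsPoly k (f - g) := by
  have := hf.add (hg.smul (-1))
  rwa [neg_one_smul, ← sub_eq_add_neg] at this

theorem IsPoly.contDiff {k : ℕ} {f : Plane → ℝ} (hf : IsPoly k f) : ContDiff ℝ ∞ f := by
  obtain ⟨P, -, h⟩ := hf
  have : f = fun x : Plane => MvPolynomial.aeval (fun i => x i) P := by
    ext x; rw [h x, MvPolynomial.aeval_eq_eval]
  have han : AnalyticOnNhd ℝ f univ := by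
    rw [this]
    refine AnalyticOnNhd.aeval_mvPolynomial (fun i => ?_) P
    exact fun x _ => (EuclideanSpace.proj (𝕜 := ℝ) i : Plane →L[ℝ] ℝ).analyticAt x
  exact contDiffOn_univ.1 han.contDiffOn_of_completeSpace

/-- Polynomials of bounded degree are invariant under scalings and translations. -/
theorem IsPoly.comp_affine {k : ℕ} {f : Plane → ℝ} (hf : IsPoly k f) (c : Plane) (r : ℝ) :
    IsPoly k fun x => f (c + r • x) := by
  obtain ⟨P, hP, h⟩ := hf
  let s : Fin 2 → MvPolynomial (Fin 2) ℝ := fun i =>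
    MvPolynomial.C (c i) + MvPolynomial.C r * MvPolynomial.X i
  have hs : ∀ i, (s i).totalDegree ≤ 1 := fun i => by
    refine (MvPolynomial.totalDegree_add _ _).trans (max_le (by simp) ?_)
    refine (MvPolynomial.totalDegree_mul _ _).trans ?_
    simp
  refine ⟨MvPolynomial.bind₁ s P, ?_, fun x => ?_⟩
  · rw [MvPolynomial.as_sum P, map_sum]
    refine MvPolynomial.totalDegree_finsetSum_le fun m hm => ?_
    rw [MvPolynomial.bind₁_monomial]
    refine (MvPolynomial.totalDegree_mul _ _).trans ?_
    rw [MvPolynomial.totalDegree_C, zero_add]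
    refine (MvPolynomial.totalDegree_finsetProd _ _).trans ?_
    refine le_trans (Finset.sum_le_sum fun i _ => ?_)
      ((MvPolynomial.le_totalDegree hm).trans hP)
    refine (MvPolynomial.totalDegree_pow _ _).trans ?_
    simpa using Nat.mul_le_mul_left (m i) (hs i)
  · simp only
    rw [h, ← MvPolynomial.aeval_eq_eval (fun i => x i), MvPolynomial.aeval_bind₁,
      MvPolynomial.aeval_eq_eval]
    congr 2
    ext i
    simp [s, MvPolynomial.aeval_eq_eval]

/-- The polynomial functions of total degree at most `k`. -/
def polyFun (k : ℕ) : Submodule ℝ (Plane → ℝ) where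
  carrier := {f | IsPoly k f}
  zero_mem' := IsPoly.zero k
  add_mem' := IsPoly.add
  smul_mem' := fun c _ hf => hf.smul c

theorem finiteDimensional_polyFun (k : ℕ) : FiniteDimensional ℝ (polyFun k) := by
  let L : MvPolynomial.restrictTotalDegree (Fin 2) ℝ k →ₗ[ℝ] polyFun k :=
    { toFun := fun P => ⟨fun x => MvPolynomial.eval (fun j => x j) (P : MvPolynomial (Fin 2) ℝ),
        ⟨P, (MvPolynomial.mem_restrictTotalDegree _ _ _).1 P.2, fun x => rfl⟩⟩
      map_add' := fun P Q => by ext x; simp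
      map_smul' := fun c P => by ext x; simp [MvPolynomial.smul_eval] }
  refine Module.Finite.of_surjective L ?_
  rintro ⟨f, P, hP, h⟩
  exact ⟨⟨P, (MvPolynomial.mem_restrictTotalDegree _ _ _).2 hP⟩, by ext x; exact (h x).symm⟩

/-- The square of the norm of an `L²` function. -/
theorem norm_toLp_sq {α F : Type*} [MeasurableSpace α] {m : Measure α} [NormedAddCommGroup F]
    [InnerProductSpace ℝ F] {f : α → F} (hf : MemLp f 2 m) :
    ‖hf.toLp f‖ ^ 2 = ∫ x, ‖f x‖ ^ 2 ∂m := by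
  rw [← real_inner_self_eq_norm_sq, L2.inner_def]
  refine integral_congr_ae ?_
  filter_upwards [hf.coeFn_toLp] with x hx
  rw [hx, real_inner_self_eq_norm_sq]

theorem memLp_of_continuous {F : Type*} [NormedAddCommGroup F]
    {f : Plane → F} (hf : Continuous f) {K : Set Plane} (hK : IsCompact K) :
    MemLp f 2 (volume.restrict K) := by
  have : IsFiniteMeasure (volume.restrict K) := ⟨by simpa using hK.measure_lt_top⟩
  obtain ⟨C, hC⟩ := hK.exists_bound_of_continuousOn hf.continuousOn
  have hK' := hK.measurableSet
  exact MemLp.of_bound hf.aestronglyMeasurable C ((ae_restrict_iff' hK').2 (Eventually.of_forall hC))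

/-- A linear map on a finite-dimensional space is controlled by any injective one. -/
theorem exists_bound_of_injective {V E F : Type*} [AddCommGroup V] [Module ℝ V]
    [FiniteDimensional ℝ V] [NormedAddCommGroup E] [NormedSpace ℝ E] [NormedAddCommGroup F]
    [NormedSpace ℝ F] (S : V →ₗ[ℝ] E) (hS : Function.Injective S) (T : V →ₗ[ℝ] F) :
    ∃ C, 0 < C ∧ ∀ v, ‖T v‖ ≤ C * ‖S v‖ := by
  let g := (LinearEquiv.ofInjective S hS).symm
  have : FiniteDimensional ℝ (LinearMap.range S) := inferInstance
  let A := LinearMap.toContinuousLinearMap (T ∘ₗ g.toLinearMap)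
  refine ⟨‖A‖ + 1, by positivity, fun v => ?_⟩
  have h1 := A.le_opNorm (LinearEquiv.ofInjective S hS v)
  have h2 : A (LinearEquiv.ofInjective S hS v) = T v := by simp [A, g]
  rw [h2] at h1
  refine h1.trans ?_
  have : ‖LinearEquiv.ofInjective S hS v‖ = ‖S v‖ := rfl
  rw [this]
  nlinarith [norm_nonneg (S v)]

/-- On polynomials of bounded degree, the maximum over the unit ball is controlled by the mean
square over a smaller ball. -/
theorem exists_sup_bound (p : ℕ) {σ : ℝ} (hσ : 0 < σ) : ∃ C, 0 < C ∧ ∀ f, IsPoly p f →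
    ∀ x ∈ Metric.closedBall (0 : Plane) 1,
      f x ^ 2 ≤ C * ∫ y in Metric.closedBall (0 : Plane) σ, f y ^ 2 := by
  have hK : IsCompact (Metric.closedBall (0 : Plane) σ) := isCompact_closedBall _ _
  have := finiteDimensional_polyFun p
  have hm : ∀ f : polyFun p, MemLp f.1 2 (volume.restrict (Metric.closedBall (0 : Plane) σ)) :=
    fun f => memLp_of_continuous f.2.continuous hK
  let S : polyFun p →ₗ[ℝ] Lp ℝ 2 (volume.restrict (Metric.closedBall (0 : Plane) σ)) :=
    { toFun := fun f => (hm f).toLp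
      map_add' := fun f g => MemLp.toLp_add (hm f) (hm g)
      map_smul' := fun c f => MemLp.toLp_const_smul c (hm f) }
  let B := Metric.closedBall (0 : Plane) 1
  have : CompactSpace B := isCompact_iff_compactSpace.1 (isCompact_closedBall _ _)
  let T : polyFun p →ₗ[ℝ] C(B, ℝ) :=
    { toFun := fun f => ⟨fun x => f.1 x, f.2.continuous.comp continuous_subtype_val⟩
      map_add' := fun f g => rfl
      map_smul' := fun c f => rfl }
  -- A polynomial that vanishes almost everywhere on a ball of positive radius vanishes identically,
  -- so the mean square is a norm.
  have hS : Function.Injective S := by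
    rw [injective_iff_map_eq_zero]
    rintro ⟨f, hf⟩ h0
    have h1 : f =ᵐ[volume.restrict (Metric.closedBall (0 : Plane) σ)] 0 :=
      ((hm ⟨f, hf⟩).toLp_eq_toLp_iff MemLp.zero).1 (h0.trans (MemLp.toLp_zero _).symm)
    have h2 := Measure.eqOn_open_of_ae_eq
      (ae_restrict_of_ae_restrict_of_subset Metric.ball_subset_closedBall h1)
      Metric.isOpen_ball hf.continuous.continuousOn continuousOn_const
    exact Subtype.ext (IsPoly.eq_zero hf Metric.isOpen_ball ⟨0, by simpa using hσ⟩ h2)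
  obtain ⟨C, hC, h⟩ := exists_bound_of_injective S hS T
  refine ⟨C ^ 2, by positivity, fun f hf x hx => ?_⟩
  have h1 := h ⟨f, hf⟩
  have h2 : |f x| ≤ ‖T ⟨f, hf⟩‖ := (T ⟨f, hf⟩).norm_coe_le_norm ⟨x, hx⟩
  have h3 := norm_toLp_sq (hm ⟨f, hf⟩)
  simp only [Real.norm_eq_abs, sq_abs] at h3
  rw [← h3, ← mul_pow, ← sq_abs]
  exact pow_le_pow_left₀ (abs_nonneg _) (h2.trans h1) 2

/-- Discrete trace inequality: on a set of diameter `d` containing a disc of radius `σ d`,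
a polynomial on a segment is controlled by its mean square. -/
theorem exists_trace_bound (p : ℕ) {σ : ℝ} (hσ : 0 < σ) : ∃ C, 0 < C ∧
    ∀ (K : Set Plane) (c : Plane), IsCompact K → 0 < Metric.diam K →
      Metric.closedBall c (σ * Metric.diam K) ⊆ K → ∀ f, IsPoly p f → ∀ x ∈ K, ∀ d,
      0 ≤ d → d ≤ Metric.diam K → d ^ 2 * f x ^ 2 ≤ C * ∫ y in K, f y ^ 2 := by
  obtain ⟨C, hC, h⟩ := exists_sup_bound p hσ
  refine ⟨C, hC, fun K c hK hD hcK f hf x hx d hd hdD => ?_⟩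
  set D := Metric.diam K
  -- Scaling by the diameter: since `c ∈ K`, the set `D⁻¹ • (K - c)` lies in the unit ball, and the
  -- disc in `K` becomes the ball of radius `σ` about the origin.
  have h1 := h _ (hf.comp_affine c D) (D⁻¹ • (x - c)) (by
    rw [mem_closedBall_zero_iff, norm_smul, norm_inv, Real.norm_of_nonneg hD.le,
      inv_mul_le_one₀ hD, ← dist_eq_norm]
    exact Metric.dist_le_diam_of_mem hK.isBounded hx
      (hcK (Metric.mem_closedBall_self (by positivity))))
  rw [smul_inv_smul₀ hD.ne', add_sub_cancel] at h1
  -- The Jacobian in the plane is `D ^ 2`, which is why the trace bound carries the factor `d ^ 2`.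
  have h2 : ∫ y in Metric.closedBall (0 : Plane) σ, f (c + D • y) ^ 2 =
      (D ^ 2)⁻¹ * ∫ y in Metric.closedBall c (σ * D), f y ^ 2 := by
    rw [← integral_indicator measurableSet_closedBall, ← integral_indicator
      measurableSet_closedBall]
    have e1 := Measure.integral_comp_smul (volume : Measure Plane)
      (fun y => (Metric.closedBall c (σ * D)).indicator (fun y => f y ^ 2) (c + y)) D
    have e2 := integral_add_left_eq_self (μ := (volume : Measure Plane))
      (fun y => (Metric.closedBall c (σ * D)).indicator (fun y => f y ^ 2) y) c
    rw [e2] at e1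
    simp only [finrank_euclideanSpace, Fintype.card_fin, abs_of_pos (inv_pos.2 (pow_pos hD 2)),
      smul_eq_mul] at e1
    rw [← e1]
    refine integral_congr_ae (Eventually.of_forall fun y => ?_)
    simp only [indicator, Metric.mem_closedBall, dist_eq_norm, sub_zero, add_sub_cancel_left,
      norm_smul, Real.norm_of_nonneg hD.le, mul_comm σ D, mul_le_mul_iff_right₀ hD]
  have h3 : ∫ y in Metric.closedBall c (σ * D), f y ^ 2 ≤ ∫ y in K, f y ^ 2 :=
    setIntegral_mono_set ((hf.continuous.pow 2).continuousOn.integrableOn_compact hK)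
      (Eventually.of_forall fun y => sq_nonneg _) hcK.eventuallyLE
  rw [h2] at h1
  have hd2 : d ^ 2 ≤ D ^ 2 := pow_le_pow_left₀ hd hdD 2
  calc d ^ 2 * f x ^ 2 ≤ D ^ 2 * f x ^ 2 := by gcongr
    _ ≤ D ^ 2 * (C * ((D ^ 2)⁻¹ * ∫ y in Metric.closedBall c (σ * D), f y ^ 2)) := by gcongr
    _ = C * ∫ y in Metric.closedBall c (σ * D), f y ^ 2 := by field_simp
    _ ≤ _ := by gcongr

/-! ### Edge integrals, traces and the algebra of the liftings -/

namespace Mesh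

variable {Ω : Set Plane} (M : Mesh Ω)

theorem len_pos (e : M.Edge) : 0 < M.len e := dist_pos.2 (M.src_ne_tgt e)

/-- The point `(1 - t) src e + t tgt e` of the edge `e`. -/
def edgePt (e : M.Edge) (t : ℝ) : Plane := AffineMap.lineMap (M.src e) (M.tgt e) t

theorem continuous_edgePt (e : M.Edge) : Continuous (M.edgePt e) :=
  AffineMap.lineMap_continuous

theorem edgePt_mem (e : M.Edge) {t : ℝ} (ht : t ∈ Icc (0 : ℝ) 1) :
    M.edgePt e t ∈ segment ℝ (M.src e) (M.tgt e) := by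
  rw [segment_eq_image_lineMap]; exact ⟨t, ht, rfl⟩

theorem edgeInt_def (e : M.Edge) (g : Plane → ℝ) :
    M.edgeInt e g = M.len e * ∫ t in (0 : ℝ)..1, g (M.edgePt e t) := rfl

variable {M}

theorem intervalIntegrable_edge {e : M.Edge} {g : Plane → ℝ} (hg : Continuous g) :
    IntervalIntegrable (fun t => g (M.edgePt e t)) volume 0 1 :=
  (hg.comp (M.continuous_edgePt e)).intervalIntegrable 0 1

theorem edgeInt_add {e : M.Edge} {f g : Plane → ℝ} (hf : Continuous f) (hg : Continuous g) :
    M.edgeInt e (fun x => f x + g x) = M.edgeInt e f + M.edgeInt e g := by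
  simp only [edgeInt_def]
  rw [intervalIntegral.integral_add (intervalIntegrable_edge hf) (intervalIntegrable_edge hg),
    mul_add]

theorem edgeInt_const_mul (e : M.Edge) (c : ℝ) (g : Plane → ℝ) :
    M.edgeInt e (fun x => c * g x) = c * M.edgeInt e g := by
  simp only [edgeInt_def]
  rw [intervalIntegral.integral_const_mul]
  ring

theorem edgeInt_const (e : M.Edge) (c : ℝ) : M.edgeInt e (fun _ => c) = M.len e * c := by
  simp [edgeInt_def]

theorem edgeInt_mono {e : M.Edge} {f g : Plane → ℝ} (hf : Continuous f) (hg : Continuous g)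
    (h : ∀ x ∈ segment ℝ (M.src e) (M.tgt e), f x ≤ g x) : M.edgeInt e f ≤ M.edgeInt e g := by
  refine mul_le_mul_of_nonneg_left ?_ (M.len_pos e).le
  exact intervalIntegral.integral_mono_on zero_le_one (intervalIntegrable_edge hf)
    (intervalIntegrable_edge hg) fun t ht => h _ (M.edgePt_mem e ht)

theorem edgeInt_congr {e : M.Edge} {f g : Plane → ℝ}
    (h : ∀ x ∈ segment ℝ (M.src e) (M.tgt e), f x = g x) : M.edgeInt e f = M.edgeInt e g := by
  rw [edgeInt_def, edgeInt_def]
  congr 1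
  refine intervalIntegral.integral_congr fun t ht => ?_
  rw [uIcc_of_le zero_le_one] at ht
  exact h _ (M.edgePt_mem e ht)

theorem edgeInt_nonneg {e : M.Edge} {f : Plane → ℝ} (h : ∀ x, 0 ≤ f x) : 0 ≤ M.edgeInt e f :=
  mul_nonneg (M.len_pos e).le
    (intervalIntegral.integral_nonneg zero_le_one fun _ _ => h _)

/-- Young's inequality on an edge, for integrands `h` with `|h| ≤ f y` and `h_e² y² ≤ D`. -/
theorem neg_edgeInt_le {e : M.Edge} {h f : Plane → ℝ} {D c : ℝ} (hh : Continuous h)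
    (hf : Continuous f) (hc : 0 < c)
    (H : ∀ x ∈ segment ℝ (M.src e) (M.tgt e), ∃ y, |h x| ≤ f x * y ∧ M.len e ^ 2 * y ^ 2 ≤ D) :
    -M.edgeInt e h ≤ c / 2 * ((M.len e)⁻¹ * M.edgeInt e fun x => f x ^ 2) + D / (2 * c) := by
  have hl := M.len_pos e
  have h1 : M.edgeInt e (fun x => (-1) * h x) ≤
      M.edgeInt e (fun x => c / 2 * (M.len e)⁻¹ * f x ^ 2 + D / (2 * c) * (M.len e)⁻¹) := by
    refine edgeInt_mono (by fun_prop) (by fun_prop) fun x hx => ?_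
    obtain ⟨y, hy, hD⟩ := H x hx
    -- The weights are scaled with `h_e` so that, after integration over an edge of length `h_e`,
    -- the second term becomes `D / (2 * c)`.
    have h2 : f x * y ≤ c / 2 * (M.len e)⁻¹ * f x ^ 2 + M.len e / (2 * c) * y ^ 2 := by
      have : 0 ≤ (c * f x - M.len e * y) ^ 2 / (2 * c * M.len e) := by positivity
      have h3 : (c * f x - M.len e * y) ^ 2 / (2 * c * M.len e) =
        c / 2 * (M.len e)⁻¹ * f x ^ 2 + M.len e / (2 * c) * y ^ 2 - f x * y := by
        field_simp; ring
      linarith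
    have h4 : M.len e / (2 * c) * y ^ 2 ≤ D / (2 * c) * (M.len e)⁻¹ := by
      have : M.len e / (2 * c) * y ^ 2 = (M.len e ^ 2 * y ^ 2) / (2 * c) * (M.len e)⁻¹ := by
        field_simp
      rw [this]; gcongr
    linarith [neg_abs_le (h x)]
  rw [edgeInt_const_mul, edgeInt_add (by fun_prop) (by fun_prop), edgeInt_const_mul,
    edgeInt_const] at h1
  have : M.len e * (D / (2 * c) * (M.len e)⁻¹) = D / (2 * c) := by field_simp
  rw [this] at h1
  linarith

/-! ### Traces -/

theorem continuous_jump {w : M.Elem → Plane → ℝ} (hw : ∀ k, Continuous (w k)) (e : M.Edge) :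
    Continuous (M.jump w e) := by
  unfold jump
  split
  · exact (hw _).smul continuous_const
  · exact ((hw _).smul continuous_const).add ((hw _).smul continuous_const)

theorem continuous_avg {τ : M.Elem → Plane → Plane} (h : ∀ k, Continuous (τ k)) (e : M.Edge) :
    Continuous (M.avg τ e) := by
  unfold avg
  split
  · exact h _
  · exact ((h _).add (h _)).const_smul (1 / 2 : ℝ)

theorem continuous_jumpNormal {τ : M.Elem → Plane → Plane} (h : ∀ k, Continuous (τ k))
    (e : M.Edge) : Continuous (M.jumpNormal τ e) := by
  unfold jumpNormal
  split
  · exact (h _).inner continuous_const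
  · exact ((h _).inner continuous_const).add ((h _).inner continuous_const)

theorem avg_add (τ ρ : M.Elem → Plane → Plane) (e : M.Edge) (x : Plane) :
    M.avg (τ + ρ) e x = M.avg τ e x + M.avg ρ e x := by
  unfold avg; split <;> simp only [Pi.add_apply]; module

theorem avg_smul (c : ℝ) (τ : M.Elem → Plane → Plane) (e : M.Edge) (x : Plane) :
    M.avg (c • τ) e x = c • M.avg τ e x := by
  unfold avg; split <;> simp only [Pi.smul_apply]; module

theorem jumpNormal_add (τ ρ : M.Elem → Plane → Plane) (e : M.Edge) (x : Plane) :
    M.jumpNormal (τ + ρ) e x = M.jumpNormal τ e x + M.jumpNormal ρ e x := by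
  unfold jumpNormal; split <;> simp only [Pi.add_apply, inner_add_left]; ring

theorem jumpNormal_smul (c : ℝ) (τ : M.Elem → Plane → Plane) (e : M.Edge) (x : Plane) :
    M.jumpNormal (c • τ) e x = c * M.jumpNormal τ e x := by
  unfold jumpNormal; split <;> simp only [Pi.smul_apply, real_inner_smul_left]; ring

theorem IsV.continuous {q : ℕ} {v : M.Elem → Plane → ℝ} (hv : M.IsV q v) (k : M.Elem) :
    Continuous (v k) := (hv k).continuous

theorem continuous_gradient {f : Plane → ℝ} (hf : ContDiff ℝ ∞ f) : Continuous (gradient f) := by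
  unfold gradient
  exact (LinearIsometryEquiv.continuous _).comp (hf.continuous_fderiv (by simp))

theorem IsV.continuous_grad {q : ℕ} {v : M.Elem → Plane → ℝ} (hv : M.IsV q v) (k : M.Elem) :
    Continuous (M.grad v k) := continuous_gradient (hv k).contDiff

/-! ### The inner product -/

theorem integrableOn_elem {F : Type*} [NormedAddCommGroup F] {f : Plane → F} (hf : Continuous f)
    (k : M.Elem) : IntegrableOn f (M.elem k) :=
  hf.continuousOn.integrableOn_compact (M.isCompact_elem k)

theorem l2Norm_nonneg (τ : M.Elem → Plane → Plane) : 0 ≤ M.l2Norm τ := Real.sqrt_nonneg _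

theorem l2Norm_sq (τ : M.Elem → Plane → Plane) :
    M.l2Norm τ ^ 2 = ∑ k, ∫ x in M.elem k, ‖τ k x‖ ^ 2 :=
  Real.sq_sqrt (Finset.sum_nonneg fun _ _ => integral_nonneg fun _ => sq_nonneg _)

theorem l2Norm_sq_eq_l2Inner (τ : M.Elem → Plane → Plane) : M.l2Norm τ ^ 2 = M.l2Inner τ τ := by
  rw [l2Norm_sq, l2Inner]; simp only [real_inner_self_eq_norm_sq]

theorem l2Inner_add_left {τ τ' ρ : M.Elem → Plane → Plane} (h : ∀ k, Continuous (τ k))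
    (h' : ∀ k, Continuous (τ' k)) (hρ : ∀ k, Continuous (ρ k)) :
    M.l2Inner (τ + τ') ρ = M.l2Inner τ ρ + M.l2Inner τ' ρ := by
  simp only [l2Inner, ← Finset.sum_add_distrib]
  refine Finset.sum_congr rfl fun k _ => ?_
  rw [← integral_add (integrableOn_elem ((h k).inner (hρ k)) k)
    (integrableOn_elem ((h' k).inner (hρ k)) k)]
  simp [inner_add_left]

theorem l2Inner_zero_left (ρ : M.Elem → Plane → Plane) : M.l2Inner 0 ρ = 0 := by
  simp [l2Inner]

theorem l2Inner_sum_left {ι : Type*} (s : Finset ι) {τ : ι → M.Elem → Plane → Plane}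
    {ρ : M.Elem → Plane → Plane} (h : ∀ i k, Continuous (τ i k)) (hρ : ∀ k, Continuous (ρ k)) :
    M.l2Inner (∑ i ∈ s, τ i) ρ = ∑ i ∈ s, M.l2Inner (τ i) ρ := by
  classical
  induction s using Finset.induction_on with
  | empty => simp [l2Inner_zero_left]
  | insert i s hi ih =>
    rw [Finset.sum_insert hi, Finset.sum_insert hi, l2Inner_add_left (h i) _ hρ, ih]
    intro k
    rw [Finset.sum_apply]
    have : (∑ j ∈ s, τ j k) = fun x => ∑ j ∈ s, τ j k x := by ext1 x; simp
    rw [this]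
    exact continuous_finsetSum _ fun j _ => h j k

theorem l2Norm_sq_mono {τ : M.Elem → Plane → Plane} {κ : M.Elem → Plane → ℝ}
    (h : ∀ k, Continuous (τ k)) (hκ : ∀ k, Continuous (κ k))
    (H : ∀ k x, ‖τ k x‖ ^ 2 ≤ κ k x) : M.l2Norm τ ^ 2 ≤ ∑ k, ∫ x in M.elem k, κ k x := by
  rw [l2Norm_sq]
  refine Finset.sum_le_sum fun k _ => integral_mono (integrableOn_elem ((h k).norm.pow 2) k)
    (integrableOn_elem (hκ k) k) (H k)

/-! ### The liftings -/

theorem liftREdge_spec (p : ℕ) (e : M.Edge) {φ : Plane → Plane} (hφ : Continuous φ) :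
    (M.IsSigma p (M.liftREdge p e φ) ∧ ∀ τ, M.IsSigma p τ → M.l2Inner (M.liftREdge p e φ) τ =
      -M.edgeInt e fun x => ⟪φ x, M.avg τ e x⟫) ∧
    ∀ R, M.IsSigma p R → (∀ τ, M.IsSigma p τ → M.l2Inner R τ =
      -M.edgeInt e fun x => ⟪φ x, M.avg τ e x⟫) → R = M.liftREdge p e φ := by
  refine M.riesz_spec p _ (fun τ _ hτ hρ => ?_) fun _ τ hτ => ?_
  · simp only [avg_add, inner_add_right]
    rw [edgeInt_add (hφ.inner (continuous_avg hτ.continuous e))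
      (hφ.inner (continuous_avg hρ.continuous e)), neg_add]
  · simp only [avg_smul, real_inner_smul_right]
    rw [edgeInt_const_mul, mul_neg]

theorem liftR_spec (p : ℕ) {φ : M.Edge → Plane → Plane} (hφ : ∀ e, Continuous (φ e)) :
    (M.IsSigma p (M.liftR p φ) ∧ ∀ τ, M.IsSigma p τ → M.l2Inner (M.liftR p φ) τ =
      -∑ e, M.edgeInt e fun x => ⟪φ e x, M.avg τ e x⟫) ∧
    ∀ R, M.IsSigma p R → (∀ τ, M.IsSigma p τ → M.l2Inner R τ =
      -∑ e, M.edgeInt e fun x => ⟪φ e x, M.avg τ e x⟫) → R = M.liftR p φ := by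
  refine M.riesz_spec p _ (fun τ _ hτ hρ => ?_) fun _ τ hτ => ?_
  · rw [← neg_add, ← Finset.sum_add_distrib]
    congr 1
    refine Finset.sum_congr rfl fun e _ => ?_
    simp only [avg_add, inner_add_right]
    rw [edgeInt_add ((hφ e).inner (continuous_avg hτ.continuous e))
      ((hφ e).inner (continuous_avg hρ.continuous e))]
  · rw [mul_neg, Finset.mul_sum]
    simp only [avg_smul, real_inner_smul_right, edgeInt_const_mul]

theorem liftL_spec (p : ℕ) {φ : M.Edge → Plane → ℝ} (hφ : ∀ e, Continuous (φ e)) :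
    M.IsSigma p (M.liftL p φ) ∧ ∀ τ, M.IsSigma p τ → M.l2Inner (M.liftL p φ) τ =
      -∑ e, if (M.right e).isSome then M.edgeInt e fun x => φ e x * M.jumpNormal τ e x else 0 := by
  refine (M.riesz_spec p _ (fun τ ρ hτ hρ => ?_) fun c τ hτ => ?_).1
  · rw [← neg_add, ← Finset.sum_add_distrib]
    congr 1
    refine Finset.sum_congr rfl fun e _ => ?_
    simp only [jumpNormal_add, mul_add]
    rw [edgeInt_add (f := fun x => φ e x * M.jumpNormal τ e x)
      (g := fun x => φ e x * M.jumpNormal ρ e x)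
      ((hφ e).mul (continuous_jumpNormal hτ.continuous e))
      ((hφ e).mul (continuous_jumpNormal hρ.continuous e))]
    split <;> simp
  · rw [mul_neg, Finset.mul_sum]
    congr 1
    refine Finset.sum_congr rfl fun e _ => ?_
    have : ∀ x, φ e x * M.jumpNormal (c • τ) e x = c * (φ e x * M.jumpNormal τ e x) := fun x => by
      rw [jumpNormal_smul]; ring
    simp only [this, edgeInt_const_mul]
    split <;> simp

/-- The sum of the edge liftings solves the problem that defines `r`, and that problem has only one
solution. -/
theorem liftR_eq_sum (p : ℕ) {φ : M.Edge → Plane → Plane} (hφ : ∀ e, Continuous (φ e)) :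
    M.liftR p φ = ∑ e, M.liftREdge p e (φ e) := by
  have hs := fun e => (liftREdge_spec p e (hφ e)).1
  refine ((liftR_spec p hφ).2 _ ((M.sigma p).sum_mem fun e _ => (hs e).1) fun τ hτ => ?_).symm
  rw [l2Inner_sum_left _ (fun e => (hs e).1.continuous) hτ.continuous, ← Finset.sum_neg_distrib]
  exact Finset.sum_congr rfl fun e _ => (hs e).2 τ hτ

theorem isSigma_ite {p : ℕ} {τ : M.Elem → Plane → Plane} (h : M.IsSigma p τ) (P : M.Elem → Prop)
    [DecidablePred P] : M.IsSigma p fun k => if P k then τ k else 0 := by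
  intro k i
  by_cases hk : P k
  · simpa [hk] using h k i
  · simpa [hk] using IsPoly.const p 0

/-- The lifting `r^e` is supported in the elements that have the edge `e`. -/
theorem liftREdge_eq_zero (p : ℕ) (e : M.Edge) {φ : Plane → Plane} (hφ : Continuous φ) {k : M.Elem}
    (hk : e ∉ M.edgesOf k) : M.liftREdge p e φ k = 0 := by
  classical
  obtain ⟨⟨h1, h2⟩, h3⟩ := liftREdge_spec p e hφ
  -- Truncating `r^e` to the elements at `e` gives another solution of its defining problem: moving
  -- the truncation to `τ` does not change `{τ}` on `e`. Uniqueness makes the truncation equal to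
  -- `r^e`.
  have := h3 _ (isSigma_ite h1 fun k => e ∈ M.edgesOf k) fun τ hτ => ?_
  · rw [← congrFun this k, if_neg hk]
  · have h4 := h2 _ (isSigma_ite hτ fun k => e ∈ M.edgesOf k)
    have h5 : M.avg (fun k => if e ∈ M.edgesOf k then τ k else 0) e = M.avg τ e := by
      ext1 x
      unfold avg
      split
      · simp [edgesOf]
      · next k hk => simp [edgesOf, hk]
    rw [h5] at h4
    rw [← h4]
    simp only [l2Inner]
    refine Finset.sum_congr rfl fun k _ => ?_
    by_cases hk : e ∈ M.edgesOf k <;> simp [hk]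

/-- On one element at most `N` edge liftings are nonzero, so the Cauchy–Schwarz inequality costs a
factor `N` and not the number of all edges. This `N` is the one in the thresholds of SIPG and BR2.
-/
theorem l2Norm_liftR_sq_le (p : ℕ) {N : ℕ} (hN : M.EdgeBound N) {φ : M.Edge → Plane → Plane}
    (hφ : ∀ e, Continuous (φ e)) :
    M.l2Norm (M.liftR p φ) ^ 2 ≤ N * ∑ e, M.l2Norm (M.liftREdge p e (φ e)) ^ 2 := by
  classical
  have hc : ∀ e k, Continuous (M.liftREdge p e (φ e) k) := fun e =>
    (liftREdge_spec p e (hφ e)).1.1.continuous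
  simp only [l2Norm_sq]
  rw [Finset.sum_comm, Finset.mul_sum]
  refine Finset.sum_le_sum fun k _ => ?_
  rw [← integral_finsetSum _ fun e _ =>
      integrableOn_elem (f := fun x => ‖M.liftREdge p e (φ e) k x‖ ^ 2) ((hc e k).norm.pow 2) k,
    ← integral_const_mul]
  refine integral_mono
    (integrableOn_elem (((liftR_spec p hφ).1.1.continuous k).norm.pow 2) k)
    (integrableOn_elem (continuous_const.mul
      (continuous_finsetSum _ fun e _ => (hc e k).norm.pow 2)) k) fun x => ?_
  simp only [liftR_eq_sum p hφ, Finset.sum_apply]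
  let s : Finset M.Edge := Finset.univ.filter fun e => e ∈ M.edgesOf k
  have hs : s.card ≤ N := by
    have h0 := hN k
    rwa [← Set.ncard_coe_finset, show (s : Set M.Edge) = M.edgesOf k by ext e; simp [s]]
  have h1 : ∑ e, M.liftREdge p e (φ e) k x = ∑ e ∈ s, M.liftREdge p e (φ e) k x := by
    refine (Finset.sum_subset (Finset.subset_univ s) fun e _ he => ?_).symm
    rw [liftREdge_eq_zero p e (hφ e) (by simpa [s] using he)]; rfl
  calc ‖∑ e, M.liftREdge p e (φ e) k x‖ ^ 2
      ≤ (∑ e ∈ s, ‖M.liftREdge p e (φ e) k x‖) ^ 2 := by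
        rw [h1]; exact pow_le_pow_left₀ (norm_nonneg _) (norm_sum_le _ _) 2
    _ ≤ s.card * ∑ e ∈ s, ‖M.liftREdge p e (φ e) k x‖ ^ 2 := sq_sum_le_card_mul_sum_sq
    _ ≤ N * ∑ e, ‖M.liftREdge p e (φ e) k x‖ ^ 2 := by
        refine mul_le_mul (by exact_mod_cast hs) ?_ (by positivity) (by positivity)
        exact Finset.sum_le_sum_of_subset_of_nonneg (Finset.subset_univ s) fun _ _ _ => by positivity

end Mesh

/-! ### Discrete trace constants and bounds for the liftings -/

namespace Mesh

variable {Ω : Set Plane} {M : Mesh Ω}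

theorem len_le_diam {e : M.Edge} {k : M.Elem} (hk : e ∈ M.edgesOf k) :
    M.len e ≤ Metric.diam (M.elem k) := by
  have hs : segment ℝ (M.src e) (M.tgt e) ⊆ M.elem k := by
    rcases hk with rfl | hk
    · exact M.segment_subset_left e
    · exact M.segment_subset_right e k hk
  exact Metric.dist_le_diam_of_mem (M.isCompact_elem k).isBounded
    (hs (left_mem_segment ℝ _ _)) (hs (right_mem_segment ℝ _ _))

theorem segment_subset {e : M.Edge} {k : M.Elem} (hk : e ∈ M.edgesOf k) :
    segment ℝ (M.src e) (M.tgt e) ⊆ M.elem k := by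
  rcases hk with rfl | hk
  · exact M.segment_subset_left e
  · exact M.segment_subset_right e k hk

variable (M) in
/-- `C` is a constant in the discrete trace inequality for `Σ_{h,p}` on the mesh. -/
def IsTraceConst (p : ℕ) (C : ℝ) : Prop :=
  ∀ τ, M.IsSigma p τ → ∀ k, ∀ e ∈ M.edgesOf k, ∀ x ∈ segment ℝ (M.src e) (M.tgt e),
    M.len e ^ 2 * ‖τ k x‖ ^ 2 ≤ C * ∫ y in M.elem k, ‖τ k y‖ ^ 2

/-- The scaled inequality is applied to each component with `d = h_e`, which is at most the diameter
of the element; edges much shorter than the element, as produced by hanging nodes, do no harm. -/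
theorem exists_isTraceConst (p : ℕ) {σ : ℝ} (hσ : 0 < σ) : ∃ C, 0 < C ∧
    ∀ (Ω : Set Plane) (M : Mesh Ω), M.ShapeRegular σ → M.IsTraceConst p C := by
  obtain ⟨C, hC, h⟩ := exists_trace_bound p hσ
  refine ⟨C, hC, fun Ω M hM τ hτ k e he x hx => ?_⟩
  obtain ⟨c, hc⟩ := hM k
  have hl := len_le_diam he
  have h1 := fun i => h _ c (M.isCompact_elem k) ((M.len_pos e).trans_le hl) hc _ (hτ k i) x
    (segment_subset he hx) _ (M.len_pos e).le hl
  simp only [EuclideanSpace.norm_sq_eq, Real.norm_eq_abs, sq_abs, Finset.mul_sum]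
  rw [integral_finsetSum _ fun i _ =>
      integrableOn_elem (f := fun y => τ k y i ^ 2) ((hτ k i).continuous.pow 2) k,
    Finset.mul_sum]
  exact Finset.sum_le_sum fun i _ => h1 i

variable (M) in
/-- The sum over the elements at the edge `e` of `∫_k ‖τ‖²`. -/
def patchSq (τ : M.Elem → Plane → Plane) (e : M.Edge) : ℝ :=
  (∫ y in M.elem (M.left e), ‖τ (M.left e) y‖ ^ 2) +
    (M.right e).elim 0 fun k => ∫ y in M.elem k, ‖τ k y‖ ^ 2

theorem setIntegral_le_l2Norm_sq (τ : M.Elem → Plane → Plane) (k : M.Elem) :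
    ∫ y in M.elem k, ‖τ k y‖ ^ 2 ≤ M.l2Norm τ ^ 2 := by
  rw [l2Norm_sq]
  exact Finset.single_le_sum (f := fun k => ∫ y in M.elem k, ‖τ k y‖ ^ 2)
    (fun k _ => integral_nonneg fun _ => sq_nonneg _) (Finset.mem_univ k)

theorem patchSq_le (τ : M.Elem → Plane → Plane) (e : M.Edge) :
    M.patchSq τ e ≤ 2 * M.l2Norm τ ^ 2 := by
  have h1 := setIntegral_le_l2Norm_sq τ (M.left e)
  unfold patchSq
  cases M.right e with
  | none => simp; nlinarith [sq_nonneg (M.l2Norm τ)]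
  | some k =>
    simp only [Option.elim_some]
    linarith [setIntegral_le_l2Norm_sq τ k]

theorem sum_patchSq_le {N : ℕ} (hN : M.EdgeBound N) (τ : M.Elem → Plane → Plane) :
    ∑ e, M.patchSq τ e ≤ 2 * N * M.l2Norm τ ^ 2 := by
  classical
  set A : M.Elem → ℝ := fun k => ∫ y in M.elem k, ‖τ k y‖ ^ 2
  have hA : ∀ k, 0 ≤ A k := fun k => integral_nonneg fun _ => sq_nonneg _
  -- Double counting: an element is charged once for every edge related to it by `P`, hence at most
  -- `N` times. The two uses, for left and for right neighbours, give the factor `2 * N`.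
  have key : ∀ (P : M.Edge → M.Elem → Prop) [∀ e k, Decidable (P e k)], (∀ e k, P e k → e ∈ M.edgesOf k) →
      ∑ e, ∑ k, (if P e k then A k else 0) ≤ N * ∑ k, A k := fun P _ hP => by
    rw [Finset.sum_comm, Finset.mul_sum]
    refine Finset.sum_le_sum fun k _ => ?_
    rw [← Finset.sum_filter, Finset.sum_const, nsmul_eq_mul]
    refine mul_le_mul_of_nonneg_right ?_ (hA k)
    have : ((Finset.univ.filter fun e => P e k : Finset M.Edge) : Set M.Edge).ncard ≤ N :=
      (Set.ncard_le_ncard (fun e he => hP e k (by simpa using he)) (Set.toFinite _)).trans (hN k)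
    rw [Set.ncard_coe_finset] at this
    exact_mod_cast this
  have h1 := key (fun e k => M.left e = k) fun _ _ h => Or.inl h
  have h2 := key (fun e k => M.right e = some k) fun _ _ h => Or.inr h
  have h3 : ∀ e, M.patchSq τ e = (∑ k, if M.left e = k then A k else 0) +
      ∑ k, if M.right e = some k then A k else 0 := fun e => by
    unfold patchSq
    congr 1
    · simp [A]
    · cases M.right e <;> simp [A]
  simp only [h3, Finset.sum_add_distrib]
  rw [l2Norm_sq]
  change _ ≤ 2 * N * ∑ k, A k
  rw [mul_assoc, two_mul]
  exact add_le_add h1 h2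

theorem IsTraceConst.avg_le {p : ℕ} {C : ℝ} (h : M.IsTraceConst p C)
    {τ : M.Elem → Plane → Plane} (hτ : M.IsSigma p τ) {e : M.Edge} {x : Plane}
    (hx : x ∈ segment ℝ (M.src e) (M.tgt e)) :
    M.len e ^ 2 * ‖M.avg τ e x‖ ^ 2 ≤ C * M.patchSq τ e := by
  have h1 := h τ hτ (M.left e) e (Or.inl rfl) x hx
  unfold avg patchSq
  split
  · next hr => simpa [hr] using h1
  · next k hr =>
    have h2 := h τ hτ k e (Or.inr hr) x hx
    simp only [hr, Option.elim_some, mul_add]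
    refine le_trans ?_ (add_le_add h1 h2)
    rw [← mul_add]
    refine mul_le_mul_of_nonneg_left ?_ (sq_nonneg _)
    rw [norm_smul]
    have h3 := norm_add_le (τ (M.left e) x) (τ k x)
    have h4 : ‖(1 / 2 : ℝ)‖ = 1 / 2 := by norm_num
    rw [h4]
    have h5 := pow_le_pow_left₀ (norm_nonneg _) h3 2
    nlinarith [sq_nonneg (‖τ (M.left e) x‖ - ‖τ k x‖), sq_nonneg (‖τ (M.left e) x‖ + ‖τ k x‖)]

theorem IsTraceConst.jumpNormal_le {p : ℕ} {C : ℝ} (h : M.IsTraceConst p C)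
    {τ : M.Elem → Plane → Plane} (hτ : M.IsSigma p τ) {e : M.Edge} {x : Plane}
    (hx : x ∈ segment ℝ (M.src e) (M.tgt e)) :
    M.len e ^ 2 * M.jumpNormal τ e x ^ 2 ≤ 2 * C * M.patchSq τ e := by
  have h1 := h τ hτ (M.left e) e (Or.inl rfl) x hx
  have hn : ∀ y : Plane, ⟪y, M.normal e⟫ ^ 2 ≤ ‖y‖ ^ 2 := fun y => by
    rw [← sq_abs]
    refine pow_le_pow_left₀ (abs_nonneg _) ?_ 2
    simpa [M.norm_normal e] using abs_real_inner_le_norm y (M.normal e)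
  have hl := hn (τ (M.left e) x)
  unfold jumpNormal patchSq
  split
  · next hr =>
    simp only [hr, Option.elim_none, add_zero]
    nlinarith [sq_nonneg (M.len e), sq_nonneg ‖τ (M.left e) x‖,
      mul_le_mul_of_nonneg_left hl (sq_nonneg (M.len e)),
      mul_nonneg (sq_nonneg (M.len e)) (sq_nonneg ‖τ (M.left e) x‖)]
  · next k hr =>
    have h2 := h τ hτ k e (Or.inr hr) x hx
    have hk := hn (τ k x)
    simp only [hr, Option.elim_some, inner_neg_right]
    have h6 : (⟪τ (M.left e) x, M.normal e⟫ + -⟪τ k x, M.normal e⟫) ^ 2 ≤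
      2 * (‖τ (M.left e) x‖ ^ 2 + ‖τ k x‖ ^ 2) := by
      nlinarith [sq_nonneg (⟪τ (M.left e) x, M.normal e⟫ + ⟪τ k x, M.normal e⟫)]
    have h7 := mul_le_mul_of_nonneg_left h6 (sq_nonneg (M.len e))
    linarith

/-- The upper lifting estimate, in terms of the constant of the discrete trace inequality. -/
theorem l2Norm_liftREdge_sq_le {p : ℕ} {C : ℝ} (hC : 0 < C) (h : M.IsTraceConst p C) (e : M.Edge)
    {φ : Plane → Plane} (hφ : Continuous φ) :
    M.l2Norm (M.liftREdge p e φ) ^ 2 ≤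
      2 * C * ((M.len e)⁻¹ * M.edgeInt e fun x => ‖φ x‖ ^ 2) := by
  obtain ⟨hs, hr⟩ := (liftREdge_spec p e hφ).1
  have h1 := hr _ hs
  rw [← l2Norm_sq_eq_l2Inner] at h1
  -- The lifting was tested with itself. The choice `c = 2 * C` turns the second Young term into
  -- half of its square norm, which is absorbed on the left.
  have h2 := neg_edgeInt_le (e := e) (h := fun x => ⟪φ x, M.avg (M.liftREdge p e φ) e x⟫)
    (f := fun x => ‖φ x‖) (D := C * (2 * M.l2Norm (M.liftREdge p e φ) ^ 2)) (c := 2 * C)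
    (hφ.inner (continuous_avg hs.continuous e)) hφ.norm (by positivity) fun x hx =>
      ⟨‖M.avg (M.liftREdge p e φ) e x‖, abs_real_inner_le_norm _ _,
        (h.avg_le hs hx).trans (mul_le_mul_of_nonneg_left (patchSq_le _ e) hC.le)⟩
  rw [← h1] at h2
  have h3 : C * (2 * M.l2Norm (M.liftREdge p e φ) ^ 2) / (2 * (2 * C)) =
    M.l2Norm (M.liftREdge p e φ) ^ 2 / 2 := by field_simp
  rw [h3] at h2
  linarith

theorem IsTraceConst.isLiftConst {q p : ℕ} {C : ℝ} (hC : 0 < C) (h : M.IsTraceConst p C) :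
    M.IsLiftConst q p √(2 * C) := by
  intro w hw e
  have h1 := l2Norm_liftREdge_sq_le hC h e (continuous_jump hw.continuous e)
  rw [← Real.sqrt_inv, ← Real.sqrt_mul (by positivity), ← Real.sqrt_mul
    (mul_nonneg (by positivity) (inv_nonneg.2 (M.len_pos e).le)), mul_assoc]
  exact Real.le_sqrt_of_sq_le h1

/-- The stability estimate for the lifting `l`. -/
theorem l2Norm_liftL_sq_le {p : ℕ} {C : ℝ} (hC : 0 < C) (h : M.IsTraceConst p C) {N : ℕ}
    (hN : M.EdgeBound N) {φ : M.Edge → Plane → ℝ} (hφ : ∀ e, Continuous (φ e)) :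
    M.l2Norm (M.liftL p φ) ^ 2 ≤
      (4 * C * N + 1) * ∑ e, (M.len e)⁻¹ * M.edgeInt e fun x => φ e x ^ 2 := by
  obtain ⟨hs, hr⟩ := liftL_spec p hφ
  have h1 := hr _ hs
  rw [← l2Norm_sq_eq_l2Inner] at h1
  set R := M.liftL p φ
  -- The patches sum to at most `2 * N * ‖R‖²`, so this Young weight leaves at most `‖R‖² / 2` to
  -- absorb. The summand `1` keeps `c` positive when `N = 0`.
  set c := 4 * C * N + 1 with hc
  have hc0 : 0 < c := by positivity
  have h2 : ∀ e, -(if (M.right e).isSome then M.edgeInt e fun x => φ e x * M.jumpNormal R e x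
      else 0) ≤ c / 2 * ((M.len e)⁻¹ * M.edgeInt e fun x => φ e x ^ 2) +
        2 * C * M.patchSq R e / (2 * c) := fun e => by
    have h3 := neg_edgeInt_le (e := e) (h := fun x => φ e x * M.jumpNormal R e x)
      (f := fun x => |φ e x|) (D := 2 * C * M.patchSq R e) (c := c)
      ((hφ e).mul (continuous_jumpNormal hs.continuous e)) (hφ e).abs hc0 fun x hx =>
        ⟨|M.jumpNormal R e x|, (abs_mul _ _).le, by
          rw [sq_abs]; exact h.jumpNormal_le hs hx⟩
    simp only [sq_abs] at h3
    split
    · exact h3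
    · have h4 : 0 ≤ M.edgeInt e fun x => φ e x ^ 2 := edgeInt_nonneg fun x => sq_nonneg _
      have h5 : 0 ≤ M.patchSq R e := by
        unfold patchSq
        refine add_nonneg (integral_nonneg fun _ => sq_nonneg _) ?_
        cases M.right e with
        | none => simp
        | some k => exact integral_nonneg fun _ => sq_nonneg _
      have := M.len_pos e
      rw [neg_zero]
      positivity
  have h6 := Finset.sum_le_sum fun e (_ : e ∈ Finset.univ) => h2 e
  rw [Finset.sum_neg_distrib, ← h1, Finset.sum_add_distrib, ← Finset.mul_sum,
    ← Finset.sum_div, ← Finset.mul_sum] at h6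
  have h7 : 2 * C * ∑ e, M.patchSq R e ≤ c * M.l2Norm R ^ 2 := by
    have := mul_le_mul_of_nonneg_left (sum_patchSq_le hN R) (by positivity : 0 ≤ 2 * C)
    nlinarith [sq_nonneg (M.l2Norm R)]
  have h8 : 2 * C * ∑ e, M.patchSq R e / (2 * c) ≤ M.l2Norm R ^ 2 / 2 := by
    rw [← Finset.sum_div, ← mul_div_assoc, div_le_iff₀ (by positivity)]
    linarith
  rw [← Finset.sum_div] at h8
  rw [mul_div_assoc] at h6
  linarith

end Mesh

/-! ### Convexity of the elements and pointwise bounds for the diffusion operator -/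

theorem IsTriangle.convex {K : Set Plane} (h : IsTriangle K) : Convex ℝ K := by
  obtain ⟨v, -, rfl⟩ := h
  exact convex_convexHull ℝ _

theorem IsRectangle.convex {K : Set Plane} (h : IsRectangle K) : Convex ℝ K := by
  obtain ⟨c, u, v, -, -, -, rfl⟩ := h
  rintro _ ⟨s, hs, t, ht, rfl⟩ _ ⟨s', hs', t', ht', rfl⟩ a b ha hb hab
  refine ⟨a * s + b * s', convex_Icc (0 : ℝ) 1 hs hs' ha hb hab, a * t + b * t',
    convex_Icc (0 : ℝ) 1 ht ht' ha hb hab, ?_⟩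
  have : c = a • c + b • c := by rw [← add_smul, hab, one_smul]
  nth_rw 3 [this]
  module

namespace IsDiffusion

variable {Ω : Set Plane} {lam Lam : ℝ} {a : Plane → ℝ → Plane → Plane}

/-- The mean value theorem for the scalar function `t ↦ ⟪a(w + t(z - w)), u⟫`. The point `ξ` depends
on the test vector `u`, which is harmless since every application uses a single `u`. -/
theorem exists_sub_eq (h : IsDiffusion Ω lam Lam a) {x : Plane} (hx : x ∈ Ω) (η : ℝ)
    (z w u : Plane) : ∃ ξ, ⟪a x η z - a x η w, u⟫ = ⟪fderiv ℝ (a x η) ξ (z - w), u⟫ := by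
  have hd : ∀ t : ℝ, HasDerivAt (fun t : ℝ => ⟪a x η (w + t • (z - w)), u⟫)
      ⟪fderiv ℝ (a x η) (w + t • (z - w)) (z - w), u⟫ t := fun t => by
    have h1 : HasDerivAt (fun t : ℝ => w + t • (z - w)) (z - w) t := by
      simpa using ((hasDerivAt_id t).smul_const (z - w)).const_add w
    have h2 := ((h.differentiable x hx η) (w + t • (z - w))).hasFDerivAt.comp_hasDerivAt t h1
    simpa using h2.inner ℝ (hasDerivAt_const t u)
  obtain ⟨t, -, ht⟩ := exists_hasDerivAt_eq_slope _ _ zero_lt_one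
    (fun t _ => (hd t).continuousAt.continuousWithinAt) fun t _ => hd t
  refine ⟨w + t • (z - w), ?_⟩
  rw [ht]
  simp [inner_sub_left]

theorem lower_bound (h : IsDiffusion Ω lam Lam a) {x : Plane} (hx : x ∈ Ω) (η : ℝ) (z : Plane) :
    lam * ‖z‖ ^ 2 ≤ ⟪a x η z, z⟫ := by
  obtain ⟨ξ, hξ⟩ := h.exists_sub_eq hx η z 0 z
  rw [h.zero x hx, sub_zero, sub_zero] at hξ
  rw [hξ]
  exact h.lower x hx η ξ z

theorem upper_bound (h : IsDiffusion Ω lam Lam a) {x : Plane} (hx : x ∈ Ω) (η : ℝ)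
    (z w : Plane) : ⟪a x η z - a x η w, z - w⟫ ≤ Lam * ‖z - w‖ ^ 2 := by
  obtain ⟨ξ, hξ⟩ := h.exists_sub_eq hx η z w (z - w)
  rw [hξ]
  exact h.upper x hx η ξ _

/-- Polarization: by the symmetry of the Jacobian `A`, `4⟪A z, w⟫` is the difference of the values
of its quadratic form at `z + w` and `z - w`. Each value is nonnegative and at most `Λ` times the
square norm, and the parallelogram law adds up the squares. The bound provides integrable majorants
for the fluxes. -/
theorem abs_inner_le (h : IsDiffusion Ω lam Lam a) (hlam : 0 ≤ lam) {x : Plane} (hx : x ∈ Ω)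
    (η : ℝ) (z w : Plane) : |⟪a x η z, w⟫| ≤ Lam / 2 * (‖z‖ ^ 2 + ‖w‖ ^ 2) := by
  obtain ⟨ξ, hξ⟩ := h.exists_sub_eq hx η z 0 w
  rw [h.zero x hx, sub_zero, sub_zero] at hξ
  rw [hξ]
  have h1 := h.upper x hx η ξ (z + w)
  have h2 := h.upper x hx η ξ (z - w)
  have h3 := h.lower x hx η ξ (z + w)
  have h4 := h.lower x hx η ξ (z - w)
  have h5 := h.symmetric x hx η ξ w z
  have p1 : 0 ≤ lam * ‖z + w‖ ^ 2 := by positivity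
  have p2 : 0 ≤ lam * ‖z - w‖ ^ 2 := by positivity
  have hz := parallelogram_law_with_norm ℝ z w
  simp only [map_add, map_sub, inner_add_left, inner_add_right, inner_sub_left,
    inner_sub_right] at h1 h2 h3 h4
  have h6 : ⟪w, fderiv ℝ (a x η) ξ z⟫ = ⟪fderiv ℝ (a x η) ξ z, w⟫ := real_inner_comm _ _
  have h7 := congrArg (Lam * ·) hz
  simp only [mul_add] at h7
  rw [abs_le]
  constructor <;> linarith

end IsDiffusion

/-! ### Flux integrals, energy norm and stability -/

namespace Mesh

variable {Ω : Set Plane} {M : Mesh Ω}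

variable (M) in
theorem convex_elem (k : M.Elem) : Convex ℝ (M.elem k) :=
  (M.shape k).elim IsTriangle.convex IsRectangle.convex

variable (M) in
theorem interior_ae_eq (k : M.Elem) : interior (M.elem k) =ᵐ[volume] M.elem k :=
  interior_ae_eq_of_null_frontier ((M.convex_elem k).addHaar_frontier volume)

variable (M) in
theorem restrict_interior (k : M.Elem) :
    volume.restrict (interior (M.elem k)) = volume.restrict (M.elem k) :=
  Measure.restrict_congr_set (M.interior_ae_eq k)

-- The hypotheses on `a` hold on `Ω` only, whereas an element may touch `∂Ω`. The boundary of a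
-- convex set is null, so pointwise estimates are needed only in the interior, which lies in `Ω`.
variable (M) in
theorem ae_mem_interior (k : M.Elem) :
    ∀ᵐ x ∂volume.restrict (M.elem k), x ∈ interior (M.elem k) := by
  rw [← M.restrict_interior k]
  exact ae_restrict_mem isOpen_interior.measurableSet

variable {lam Lam : ℝ} {a : Plane → ℝ → Plane → Plane} {u : M.Elem → Plane → ℝ}

/-- Compactness of the element is of no use for the flux, as `a` need not extend continuously to
`∂Ω`. Measurability comes from continuity in the interior, and a continuous majorant on the element
from `abs_inner_le`. -/
theorem integrableOn_flux (h : IsDiffusion Ω lam Lam a) (hlam : 0 ≤ lam)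
    {τ ρ : M.Elem → Plane → Plane} (hu : ∀ k, Continuous (u k)) (hτ : ∀ k, Continuous (τ k))
    (hρ : ∀ k, Continuous (ρ k)) (k : M.Elem) :
    IntegrableOn (fun x => ⟪a x (u k x) (τ k x), ρ k x⟫) (M.elem k) := by
  have h1 : ContinuousOn (fun x => ⟪a x (u k x) (τ k x), ρ k x⟫) (interior (M.elem k)) := by
    refine ContinuousOn.inner (𝕜 := ℝ) ?_ (hρ k).continuousOn
    refine h.continuousOn.comp (f := fun x => (x, u k x, τ k x)) ?_ fun x hx =>
      ⟨M.interior_elem_subset k hx, mem_univ _⟩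
    exact (continuous_id.prodMk ((hu k).prodMk (hτ k))).continuousOn
  have h2 : AEStronglyMeasurable (fun x => ⟪a x (u k x) (τ k x), ρ k x⟫)
      (volume.restrict (M.elem k)) := by
    rw [← M.restrict_interior k]
    exact h1.aestronglyMeasurable isOpen_interior.measurableSet
  refine Integrable.mono' (integrableOn_elem
    (f := fun x => Lam / 2 * (‖τ k x‖ ^ 2 + ‖ρ k x‖ ^ 2))
    (continuous_const.mul (((hτ k).norm.pow 2).add ((hρ k).norm.pow 2))) k) h2 ?_
  filter_upwards [M.ae_mem_interior k] with x hx
  exact h.abs_inner_le hlam (M.interior_elem_subset k hx) _ _ _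

theorem le_flux_self (h : IsDiffusion Ω lam Lam a) (hlam : 0 ≤ lam)
    {τ : M.Elem → Plane → Plane} (hu : ∀ k, Continuous (u k)) (hτ : ∀ k, Continuous (τ k)) :
    lam * M.l2Norm τ ^ 2 ≤ M.flux a u τ τ := by
  rw [l2Norm_sq, Finset.mul_sum, flux, l2Inner]
  refine Finset.sum_le_sum fun k _ => ?_
  rw [← integral_const_mul]
  refine integral_mono_ae (integrableOn_elem (continuous_const.mul ((hτ k).norm.pow 2)) k)
    (integrableOn_flux h hlam hu hτ hτ k) ?_
  filter_upwards [M.ae_mem_interior k] with x hx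
  exact h.lower_bound (M.interior_elem_subset k hx) _ _

/-- The lower bound for the volume terms of the primal forms of SIPG and BR2. -/
theorem le_flux_add_flux (h : IsDiffusion Ω lam Lam a) (hlam : 0 ≤ lam)
    {τ ρ : M.Elem → Plane → Plane} (hu : ∀ k, Continuous (u k)) (hτ : ∀ k, Continuous (τ k))
    (hρ : ∀ k, Continuous (ρ k)) :
    lam * M.l2Norm (τ + ρ) ^ 2 - Lam * M.l2Norm ρ ^ 2 ≤
      M.flux a u (τ + ρ) τ + M.flux a u τ ρ := by
  have hs : ∀ k, Continuous ((τ + ρ) k) := fun k => (hτ k).add (hρ k)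
  rw [l2Norm_sq, l2Norm_sq, Finset.mul_sum, Finset.mul_sum, ← Finset.sum_sub_distrib, flux, flux,
    l2Inner, l2Inner, ← Finset.sum_add_distrib]
  refine Finset.sum_le_sum fun k _ => ?_
  rw [← integral_const_mul, ← integral_const_mul, ← integral_sub
    (integrableOn_elem (f := fun x => lam * ‖(τ + ρ) k x‖ ^ 2)
      (continuous_const.mul ((hs k).norm.pow 2)) k)
    (integrableOn_elem (f := fun x => Lam * ‖ρ k x‖ ^ 2)
      (continuous_const.mul ((hρ k).norm.pow 2)) k),
    ← integral_add (integrableOn_flux h hlam hu hs hτ k) (integrableOn_flux h hlam hu hτ hρ k)]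
  refine integral_mono_ae (integrableOn_elem ((continuous_const.mul ((hs k).norm.pow 2)).sub
    (continuous_const.mul ((hρ k).norm.pow 2))) k)
    ((integrableOn_flux h hlam hu hs hτ k).add (integrableOn_flux h hlam hu hτ hρ k)) ?_
  filter_upwards [M.ae_mem_interior k] with x hx
  -- The identity behind the estimate is `a(τ+ρ)·τ + a(τ)·ρ = a(τ+ρ)·(τ+ρ) - (a(τ+ρ) - a(τ))·ρ`; the
  -- two bounds handle its two terms.
  have h1 := h.lower_bound (M.interior_elem_subset k hx) (u k x) (τ k x + ρ k x)
  have h2 := h.upper_bound (M.interior_elem_subset k hx) (u k x) (τ k x + ρ k x) (τ k x)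
  simp only [add_sub_cancel_left, inner_sub_left, inner_add_right] at h1 h2
  simp only [Pi.add_apply]
  linarith

/-- Since `τ = (τ + ρ) - ρ`, this recovers the element-wise gradient from a discrete gradient and
its liftings. -/
theorem l2Norm_sq_le_of_add {τ ρ : M.Elem → Plane → Plane} (hτ : ∀ k, Continuous (τ k))
    (hρ : ∀ k, Continuous (ρ k)) :
    M.l2Norm τ ^ 2 ≤ 2 * M.l2Norm (τ + ρ) ^ 2 + 2 * M.l2Norm ρ ^ 2 := by
  have hs : ∀ k, Continuous ((τ + ρ) k) := fun k => (hτ k).add (hρ k)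
  refine (l2Norm_sq_mono hτ (κ := fun k x => 2 * ‖(τ + ρ) k x‖ ^ 2 + 2 * ‖ρ k x‖ ^ 2)
    (fun k => (continuous_const.mul ((hs k).norm.pow 2)).add
      (continuous_const.mul ((hρ k).norm.pow 2))) fun k x => ?_).trans_eq ?_
  · have h1 : ‖τ k x‖ ≤ ‖(τ + ρ) k x‖ + ‖ρ k x‖ := by
      simpa using norm_sub_le ((τ + ρ) k x) (ρ k x)
    nlinarith [norm_nonneg (τ k x), sq_nonneg (‖(τ + ρ) k x‖ - ‖ρ k x‖),
      pow_le_pow_left₀ (norm_nonneg _) h1 2]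
  · rw [l2Norm_sq, l2Norm_sq, Finset.mul_sum, Finset.mul_sum, ← Finset.sum_add_distrib]
    refine Finset.sum_congr rfl fun k _ => ?_
    rw [integral_add (integrableOn_elem (f := fun x => 2 * ‖(τ + ρ) k x‖ ^ 2)
        (continuous_const.mul ((hs k).norm.pow 2)) k)
      (integrableOn_elem (f := fun x => 2 * ‖ρ k x‖ ^ 2)
        (continuous_const.mul ((hρ k).norm.pow 2)) k), integral_const_mul,
      integral_const_mul]

theorem energyNorm_sq (p : ℕ) (w : M.Elem → Plane → ℝ) (g : M.Elem → Plane → Plane) :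
    M.energyNorm p w g ^ 2 =
      M.l2Norm g ^ 2 + ∑ e, M.l2Norm (M.liftREdge p e (M.jump w e)) ^ 2 :=
  Real.sq_sqrt (add_nonneg (sq_nonneg _) (Finset.sum_nonneg fun _ _ => sq_nonneg _))

theorem energyNorm_nonneg (p : ℕ) (w : M.Elem → Plane → ℝ) (g : M.Elem → Plane → Plane) :
    0 ≤ M.energyNorm p w g := Real.sqrt_nonneg _

/-- The scaled norm of the jumps of `v`. -/
def jumpSq (M : Mesh Ω) (v : M.Elem → Plane → ℝ) : ℝ :=
  ∑ e, (M.len e)⁻¹ * M.edgeInt e fun x => ‖M.jump v e x‖ ^ 2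

theorem jumpSq_nonneg (v : M.Elem → Plane → ℝ) : 0 ≤ M.jumpSq v :=
  Finset.sum_nonneg fun e _ => mul_nonneg (inv_nonneg.2 (M.len_pos e).le)
    (edgeInt_nonneg fun _ => sq_nonneg _)

theorem le_penalty {μ : M.Edge → ℝ} {μ₀ : ℝ} (h : ∀ e, μ₀ ≤ μ e) (v : M.Elem → Plane → ℝ) :
    μ₀ * M.jumpSq v ≤ M.penalty μ v v := by
  rw [jumpSq, penalty, Finset.mul_sum]
  refine Finset.sum_le_sum fun e _ => ?_
  simp only [real_inner_self_eq_norm_sq]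
  rw [div_eq_mul_inv, mul_assoc]
  exact mul_le_mul_of_nonneg_right (h e) (mul_nonneg (inv_nonneg.2 (M.len_pos e).le)
    (edgeInt_nonneg fun _ => sq_nonneg _))

theorem IsLiftConst.sum_le {q p : ℕ} {C : ℝ} (h : M.IsLiftConst q p C)
    {v : M.Elem → Plane → ℝ} (hv : M.IsV q v) :
    ∑ e, M.l2Norm (M.liftREdge p e (M.jump v e)) ^ 2 ≤ C ^ 2 * M.jumpSq v := by
  rw [jumpSq, Finset.mul_sum]
  refine Finset.sum_le_sum fun e _ => ?_
  have h1 := pow_le_pow_left₀ (l2Norm_nonneg _) (h v hv e) 2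
  have h2 : 0 ≤ M.edgeInt e fun x => ‖M.jump v e x‖ ^ 2 := edgeInt_nonneg fun _ => sq_nonneg _
  rwa [mul_pow, mul_pow, inv_pow, Real.sq_sqrt (M.len_pos e).le, Real.sq_sqrt h2, mul_assoc] at h1

/-- The summand from `H² ∩ H₀¹` is zero; this makes the continuity estimate on `V(h)` available for
discrete solutions. -/
theorem isVh_of_isV {q : ℕ} {v : M.Elem → Plane → ℝ} (hv : M.IsV q v) :
    M.IsVh q v (M.grad v) := by
  have hg : gradient (fun _ : Plane => (0 : ℝ)) = 0 := by
    ext1 x; exact gradient_fun_const x 0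
  refine ⟨v, 0, 0, hv, ?_, by simp, by simp⟩
  have h0 : InL2 Ω fun _ => 0 := MemLp.zero
  exact
    { memLp := MemLp.zero
      memLp_grad := fun i => by simpa using h0
      weak_grad := fun i ψ _ => by simp
      weak_hess := fun i j => ⟨0, MemLp.zero, fun ψ _ => by simp⟩
      approx := ⟨fun _ _ => 0, fun _ => ⟨contDiff_const, HasCompactSupport.zero, by
        simp [tsupport, Function.support_fun_zero]⟩, by
          have : (0 : Plane → ℝ) - (fun _ => 0) = 0 := by ext; simp
          simp [this], by simp [hg]⟩
      continuousOn := continuousOn_const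
      eq_zero := fun _ _ => rfl }

/-- Testing with the solution: `C_co ‖u‖² ≤ B(u, u) = F(u) ≤ C_F ‖f‖ ‖u‖`. Nothing about the form is
needed beyond the coercivity assumed in the estimate. -/
theorem stabilityEstimate (q p : ℕ)
    (B : (M.Elem → Plane → ℝ) → (M.Elem → Plane → ℝ) → ℝ) : M.StabilityEstimate q p B := by
  intro f u CF Cco _ hu hCF hF hCco hB
  have h1 := hB u hu.1
  have h2 := hF u _ (isVh_of_isV hu.1)
  rw [hu.2 u hu.1] at h1
  have h3 := h1.trans ((le_abs_self _).trans h2)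
  have h4 := energyNorm_nonneg p u (M.grad u)
  -- If the norm vanishes, no division is possible, but the claim reduces to the nonnegativity of
  -- the right-hand side.
  rcases h4.eq_or_lt with h0 | h0
  · rw [← h0]
    exact mul_nonneg (div_nonneg hCF hCco.le) (Real.sqrt_nonneg _)
  · rw [sq, ← mul_assoc] at h3
    have h5 := le_of_mul_le_mul_right h3 h0
    rw [div_mul_eq_mul_div, le_div_iff₀ hCco]
    linarith

/-- The common final step of the coercivity proofs. -/
theorem isCoercivityConst_of_le {q p : ℕ} {lam δ κ : ℝ} (hlam : 0 < lam)
    (hδ : 0 < δ) (hκ : 0 ≤ κ) {B : (M.Elem → Plane → ℝ) → (M.Elem → Plane → ℝ) → ℝ}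
    (H : ∀ v, M.IsV q v → ∃ T Y, 0 ≤ T ∧ 0 ≤ Y ∧
      M.energyNorm p v (M.grad v) ^ 2 ≤ 2 * T + κ * Y ∧ lam * T + δ * Y ≤ B v v) :
    M.IsCoercivityConst q p B (min (lam / 2) (δ / (κ + 1))) := by
  intro v hv
  obtain ⟨T, Y, hT, hY, h1, h2⟩ := H v hv
  -- With `c` the minimum, `2 c T ≤ λ T` and `c κ Y ≤ c (κ + 1) Y ≤ δ Y`. The added `1` avoids a
  -- zero denominator.
  have m1 : min (lam / 2) (δ / (κ + 1)) ≤ lam / 2 := min_le_left _ _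
  have m2 : min (lam / 2) (δ / (κ + 1)) * (κ + 1) ≤ δ :=
    (le_div_iff₀ (by positivity)).1 (min_le_right _ _)
  have h0 : 0 ≤ min (lam / 2) (δ / (κ + 1)) := le_min (by positivity) (by positivity)
  nlinarith [mul_le_mul_of_nonneg_left h1 h0, mul_le_mul_of_nonneg_right m1 hT,
      mul_le_mul_of_nonneg_right m2 hY, mul_nonneg h0 hY]

end Mesh

/-! ### Coercivity of the three forms -/

namespace Mesh

variable {Ω : Set Plane} {M : Mesh Ω}

variable {lam Lam : ℝ} {a : Plane → ℝ → Plane → Plane}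

/-- In the factor `2 * N + 1`, the term `2 * N` pays for `r` in `∇_h v = θ - r`, and `1` is the jump
part of the energy norm itself. -/
theorem energyNorm_sq_le {q p N : ℕ} (hN : M.EdgeBound N) {v : M.Elem → Plane → ℝ}
    (hv : M.IsV q v) :
    M.energyNorm p v (M.grad v) ^ 2 ≤ 2 * M.l2Norm (M.theta p v) ^ 2 +
      (2 * N + 1) * ∑ e, M.l2Norm (M.liftREdge p e (M.jump v e)) ^ 2 := by
  have hj := fun e => continuous_jump hv.continuous e
  have h1 := l2Norm_sq_le_of_add hv.continuous_grad (liftR_spec p hj).1.1.continuous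
  have h2 := l2Norm_liftR_sq_le p hN hj
  rw [energyNorm_sq, theta]
  linarith

theorem le_volume_terms {q p N : ℕ} (hN : M.EdgeBound N) (ha : IsDiffusion Ω lam Lam a)
    (hlam : 0 ≤ lam) (hLam : 0 ≤ Lam) {v : M.Elem → Plane → ℝ} (hv : M.IsV q v) :
    lam * M.l2Norm (M.theta p v) ^ 2 -
        Lam * (N * ∑ e, M.l2Norm (M.liftREdge p e (M.jump v e)) ^ 2) ≤
      M.flux a v (M.theta p v) (M.grad v) + M.flux a v (M.grad v) (M.liftR p (M.jump v)) := by
  have hj := fun e => continuous_jump hv.continuous e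
  refine le_trans ?_ (le_flux_add_flux ha hlam hv.continuous hv.continuous_grad
    (liftR_spec p hj).1.1.continuous)
  have h2 := mul_le_mul_of_nonneg_left (l2Norm_liftR_sq_le p hN hj) hLam
  rw [theta]
  linarith

/-- The lifting estimate turns the penalty into at least `μ₀ / CR ^ 2` times `∑ ‖r^e‖²`, while the
volume terms lose at most `Λ N` times that sum. The threshold says that the difference is positive.
-/
theorem isCoercivityConst_formSIPG {q p N : ℕ} {CR μ₀ : ℝ} (hlam : 0 < lam) (hLam : lam ≤ Lam)
    (hCR : 0 < CR) (hμ₀ : CR ^ 2 * Lam * N < μ₀) (hN : M.EdgeBound N)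
    (hC : M.IsLiftConst q p CR) (ha : IsDiffusion Ω lam Lam a) {μ : M.Edge → ℝ}
    (hμ : ∀ e, μ₀ ≤ μ e) :
    M.IsCoercivityConst q p (M.formSIPG p a μ)
      (min (lam / 2) ((μ₀ / CR ^ 2 - Lam * N) / (2 * N + 1 + 1))) := by
  have hδ : 0 < μ₀ / CR ^ 2 - Lam * N := by
    rw [sub_pos, lt_div_iff₀ (by positivity)]; linarith
  refine isCoercivityConst_of_le hlam hδ (by positivity) fun v hv =>
    ⟨_, _, sq_nonneg _, Finset.sum_nonneg fun _ _ => sq_nonneg _, energyNorm_sq_le hN hv, ?_⟩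
  have h1 := le_volume_terms (p := p) hN ha hlam.le (hlam.le.trans hLam) hv
  have h2 := le_penalty hμ v
  have h3 := hC.sum_le hv
  have h4 : 0 ≤ μ₀ := le_trans (mul_nonneg (mul_nonneg (sq_nonneg _) (hlam.le.trans hLam))
    (Nat.cast_nonneg N)) hμ₀.le
  have h5 := mul_le_mul_of_nonneg_left h3 (by positivity : 0 ≤ μ₀ / CR ^ 2)
  rw [← mul_assoc, div_mul_cancel₀ _ (by positivity)] at h5
  rw [formSIPG]
  linarith

/-- The stabilization is measured by the edge liftings themselves, `a(r^e)·r^e ≥ λ|r^e|²`. No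
lifting constant, and so no shape regularity, enters; the loss `Λ N` has to stay below `η₀ λ`. -/
theorem isCoercivityConst_formBR2 {q p N : ℕ} {η₀ : ℝ} (hlam : 0 < lam) (hLam : lam ≤ Lam)
    (hη₀ : N * (Lam / lam) < η₀) (hN : M.EdgeBound N)
    (ha : IsDiffusion Ω lam Lam a) {η : M.Edge → ℝ} (hη : ∀ e, η₀ ≤ η e) :
    M.IsCoercivityConst q p (M.formBR2 p a η)
      (min (lam / 2) ((η₀ * lam - Lam * N) / (2 * N + 1 + 1))) := by
  have hδ : 0 < η₀ * lam - Lam * N := by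
    rw [← mul_div_assoc, div_lt_iff₀ hlam] at hη₀
    linarith
  have hη0 : 0 ≤ η₀ := le_trans (mul_nonneg (Nat.cast_nonneg N)
    (div_nonneg (hlam.le.trans hLam) hlam.le)) hη₀.le
  refine isCoercivityConst_of_le hlam hδ (by positivity) fun v hv =>
    ⟨_, _, sq_nonneg _, Finset.sum_nonneg fun _ _ => sq_nonneg _, energyNorm_sq_le hN hv, ?_⟩
  have h1 := le_volume_terms (p := p) hN ha hlam.le (hlam.le.trans hLam) hv
  have h2 : η₀ * lam * ∑ e, M.l2Norm (M.liftREdge p e (M.jump v e)) ^ 2 ≤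
      ∑ e, η e * M.flux a v (M.liftREdge p e (M.jump v e)) (M.liftREdge p e (M.jump v e)) := by
    rw [Finset.mul_sum]
    refine Finset.sum_le_sum fun e _ => ?_
    have h3 := le_flux_self ha hlam.le hv.continuous
      (liftREdge_spec p e (continuous_jump hv.continuous e)).1.1.continuous
    rw [mul_assoc]
    exact mul_le_mul (hη e) h3 (by positivity) (hη0.trans (hη e))
  rw [formBR2]
  linarith

/-- The form is at least `λ‖θ‖² + μ₀ · jumpSq`, with nothing to absorb. The trace constant serves
only to bound the energy norm by these quantities: `2‖r + l‖²` yields the two summands with the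
factor `4`, and the jump part of the norm yields `2 * C`. -/
theorem isCoercivityConst_formLDG {q p N : ℕ} {C b μ₀ : ℝ} (hlam : 0 < lam)
    (hC : 0 < C) (hT : M.IsTraceConst p C) (hμ₀ : 0 < μ₀) (hN : M.EdgeBound N)
    (ha : IsDiffusion Ω lam Lam a) {β : M.Edge → Plane} (hβ : ∀ e, ‖β e‖ ≤ b) {μ : M.Edge → ℝ}
    (hμ : ∀ e, μ₀ ≤ μ e) :
    M.IsCoercivityConst q p (M.formLDG p a β μ) (min (lam / 2)
      (μ₀ / (4 * (N * (2 * C)) + 4 * ((4 * C * N + 1) * b ^ 2) + 2 * C + 1))) := by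
  refine isCoercivityConst_of_le hlam hμ₀ (by positivity) fun v hv =>
    ⟨M.l2Norm (M.thetaLDG p β v) ^ 2, M.jumpSq v, sq_nonneg _, jumpSq_nonneg v, ?_, ?_⟩
  · have hj := fun e => continuous_jump hv.continuous e
    have hφ : ∀ e, Continuous fun x => ⟪β e, M.jump v e x⟫ := fun e =>
      continuous_const.inner (hj e)
    have hr := (liftR_spec p hj).1.1.continuous
    have hl := (liftL_spec p hφ).1.continuous
    set r := M.liftR p (M.jump v)
    set l := M.liftL p fun e x => ⟪β e, M.jump v e x⟫
    have h1 : M.l2Norm (M.grad v) ^ 2 ≤ 2 * M.l2Norm (M.thetaLDG p β v) ^ 2 +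
        2 * M.l2Norm (r + l) ^ 2 := by
      rw [thetaLDG, add_assoc]
      exact l2Norm_sq_le_of_add hv.continuous_grad fun k => (hr k).add (hl k)
    have h2 : M.l2Norm (r + l) ^ 2 ≤ 2 * M.l2Norm r ^ 2 + 2 * M.l2Norm l ^ 2 := by
      have := l2Norm_sq_le_of_add (τ := r + l) (ρ := -l) (fun k => (hr k).add (hl k))
        fun k => (hl k).neg
      rw [add_neg_cancel_right] at this
      simpa [l2Norm] using this
    have h3 : ∑ e, M.l2Norm (M.liftREdge p e (M.jump v e)) ^ 2 ≤ 2 * C * M.jumpSq v := by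
      rw [jumpSq, Finset.mul_sum]
      exact Finset.sum_le_sum fun e _ => l2Norm_liftREdge_sq_le hC hT e (hj e)
    have h4 : M.l2Norm r ^ 2 ≤ N * (2 * C) * M.jumpSq v := by
      rw [mul_assoc]
      exact (l2Norm_liftR_sq_le p hN hj).trans
        (mul_le_mul_of_nonneg_left h3 (Nat.cast_nonneg N))
    have h5 : M.l2Norm l ^ 2 ≤ (4 * C * N + 1) * b ^ 2 * M.jumpSq v := by
      refine (l2Norm_liftL_sq_le hC hT hN hφ).trans ?_
      rw [mul_assoc (4 * C * N + 1), jumpSq, Finset.mul_sum _ _ (b ^ 2)]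
      refine mul_le_mul_of_nonneg_left (Finset.sum_le_sum fun e _ => ?_) (by positivity)
      rw [mul_left_comm (b ^ 2), ← edgeInt_const_mul e (b ^ 2)]
      refine mul_le_mul_of_nonneg_left (edgeInt_mono ((hφ e).pow 2)
        (continuous_const.mul ((hj e).norm.pow 2)) fun x _ => ?_)
        (inv_nonneg.2 (M.len_pos e).le)
      rw [← mul_pow, ← sq_abs]
      exact pow_le_pow_left₀ (abs_nonneg _) ((abs_real_inner_le_norm _ _).trans
        (mul_le_mul_of_nonneg_right (hβ e) (norm_nonneg _))) 2
    rw [energyNorm_sq]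
    linarith
  · have hj := fun e => continuous_jump hv.continuous e
    have hφ : ∀ e, Continuous fun x => ⟪β e, M.jump v e x⟫ := fun e =>
      continuous_const.inner (hj e)
    have hr := (liftR_spec p hj).1.1.continuous
    have hl := (liftL_spec p hφ).1.continuous
    rw [formLDG]
    exact add_le_add (le_flux_self ha hlam.le hv.continuous fun k =>
      ((hv.continuous_grad k).add (hr k)).add (hl k)) (le_penalty hμ v)

end Mesh

/-! ### Geometry of the skeleton and functions without jumps -/

/-- Orthonormal coordinates on the plane preserve the volume. -/
theorem exists_frame {d n : Plane} (hd : ‖d‖ = 1) (hn : ‖n‖ = 1) (hdn : ⟪d, n⟫ = 0)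
    (x₀ : Plane) : ∃ Φ : ℝ × ℝ ≃ᵐ Plane, MeasurePreserving Φ ∧
      ∀ y, Φ y = x₀ + (y.1 • d + y.2 • n) := by
  have hv : Orthonormal ℝ ![d, n] := by
    refine ⟨fun i => ?_, fun i j hij => ?_⟩
    · fin_cases i <;> simpa
    · fin_cases i <;> fin_cases j <;> simp_all [real_inner_comm]
  let b := OrthonormalBasis.mk hv
    (hv.linearIndependent.span_eq_top_of_card_eq_finrank (by simp)).ge
  have hb : ∀ i, b i = ![d, n] i := fun i => by simp [b]
  let e1 : ℝ × ℝ ≃ᵐ (Fin 2 → ℝ) := MeasurableEquiv.finTwoArrow.symm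
  have h1 : MeasurePreserving e1 := (volume_preserving_finTwoArrow ℝ).symm _
  let e2 : (Fin 2 → ℝ) ≃ᵐ EuclideanSpace ℝ (Fin 2) := MeasurableEquiv.toLp 2 (Fin 2 → ℝ)
  have h2 : MeasurePreserving e2 := PiLp.volume_preserving_toLp (Fin 2)
  let e3 : EuclideanSpace ℝ (Fin 2) ≃ᵐ Plane := b.measurableEquiv.symm
  have h3 : MeasurePreserving e3 := b.measurePreserving_measurableEquiv.symm _
  let e4 : Plane ≃ᵐ Plane := MeasurableEquiv.addLeft x₀
  have h4 : MeasurePreserving e4 := measurePreserving_add_left volume x₀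
  refine ⟨((e1.trans e2).trans e3).trans e4, h4.comp (h3.comp (h2.comp h1)), fun y => ?_⟩
  have : e3 (e2 (e1 y)) = b.repr.symm (WithLp.toLp 2 ![y.1, y.2]) := rfl
  change x₀ + e3 (e2 (e1 y)) = _
  rw [this, ← b.sum_repr (b.repr.symm _)]
  simp [hb]

/-- A small step in the direction `n` stays in `K` and increases the linear functional, so the
functional cannot already vanish at an interior point. -/
theorem inner_lt_of_mem_interior {K : Set Plane} {n c x : Plane} (hn : ‖n‖ = 1)
    (h : ∀ y ∈ K, ⟪n, y - c⟫ ≤ 0) (hx : x ∈ interior K) : ⟪n, x - c⟫ < 0 := by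
  have h1 : Tendsto (fun t : ℝ => x + t • n) (𝓝[>] 0) (𝓝 x) := by
    have : Continuous fun t : ℝ => x + t • n := by fun_prop
    simpa using (this.tendsto 0).mono_left nhdsWithin_le_nhds
  have h2 := h1.eventually (isOpen_interior.mem_nhds hx)
  obtain ⟨t, ht, ht0⟩ := (h2.and self_mem_nhdsWithin).exists
  have h3 := h _ (interior_subset ht)
  rw [add_sub_right_comm, inner_add_right, real_inner_smul_right, real_inner_self_eq_norm_sq,
    hn] at h3
  have : (0 : ℝ) < t := ht0
  linarith

namespace Mesh

variable {Ω : Set Plane} {M : Mesh Ω}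

variable (M)

theorem closure_interior_elem (k : M.Elem) : closure (interior (M.elem k)) = M.elem k := by
  rw [(M.convex_elem k).closure_interior_eq_closure_of_nonempty_interior
    (M.interior_elem_nonempty k), (M.isCompact_elem k).isClosed.closure_eq]

/-- The end points of the edges. -/
def vertices : Set Plane := range M.src ∪ range M.tgt

theorem finite_vertices : M.vertices.Finite := (finite_range _).union (finite_range _)

variable {M}

/-- Every point of an element is a limit of its interior points; a neighbourhood contained in the
other element would make the two interiors meet. -/
theorem eq_of_mem_interior {k k' : M.Elem} {x : Plane} (h : x ∈ interior (M.elem k))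
    (h' : x ∈ M.elem k') : k = k' := by
  by_contra hne
  rw [← M.closure_interior_elem k'] at h'
  obtain ⟨y, hy, hy'⟩ := mem_closure_iff.1 h' _ isOpen_interior h
  exact (Set.disjoint_left.1 (M.disjoint_interior k k' hne)) hy hy'

theorem inner_normal_eq_zero {e : M.Edge} {x : Plane}
    (hx : x ∈ segment ℝ (M.src e) (M.tgt e)) : ⟪M.normal e, x - M.src e⟫ = 0 := by
  rw [segment_eq_image'] at hx
  obtain ⟨t, -, rfl⟩ := hx
  simp only [add_sub_cancel_left]
  rw [real_inner_smul_right, M.normal_orthogonal, mul_zero]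

theorem inner_normal_neg {e : M.Edge} {x : Plane} (hx : x ∈ interior (M.elem (M.left e))) :
    ⟪M.normal e, x - M.src e⟫ < 0 :=
  inner_lt_of_mem_interior (M.norm_normal e) (M.normal_left e) hx

theorem inner_normal_pos {e : M.Edge} {k : M.Elem} (hk : M.right e = some k) {x : Plane}
    (hx : x ∈ interior (M.elem k)) : 0 < ⟪M.normal e, x - M.src e⟫ := by
  have := inner_lt_of_mem_interior (n := -M.normal e) (c := M.src e)
    (by rw [norm_neg, M.norm_normal e])
    (fun y hy => by rw [inner_neg_left]; linarith [M.normal_right e k hk y hy]) hx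
  rw [inner_neg_left] at this
  linarith

theorem left_ne_right {e : M.Edge} {k : M.Elem} (hk : M.right e = some k) : M.left e ≠ k := by
  rintro rfl
  obtain ⟨x, hx⟩ := M.interior_elem_nonempty (M.left e)
  exact (inner_normal_neg hx).not_gt (inner_normal_pos hk hx)

theorem notMem_interior_of_mem_segment {e : M.Edge} {x : Plane}
    (hx : x ∈ segment ℝ (M.src e) (M.tgt e)) (k : M.Elem) : x ∉ interior (M.elem k) := by
  intro hk
  have := eq_of_mem_interior hk (M.segment_subset_left e hx)
  subst this
  exact (inner_normal_neg hk).ne (inner_normal_eq_zero hx)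

theorem mem_openSegment_of_notMem_vertices {e : M.Edge} {x : Plane}
    (hx : x ∈ segment ℝ (M.src e) (M.tgt e)) (hv : x ∉ M.vertices) :
    x ∈ openSegment ℝ (M.src e) (M.tgt e) :=
  mem_openSegment_of_ne_left_right (fun h => hv (Or.inl ⟨e, h⟩)) (fun h => hv (Or.inr ⟨e, h⟩)) hx

theorem exists_edge {k : M.Elem} {x : Plane} (hx : x ∈ M.elem k)
    (hi : x ∉ interior (M.elem k)) : ∃ e ∈ M.edgesOf k, x ∈ segment ℝ (M.src e) (M.tgt e) := by
  have h1 : x ∈ frontier (M.elem k) := ⟨subset_closure hx, hi⟩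
  rw [M.frontier_elem k] at h1
  simpa [edgesOf] using h1

theorem edge_unique {e e' : M.Edge} {x : Plane} (h : x ∈ openSegment ℝ (M.src e) (M.tgt e))
    (h' : x ∈ openSegment ℝ (M.src e') (M.tgt e')) : e = e' := by
  by_contra hne
  exact Set.disjoint_left.1 (M.disjoint_edges e e' hne) h h'

/-- The point is interior to no element, so it lies on some edge of `k`. Away from the vertices,
which include the hanging nodes, edges do not meet, so that edge is `e`. -/
theorem mem_edgesOf_of_mem {e : M.Edge} {k : M.Elem} {x : Plane}
    (h : x ∈ openSegment ℝ (M.src e) (M.tgt e)) (hv : x ∉ M.vertices) (hk : x ∈ M.elem k) :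
    e ∈ M.edgesOf k := by
  obtain ⟨e', he', hx⟩ := exists_edge hk
    (notMem_interior_of_mem_segment (openSegment_subset_segment ℝ _ _ h) k)
  rwa [edge_unique h (mem_openSegment_of_notMem_vertices hx hv)]

variable (M) in
/-- `v` is continuous across the edges and vanishes on the boundary edges. -/
def NoJump (v : M.Elem → Plane → ℝ) : Prop :=
  ∀ e, ∀ x ∈ segment ℝ (M.src e) (M.tgt e), M.jump v e x = 0

theorem normal_ne_zero (e : M.Edge) : M.normal e ≠ 0 := fun h => by
  simpa [h] using M.norm_normal e

theorem NoJump.eq_zero {v : M.Elem → Plane → ℝ} (h : M.NoJump v) {e : M.Edge}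
    (hr : M.right e = none) {x : Plane} (hx : x ∈ segment ℝ (M.src e) (M.tgt e)) :
    v (M.left e) x = 0 := by
  have := h e x hx
  unfold jump at this
  rw [hr] at this
  exact (smul_eq_zero.1 this).resolve_right (normal_ne_zero e)

theorem NoJump.eq {v : M.Elem → Plane → ℝ} (h : M.NoJump v) {e : M.Edge} {k : M.Elem}
    (hr : M.right e = some k) {x : Plane} (hx : x ∈ segment ℝ (M.src e) (M.tgt e)) :
    v (M.left e) x = v k x := by
  have := h e x hx
  unfold jump at this
  rw [hr] at this
  simp only [smul_neg, ← sub_eq_add_neg, ← sub_smul] at this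
  exact sub_eq_zero.1 ((smul_eq_zero.1 this).resolve_right (normal_ne_zero e))

variable (M) in
/-- The function on the plane that is `v k` on the element `k` and zero off the elements. -/
def extend (v : M.Elem → Plane → ℝ) (x : Plane) : ℝ :=
  open Classical in if h : ∃ k, x ∈ M.elem k then v h.choose x else 0

/-- The choice made in `extend` does not matter: two different elements meeting at a point that is
no vertex share the edge there, and `v` does not jump across it. Vertices are left out because
elements may touch there without a common edge. -/
theorem NoJump.extend_eq {v : M.Elem → Plane → ℝ} (h : M.NoJump v) {x : Plane}
    (hv : x ∉ M.vertices) {k : M.Elem} (hk : x ∈ M.elem k) : M.extend v x = v k x := by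
  have hex : ∃ k, x ∈ M.elem k := ⟨k, hk⟩
  rw [extend, dif_pos hex]
  have hk' := hex.choose_spec
  generalize hex.choose = k' at hk'
  by_cases hkk : k' = k
  · rw [hkk]
  obtain ⟨e, he, hx⟩ := exists_edge hk fun hi => hkk (eq_of_mem_interior hi hk').symm
  have he' := mem_edgesOf_of_mem (mem_openSegment_of_notMem_vertices hx hv) hv hk'
  rcases he with rfl | he <;> rcases he' with rfl | he'
  · exact absurd rfl hkk
  · exact (h.eq he' hx).symm
  · exact h.eq he hx
  · rw [he] at he'; exact absurd (Option.some.inj he').symm hkk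

/-- A point of an element outside `Ω` lies on an edge; it cannot be an interior edge, whose open
segment is in `Ω`, and on a boundary edge the jump is the trace itself. -/
theorem NoJump.extend_eq_zero {v : M.Elem → Plane → ℝ} (h : M.NoJump v) {x : Plane}
    (hv : x ∉ M.vertices) (hx : x ∉ Ω) : M.extend v x = 0 := by
  by_cases hex : ∃ k, x ∈ M.elem k
  · obtain ⟨k, hk⟩ := hex
    rw [h.extend_eq hv hk]
    obtain ⟨e, he, hs⟩ := exists_edge hk fun hi => hx (M.interior_elem_subset k hi)
    have hr : M.right e = none := by
      rw [Option.eq_none_iff_forall_ne_some]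
      intro k' hk'
      exact hx (M.interior_edge e k' hk' (mem_openSegment_of_notMem_vertices hs hv))
    rcases he with rfl | he
    · exact h.eq_zero hr hs
    · rw [hr] at he; cases he
  · rw [extend, dif_neg hex]

theorem exists_radius (M : Mesh Ω) : ∃ R, 0 < R ∧ ∀ x ∈ closure Ω, ‖x‖ < R := by
  have hc : IsCompact (closure Ω) := by
    rw [← M.cover]; exact isCompact_iUnion M.isCompact_elem
  obtain ⟨R, hR⟩ := hc.isBounded.exists_norm_le
  exact ⟨max R 0 + 1, by positivity, fun x hx =>
    (hR x hx).trans_lt ((le_max_left R 0).trans_lt (lt_add_one _))⟩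

end Mesh

/-! ### Poincaré's inequality for piecewise polynomials without jumps -/

namespace Mesh

variable {Ω : Set Plane} {M : Mesh Ω}

variable (M) in
/-- The function on the plane that is `f k` in the interior of the element `k` and zero
elsewhere. -/
def glue {F : Type*} [AddCommMonoid F] (f : M.Elem → Plane → F) (x : Plane) : F :=
  ∑ k, (interior (M.elem k)).indicator (f k) x

theorem glue_eq {F : Type*} [AddCommMonoid F] (f : M.Elem → Plane → F) {k : M.Elem} {x : Plane}
    (hx : x ∈ interior (M.elem k)) : M.glue f x = f k x := by
  rw [glue, Finset.sum_eq_single k, indicator_of_mem hx]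
  · intro k' _ hk
    exact indicator_of_notMem (fun h => hk (eq_of_mem_interior h (interior_subset hx))) _
  · simp

theorem glue_eq_zero {F : Type*} [AddCommMonoid F] (f : M.Elem → Plane → F) {x : Plane}
    (hx : ∀ k, x ∉ interior (M.elem k)) : M.glue f x = 0 :=
  Finset.sum_eq_zero fun k _ => indicator_of_notMem (hx k) _

theorem integrable_indicator_interior {F : Type*} [NormedAddCommGroup F] {f : Plane → F}
    (hf : Continuous f) (k : M.Elem) : Integrable ((interior (M.elem k)).indicator f) :=
  (integrable_indicator_iff isOpen_interior.measurableSet).2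
    ((integrableOn_elem hf k).mono_set interior_subset)

theorem integrable_glue {f : M.Elem → Plane → ℝ} (hf : ∀ k, Continuous (f k)) :
    Integrable (M.glue f) :=
  integrable_finsetSum _ fun k _ => integrable_indicator_interior (hf k) k

theorem integral_glue {f : M.Elem → Plane → ℝ} (hf : ∀ k, Continuous (f k)) :
    ∫ x, M.glue f x = ∑ k, ∫ x in M.elem k, f k x := by
  unfold glue
  rw [integral_finsetSum _ fun k _ => integrable_indicator_interior (hf k) k]
  refine Finset.sum_congr rfl fun k _ => ?_
  rw [integral_indicator isOpen_interior.measurableSet, M.restrict_interior]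

/-- A line in the direction `d` through no vertex meets every edge in at most one point. -/
theorem countable_line_inter {d n : Plane} (hd : d ≠ 0) (hdn : ⟪d, n⟫ = 0) (hn : ‖n‖ = 1)
    {t : ℝ} (ht : ∀ x ∈ M.vertices, ⟪n, x⟫ ≠ t) :
    {s : ℝ | ∃ e, s • d + t • n ∈ segment ℝ (M.src e) (M.tgt e)}.Countable := by
  rw [ofPred_exists]
  refine Set.countable_iUnion fun e => Set.Subsingleton.countable ?_
  intro s hs s' hs'
  simp only [mem_ofPred_eq, segment_eq_image'] at hs hs'
  obtain ⟨r, -, hr⟩ := hs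
  obtain ⟨r', -, hr'⟩ := hs'
  have key : ∀ s r : ℝ, M.src e + r • (M.tgt e - M.src e) = s • d + t • n →
      ⟪n, M.src e⟫ + r * (⟪n, M.tgt e⟫ - ⟪n, M.src e⟫) = t := fun s r h => by
    have := congrArg (fun y => ⟪n, y⟫) h
    simp only [inner_add_right, real_inner_smul_right, inner_sub_right, real_inner_self_eq_norm_sq,
      hn, show ⟪n, d⟫ = 0 by rw [real_inner_comm, hdn]] at this
    linarith
  have h1 := key _ _ hr
  have h2 := key _ _ hr'
  -- An edge parallel to the line that meets it would have its end points on the line, against `ht`.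
  have h3 : ⟪n, M.tgt e⟫ - ⟪n, M.src e⟫ ≠ 0 := fun h0 => by
    rw [h0, mul_zero, add_zero] at h1
    exact ht _ (Or.inl ⟨e, rfl⟩) h1
  have h4 : r = r' := by
    have : r * (⟪n, M.tgt e⟫ - ⟪n, M.src e⟫) = r' * (⟪n, M.tgt e⟫ - ⟪n, M.src e⟫) := by linarith
    exact mul_right_cancel₀ h3 this
  subst h4
  have h5 : s • d = s' • d := by
    have := hr.symm.trans hr'
    exact add_right_cancel this
  exact smul_left_injective ℝ hd h5

/-- The preimages of the elements and of the complement of `Ω` form a finite closed cover of the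
curve's parameter line. On each of them the extension agrees with a continuous function, since the
curve avoids the vertices. -/
theorem NoJump.continuous_line {v : M.Elem → Plane → ℝ} (h : M.NoJump v)
    (hv : ∀ k, Continuous (v k)) (hΩ : IsOpen Ω) {γ : ℝ → Plane} (hγ : Continuous γ)
    (hγv : ∀ s, γ s ∉ M.vertices) : Continuous fun s => M.extend v (γ s) := by
  let A : Option M.Elem → Set ℝ := fun o => γ ⁻¹' (o.elim Ωᶜ M.elem)
  refine LocallyFinite.continuous (f := A) (locallyFinite_of_finite A) ?_ ?_ ?_
  · rw [eq_univ_iff_forall]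
    intro s
    by_cases hs : γ s ∈ Ω
    · have : γ s ∈ ⋃ k, M.elem k := by rw [M.cover]; exact subset_closure hs
      obtain ⟨k, hk⟩ := mem_iUnion.1 this
      exact mem_iUnion.2 ⟨some k, hk⟩
    · exact mem_iUnion.2 ⟨none, hs⟩
  · rintro (_ | k)
    · exact hΩ.isClosed_compl.preimage hγ
    · exact (M.isCompact_elem k).isClosed.preimage hγ
  · rintro (_ | k)
    · exact continuousOn_const.congr fun s hs => h.extend_eq_zero (hγv s) hs
    · exact ((hv k).comp hγ).continuousOn.congr fun s hs => h.extend_eq (hγv s) hs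

theorem _root_.DG.IsTest.eq_zero {ψ : Plane → ℝ} (hψ : IsTest Ω ψ) {x : Plane} (hx : x ∉ Ω) : ψ x = 0 :=
  image_eq_zero_of_notMem_tsupport fun h => hx (hψ.2.2 h)

/-- The integrand `∂_d (⟪d, x⟫ (v - ψ)²)`. -/
def lineIntegrand (d : Plane) (w : Plane → ℝ) (x : Plane) : ℝ :=
  w x ^ 2 + 2 * ⟪d, x⟫ * w x * fderiv ℝ w x d

/-- Along the line `s • d + t • n` the integrand is the derivative of `s (v - ψ)²`, except at the
countably many points on edges. This function is continuous and vanishes outside the closure of `Ω`,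
so the fundamental theorem of calculus gives zero. -/
theorem integral_line_eq_zero {q : ℕ} {v : M.Elem → Plane → ℝ} (h : M.NoJump v)
    (hv : M.IsV q v) (hΩ : IsOpen Ω) {ψ : Plane → ℝ} (hψ : IsTest Ω ψ) {d n : Plane}
    (hd : ‖d‖ = 1) (hn : ‖n‖ = 1) (hdn : ⟪d, n⟫ = 0) {t : ℝ}
    (ht : ∀ x ∈ M.vertices, ⟪n, x⟫ ≠ t)
    (hint : Integrable fun s : ℝ => M.glue (fun k => lineIntegrand d (v k - ψ)) (s • d + t • n)) :
    ∫ s : ℝ, M.glue (fun k => lineIntegrand d (v k - ψ)) (s • d + t • n) = 0 := by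
  obtain ⟨R, hR0, hR⟩ := M.exists_radius
  set γ : ℝ → Plane := fun s => s • d + t • n with hγdef
  have hγ : Continuous γ := by fun_prop
  have hγd : ∀ s, ⟪d, γ s⟫ = s := fun s => by
    simp [hγdef, inner_add_right, real_inner_smul_right, hdn, hd]
  have hγn : ∀ s, ⟪n, γ s⟫ = t := fun s => by
    simp [hγdef, inner_add_right, real_inner_smul_right, hn, real_inner_comm, hdn]
  have hγv : ∀ s, γ s ∉ M.vertices := fun s hs => ht _ hs (hγn s)
  have hγR : ∀ s, R ≤ |s| → γ s ∉ closure Ω := fun s hs hc => by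
    have h1 := hR _ hc
    have h2 := abs_real_inner_le_norm d (γ s)
    rw [hγd, hd, one_mul] at h2
    linarith
  have helem : ∀ k, M.elem k ⊆ closure Ω := fun k => by
    rw [← M.cover]; exact subset_iUnion M.elem k
  set F := M.glue fun k => lineIntegrand d (v k - ψ)
  let g : ℝ → ℝ := fun s => s * (M.extend v (γ s) - ψ (γ s)) ^ 2
  have hout : ∀ x ∉ closure Ω, F x = 0 := fun x hx =>
    glue_eq_zero _ fun k hk => hx (helem k (interior_subset hk))
  have hg0 : ∀ s, γ s ∉ closure Ω → g s = 0 := fun s hs => by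
    have hs' : γ s ∉ Ω := fun h => hs (subset_closure h)
    simp [g, h.extend_eq_zero (hγv s) hs', hψ.eq_zero hs']
  have hgc : Continuous g := continuous_id.mul
    (((h.continuous_line hv.continuous hΩ hγ hγv).sub (hψ.1.continuous.comp hγ)).pow 2)
  have hγ' : ∀ s, HasDerivAt γ d s := fun s => by
    have := ((hasDerivAt_id s).smul_const d).add_const (t • n)
    rwa [one_smul] at this
  have hder : ∀ s ∉ {s : ℝ | ∃ e, γ s ∈ segment ℝ (M.src e) (M.tgt e)},
      HasDerivAt g (F (γ s)) s := by
    intro s hs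
    by_cases hk : ∃ k, γ s ∈ M.elem k
    · obtain ⟨k, hk⟩ := hk
      have hi : γ s ∈ interior (M.elem k) := by
        by_contra hi
        obtain ⟨e, -, he⟩ := exists_edge hk hi
        exact hs ⟨e, he⟩
      have h1 : g =ᶠ[𝓝 s] fun s => s * (v k - ψ) (γ s) ^ 2 := by
        filter_upwards [(isOpen_interior.preimage hγ).mem_nhds hi] with s' hs'
        simp [g, h.extend_eq (hγv s') (interior_subset hs')]
      have hw : DifferentiableAt ℝ (v k - ψ) (γ s) :=
        (((hv k).contDiff.sub hψ.1).differentiable (by simp)) _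
      have h2 := hw.hasFDerivAt.comp_hasDerivAt s (hγ' s)
      have h3 := (hasDerivAt_id s).mul (h2.pow 2)
      refine (h3.congr_of_eventuallyEq h1).congr_deriv ?_
      rw [show F (γ s) = lineIntegrand d (v k - ψ) (γ s) from glue_eq _ hi, lineIntegrand, hγd]
      simp
      ring
    · have hc : γ s ∉ closure Ω := by
        rw [← M.cover]; simpa using hk
      have h1 : g =ᶠ[𝓝 s] fun _ => 0 := by
        filter_upwards [(isClosed_closure.isOpen_compl.preimage hγ).mem_nhds hc] with s' hs'
        exact hg0 s' hs'
      rw [hout _ hc]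
      exact (hasDerivAt_const s (0 : ℝ)).congr_of_eventuallyEq h1
  have hsupp : Function.support (fun s => F (γ s)) ⊆ Ioc (-R) R := by
    intro s hs
    by_contra hs'
    refine hs (hout _ (hγR s ?_))
    rw [mem_Ioc, not_and_or, not_lt, not_le] at hs'
    rcases hs' with hs' | hs'
    · exact (by linarith : R ≤ -s).trans (neg_le_abs s)
    · exact hs'.le.trans (le_abs_self s)
  rw [← intervalIntegral.integral_eq_integral_of_support_subset hsupp,
    integral_eq_of_hasDerivAt_off_countable g (fun s => F (γ s))
      (countable_line_inter (norm_ne_zero_iff.1 (by simp [hd])) hdn hn ht) hgc.continuousOn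
      (fun s hs => hder s hs.2) hint.intervalIntegrable,
    hg0 R (hγR R (le_abs_self R)), hg0 (-R) (hγR _ (by simp [le_abs_self])), sub_zero]

theorem norm_fderiv_eq_gradient (f : Plane → ℝ) (x : Plane) : ‖fderiv ℝ f x‖ = ‖gradient f x‖ := by
  simp [gradient]

/-- Poincaré's inequality for functions without jumps. -/
theorem exists_poincare (M : Mesh Ω) (hΩ : IsOpen Ω) : ∃ R, 0 < R ∧
    ∀ q v ψ, M.IsV q v → M.NoJump v → IsTest Ω ψ →
      ∑ k, ∫ x in M.elem k, (v k x - ψ x) ^ 2 ≤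
        R ^ 2 * ∑ k, ∫ x in M.elem k, ‖M.grad v k x - gradient ψ x‖ ^ 2 := by
  obtain ⟨R, hR0, hR⟩ := M.exists_radius
  refine ⟨2 * R, by positivity, fun q v ψ hv h hψ => ?_⟩
  let d : Plane := EuclideanSpace.single 0 1
  let n : Plane := EuclideanSpace.single 1 1
  have hd : ‖d‖ = 1 := by simp [d]
  have hn : ‖n‖ = 1 := by simp [n]
  have hdn : ⟪d, n⟫ = 0 := by simp [d, n, EuclideanSpace.inner_single_left]
  have hw : ∀ k, ContDiff ℝ ∞ (v k - ψ) := fun k => (hv k).contDiff.sub hψ.1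
  have hf : ∀ k, Continuous (lineIntegrand d (v k - ψ)) := fun k => by
    have h1 := (hw k).continuous
    have h2 := (hw k).continuous_fderiv (by simp)
    unfold lineIntegrand
    fun_prop
  have hF := integrable_glue hf
  -- Fubini in the frame `d, n`: only finitely many of the parallel lines pass through a vertex, and
  -- all others contribute zero.
  have hzero : ∫ x, M.glue (fun k => lineIntegrand d (v k - ψ)) x = 0 := by
    obtain ⟨Φ, hΦ, hΦ'⟩ := exists_frame hd hn hdn 0
    rw [← hΦ.integral_comp', Measure.volume_eq_prod]
    have hF' := (hΦ.integrable_comp_emb Φ.measurableEmbedding).2 hF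
    rw [Measure.volume_eq_prod] at hF'
    refine (integral_prod_symm _ hF').trans (integral_eq_zero_of_ae ?_)
    have hfin : ((fun x => ⟪n, x⟫) '' M.vertices).Finite := M.finite_vertices.image _
    filter_upwards [hF'.prod_left_ae, compl_mem_ae_iff.2 (hfin.measure_zero volume)] with t h1 h2
    simp only [Function.comp_apply, hΦ', zero_add] at h1 ⊢
    exact integral_line_eq_zero h hv hΩ hψ hd hn hdn (fun x hx hxt => h2 ⟨x, hx, hxt⟩) h1
  rw [integral_glue hf] at hzero
  have hg : ∀ k, Continuous fun x => ‖M.grad v k x - gradient ψ x‖ ^ 2 := fun k =>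
    ((hv.continuous_grad k).sub (continuous_gradient hψ.1)).norm.pow 2
  have hgrad : ∀ k x, fderiv ℝ (v k - ψ) x d ^ 2 ≤ ‖M.grad v k x - gradient ψ x‖ ^ 2 :=
    fun k x => by
      have h1 : gradient (v k - ψ) x = M.grad v k x - gradient ψ x := by
        simp only [gradient, grad]
        rw [fderiv_sub ((hv k).contDiff.differentiable (by simp) x)
          (hψ.1.differentiable (by simp) x), map_sub]
      have h2 := (fderiv ℝ (v k - ψ) x).le_opNorm d
      rw [hd, mul_one, norm_fderiv_eq_gradient, h1] at h2
      rw [← sq_abs]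
      exact pow_le_pow_left₀ (abs_nonneg _) h2 2
  -- With `w = v - ψ` and `m = ⟪d, x⟫`, the pointwise bound `w² ≤ 2(w² + 2 m w ∂w) + 4 m² (∂w)²` is
  -- the nonnegativity of `(w + 2 m ∂w)²`. The bracket integrates to zero over the mesh and `|m| ≤
  -- R`, whence the constant `2 * R`.
  have key : ∀ k, ∫ x in M.elem k, (v k x - ψ x) ^ 2 ≤
      2 * (∫ x in M.elem k, lineIntegrand d (v k - ψ) x) + (2 * R) ^ 2 *
        ∫ x in M.elem k, ‖M.grad v k x - gradient ψ x‖ ^ 2 := fun k => by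
    have i1 : IntegrableOn (fun x => 2 * lineIntegrand d (v k - ψ) x) (M.elem k) :=
      integrableOn_elem (continuous_const.mul (hf k)) k
    have i2 : IntegrableOn (fun x => (2 * R) ^ 2 * ‖M.grad v k x - gradient ψ x‖ ^ 2) (M.elem k) :=
      integrableOn_elem (continuous_const.mul (hg k)) k
    rw [← integral_const_mul, ← integral_const_mul, ← integral_add i1 i2]
    refine setIntegral_mono_on (integrableOn_elem ((hw k).continuous.pow 2) k) (i1.add i2)
      (M.isCompact_elem k).measurableSet fun x hx => ?_
    have hxc : x ∈ closure Ω := by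
      rw [← M.cover]; exact mem_iUnion.2 ⟨k, hx⟩
    have h1 : ⟪d, x⟫ ^ 2 ≤ R ^ 2 := by
      rw [← sq_abs]
      refine pow_le_pow_left₀ (abs_nonneg _) ((abs_real_inner_le_norm d x).trans ?_) 2
      rw [hd, one_mul]
      exact (hR x hxc).le
    have h2 := mul_le_mul h1 (hgrad k x) (sq_nonneg _) (sq_nonneg R)
    simp only [lineIntegrand, Pi.sub_apply]
    nlinarith [sq_nonneg ((v k x - ψ x) + 2 * ⟪d, x⟫ * fderiv ℝ (v k - ψ) x d)]
  refine (Finset.sum_le_sum fun k _ => key k).trans_eq ?_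
  rw [Finset.sum_add_distrib, ← Finset.mul_sum, ← Finset.mul_sum, hzero, mul_zero, zero_add]

end Mesh

/-! ### Rotated gradients and the divergence theorem on half-planes -/

/-- The closed half-plane with outward normal `n` and `x₀` on its boundary. -/
def halfPlane (n x₀ : Plane) : Set Plane := {x | ⟪n, x - x₀⟫ ≤ 0}

theorem isClosed_halfPlane (n x₀ : Plane) : IsClosed (halfPlane n x₀) :=
  isClosed_le (by fun_prop) continuous_const

theorem isometry_line {d : Plane} (hd : ‖d‖ = 1) (c : Plane) :
    Isometry fun s : ℝ => c + s • d :=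
  Isometry.of_dist_eq fun s s' => by
    rw [dist_add_left, dist_eq_norm, ← sub_smul, norm_smul, hd, mul_one, dist_eq_norm]

theorem contDiff_comp_line {h : Plane → ℝ} (hh : ContDiff ℝ 1 h) (c d : Plane) :
    ContDiff ℝ 1 fun s : ℝ => h (c + s • d) := by
  fun_prop

theorem hasCompactSupport_comp_line {h : Plane → ℝ} (hc : HasCompactSupport h) {d : Plane}
    (hd : ‖d‖ = 1) (c : Plane) : HasCompactSupport fun s : ℝ => h (c + s • d) :=
  hc.comp_isClosedEmbedding (isometry_line hd c).isClosedEmbedding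

theorem deriv_comp_line {h : Plane → ℝ} (hh : ContDiff ℝ 1 h) (c d : Plane) (s : ℝ) :
    deriv (fun s : ℝ => h (c + s • d)) s = fderiv ℝ h (c + s • d) d := by
  have h1 : HasDerivAt (fun s : ℝ => c + s • d) d s := by
    have := ((hasDerivAt_id s).smul_const d).const_add c
    rwa [one_smul] at this
  exact (((hh.differentiable one_ne_zero) _).hasFDerivAt.comp_hasDerivAt s h1).deriv

theorem continuous_fderiv_apply {h : Plane → ℝ} (hh : ContDiff ℝ 1 h) (v : Plane) :
    Continuous fun x => fderiv ℝ h x v :=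
  (hh.continuous_fderiv one_ne_zero).clm_apply continuous_const

theorem integrable_fderiv_apply {h : Plane → ℝ} (hh : ContDiff ℝ 1 h) (hc : HasCompactSupport h)
    (v : Plane) : Integrable fun x => fderiv ℝ h x v :=
  (continuous_fderiv_apply hh v).integrable_of_hasCompactSupport (hc.fderiv_apply ℝ v)


/-- Both orders of integration are recorded: tangential derivatives are integrated first along the
boundary direction, normal ones first across it. -/
theorem integral_halfPlane {d n : Plane} (hd : ‖d‖ = 1) (hn : ‖n‖ = 1) (hdn : ⟪d, n⟫ = 0)
    (x₀ : Plane) {f : Plane → ℝ} (hf : Integrable f) :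
    (∫ x in halfPlane n x₀, f x = ∫ s : ℝ, ∫ t in Iic (0 : ℝ), f (x₀ + (s • d + t • n))) ∧
    ∫ x in halfPlane n x₀, f x = ∫ t in Iic (0 : ℝ), ∫ s : ℝ, f (x₀ + (s • d + t • n)) := by
  obtain ⟨Φ, hΦ, hΦ'⟩ := exists_frame hd hn hdn x₀
  have hpre : Φ ⁻¹' halfPlane n x₀ = univ ×ˢ Iic (0 : ℝ) := by
    ext ⟨s, t⟩
    simp [halfPlane, hΦ', inner_add_right, real_inner_smul_right, hn, real_inner_comm, hdn]
  have hF := (hΦ.integrable_comp_emb Φ.measurableEmbedding).2 hf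
  have hm : (volume.restrict (univ ×ˢ Iic (0 : ℝ)) : Measure (ℝ × ℝ)) =
      (volume : Measure ℝ).prod (volume.restrict (Iic (0 : ℝ))) := by
    rw [Measure.volume_eq_prod, ← Measure.prod_restrict, Measure.restrict_univ]
  have hF' := hF.restrict (s := univ ×ˢ Iic (0 : ℝ))
  rw [hm] at hF'
  have hFun : (f ∘ Φ) = fun y : ℝ × ℝ => f (x₀ + (y.1 • d + y.2 • n)) :=
    funext fun y => congrArg f (hΦ' y)
  rw [← hΦ.setIntegral_preimage_emb Φ.measurableEmbedding, hpre, hm]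
  change ∫ y, (f ∘ Φ) y ∂_ = _ ∧ ∫ y, (f ∘ Φ) y ∂_ = _
  rw [hFun] at hF' ⊢
  exact ⟨integral_prod _ hF', integral_prod_symm _ hF'⟩

/-- The divergence theorem on a half-plane, for the tangential derivative. -/
theorem integral_halfPlane_tangent {d n : Plane} (hd : ‖d‖ = 1) (hn : ‖n‖ = 1)
    (hdn : ⟪d, n⟫ = 0) (x₀ : Plane) {h : Plane → ℝ} (hh : ContDiff ℝ 1 h)
    (hc : HasCompactSupport h) : ∫ x in halfPlane n x₀, fderiv ℝ h x d = 0 := by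
  rw [(integral_halfPlane hd hn hdn x₀ (integrable_fderiv_apply hh hc d)).2]
  refine integral_eq_zero_of_ae (Eventually.of_forall fun t => ?_)
  have e : ∀ s : ℝ, x₀ + (s • d + t • n) = (x₀ + t • n) + s • d := fun s => by abel
  simp only [e, ← deriv_comp_line hh]
  have h1 := contDiff_comp_line hh (x₀ + t • n) d
  have h2 := hasCompactSupport_comp_line hc hd (x₀ + t • n)
  exact integral_eq_zero_of_hasDerivAt_of_integrable
    (fun s => (h1.differentiable one_ne_zero s).hasDerivAt)
    ((h1.continuous_deriv le_rfl).integrable_of_hasCompactSupport h2.deriv)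
    (h1.continuous.integrable_of_hasCompactSupport h2)

/-- The divergence theorem on a half-plane, for the normal derivative. -/
theorem integral_halfPlane_normal {d n : Plane} (hd : ‖d‖ = 1) (hn : ‖n‖ = 1)
    (hdn : ⟪d, n⟫ = 0) (x₀ : Plane) {h : Plane → ℝ} (hh : ContDiff ℝ 1 h)
    (hc : HasCompactSupport h) :
    ∫ x in halfPlane n x₀, fderiv ℝ h x n = ∫ s : ℝ, h (x₀ + s • d) := by
  rw [(integral_halfPlane hd hn hdn x₀ (integrable_fderiv_apply hh hc n)).1]
  refine integral_congr_ae (Eventually.of_forall fun s => ?_)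
  simp only [← add_assoc, ← deriv_comp_line hh]
  rw [(hasCompactSupport_comp_line hc hn (x₀ + s • d)).integral_Iic_deriv_eq
    (contDiff_comp_line hh _ n)]
  simp

/-- The rotated gradient of `χ`, in the orthonormal frame `d, n`. -/
def rotGrad (d n : Plane) (χ : Plane → ℝ) (x : Plane) : Plane :=
  fderiv ℝ χ x d • n - fderiv ℝ χ x n • d

theorem continuous_rotGrad (d n : Plane) {χ : Plane → ℝ} (hχ : ContDiff ℝ ∞ χ) :
    Continuous (rotGrad d n χ) :=
  ((continuous_fderiv_apply (hχ.of_le (by simp)) d).smul continuous_const).sub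
    ((continuous_fderiv_apply (hχ.of_le (by simp)) n).smul continuous_const)

theorem rotGrad_eq_zero (d n : Plane) {χ : Plane → ℝ} {x : Plane} (hx : x ∉ tsupport χ) :
    rotGrad d n χ x = 0 := by
  have : fderiv ℝ χ x = 0 := image_eq_zero_of_notMem_tsupport fun h =>
    hx (tsupport_fderiv_subset ℝ h)
  simp [rotGrad, this]

theorem hasCompactSupport_rotGrad (d n : Plane) {χ : Plane → ℝ} (hχ : HasCompactSupport χ) :
    HasCompactSupport (rotGrad d n χ) :=
  HasCompactSupport.intro hχ fun _ hx => rotGrad_eq_zero d n hx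

theorem inner_gradient (f : Plane → ℝ) (x v : Plane) : ⟪gradient f x, v⟫ = fderiv ℝ f x v := by
  simp [gradient]

/-- The terms with second derivatives of `f` cancel by their symmetry, so the product is a
divergence. -/
theorem inner_gradient_rotGrad (d n : Plane) {f χ : Plane → ℝ} (hf : ContDiff ℝ ∞ f)
    (hχ : ContDiff ℝ ∞ χ) (x : Plane) :
    ⟪gradient f x, rotGrad d n χ x⟫ = fderiv ℝ (fun y => χ y * fderiv ℝ f y n) x d -
      fderiv ℝ (fun y => χ y * fderiv ℝ f y d) x n := by
  have hχx := (hχ.differentiable (by simp)) x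
  have hf' : ContDiff ℝ ∞ (fderiv ℝ f) := hf.fderiv_right (by simp)
  have hfx := (hf'.differentiable (by simp)) x
  have h1 : ∀ v w, fderiv ℝ (fun y => χ y * fderiv ℝ f y v) x w =
      χ x * fderiv ℝ (fderiv ℝ f) x w v + fderiv ℝ f x v * fderiv ℝ χ x w := fun v w => by
    have h2 : HasFDerivAt (fun y => fderiv ℝ f y v)
        ((fderiv ℝ (fderiv ℝ f) x).flip v) x := by
      simpa using hfx.hasFDerivAt.clm_apply (hasFDerivAt_const v x)
    rw [show fderiv ℝ (fun y => χ y * fderiv ℝ f y v) x = _ from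
      (hχx.hasFDerivAt.mul h2).fderiv]
    simp
  have hs : fderiv ℝ (fderiv ℝ f) x d n = fderiv ℝ (fderiv ℝ f) x n d :=
    ((contDiff_infty.1 hf 2).contDiffAt.isSymmSndFDerivAt (by simp)).eq d n
  rw [h1, h1, rotGrad, inner_sub_right, real_inner_smul_right, real_inner_smul_right,
    inner_gradient, inner_gradient, hs]
  ring

theorem contDiff_mul_fderiv {f χ : Plane → ℝ} (hf : ContDiff ℝ ∞ f) (hχ : ContDiff ℝ ∞ χ)
    (v : Plane) : ContDiff ℝ 1 fun y => χ y * fderiv ℝ f y v := by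
  have hf' : ContDiff ℝ ∞ (fderiv ℝ f) := hf.fderiv_right (by simp)
  exact (hχ.mul (hf'.clm_apply contDiff_const)).of_le (by simp)

/-- Only the normal derivative produces a boundary term, which contains the tangential derivative of
`f` alone; this is how jumps along an edge are detected. -/
theorem setIntegral_halfPlane_rotGrad {d n : Plane} (hd : ‖d‖ = 1) (hn : ‖n‖ = 1)
    (hdn : ⟪d, n⟫ = 0) (x₀ : Plane) {f χ : Plane → ℝ} (hf : ContDiff ℝ ∞ f)
    (hχ : ContDiff ℝ ∞ χ) (hc : HasCompactSupport χ) :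
    ∫ x in halfPlane n x₀, ⟪gradient f x, rotGrad d n χ x⟫ =
      -∫ s : ℝ, χ (x₀ + s • d) * fderiv ℝ f (x₀ + s • d) d := by
  simp only [inner_gradient_rotGrad d n hf hχ]
  have hA := contDiff_mul_fderiv hf hχ
  have hAc : ∀ v, HasCompactSupport fun y => χ y * fderiv ℝ f y v := fun v => hc.mul_right
  rw [integral_sub (integrable_fderiv_apply (hA n) (hAc n) d).integrableOn
    (integrable_fderiv_apply (hA d) (hAc d) n).integrableOn,
    integral_halfPlane_tangent hd hn hdn x₀ (hA n) (hAc n),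
    integral_halfPlane_normal hd hn hdn x₀ (hA d) (hAc d), zero_sub]

theorem rotGrad_neg (d n : Plane) (χ : Plane → ℝ) (x : Plane) :
    rotGrad d (-n) χ x = -rotGrad d n χ x := by
  simp only [rotGrad, map_neg, smul_neg, neg_smul]
  abel

/-- The half-plane on the other side of the same line. Replacing `n` by `-n` reverses the rotated
gradient, so the same field gives the boundary term with the opposite sign. -/
theorem setIntegral_halfPlane_neg_rotGrad {d n : Plane} (hd : ‖d‖ = 1) (hn : ‖n‖ = 1)
    (hdn : ⟪d, n⟫ = 0) (x₀ : Plane) {f χ : Plane → ℝ} (hf : ContDiff ℝ ∞ f)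
    (hχ : ContDiff ℝ ∞ χ) (hc : HasCompactSupport χ) :
    ∫ x in halfPlane (-n) x₀, ⟪gradient f x, rotGrad d n χ x⟫ =
      ∫ s : ℝ, χ (x₀ + s • d) * fderiv ℝ f (x₀ + s • d) d := by
  have := setIntegral_halfPlane_rotGrad hd (n := -n) (by rwa [norm_neg])
    (by rw [inner_neg_right, hdn, neg_zero]) x₀ hf hχ hc
  simp only [rotGrad_neg, inner_neg_right, integral_neg] at this
  exact neg_injective this

/-- Gradients are orthogonal to rotated gradients. -/
theorem integral_rotGrad {d n : Plane} (hd : ‖d‖ = 1) (hn : ‖n‖ = 1)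
    (hdn : ⟪d, n⟫ = 0) {f χ : Plane → ℝ} (hf : ContDiff ℝ ∞ f)
    (hχ : ContDiff ℝ ∞ χ) (hc : HasCompactSupport χ) :
    ∫ x, ⟪gradient f x, rotGrad d n χ x⟫ = 0 := by
  obtain ⟨R, hR⟩ := hc.isCompact.isBounded.exists_norm_le
  have h1 : ∀ x ∈ tsupport χ, ⟪n, x⟫ ≤ R := fun x hx => by
    have := real_inner_le_norm n x
    rw [hn, one_mul] at this
    exact this.trans (hR x hx)
  -- The half-plane is pushed so far out that it contains the support of `χ` and its boundary line
  -- misses it.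
  have h2 := setIntegral_halfPlane_rotGrad hd hn hdn ((R + 1) • n) hf hχ hc
  have h3 : ∀ s : ℝ, χ ((R + 1) • n + s • d) = 0 := fun s =>
    image_eq_zero_of_notMem_tsupport fun h => by
      have := h1 _ h
      simp only [inner_add_right, real_inner_smul_right, real_inner_self_eq_norm_sq, hn] at this
      rw [real_inner_comm, hdn] at this
      linarith
  simp only [h3, zero_mul, integral_zero, neg_zero] at h2
  rw [← h2]
  refine (setIntegral_eq_integral_of_forall_compl_eq_zero fun x hx => ?_).symm
  rw [rotGrad_eq_zero, inner_zero_right]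
  intro h
  refine hx ?_
  have := h1 x h
  simp only [halfPlane, mem_ofPred_eq, inner_sub_right, real_inner_smul_right,
    real_inner_self_eq_norm_sq, hn]
  linarith

/-! ### Limits of gradients of test functions have constant jumps on edges -/

namespace Mesh

variable {Ω : Set Plane} {M : Mesh Ω}

/-- Near a point `x₀` of the edge `e` that is no vertex, an element with the edge `e` is a
half-plane. -/
theorem ball_inter_elem_eq {e : M.Edge} {k : M.Elem} {x₀ ν : Plane} {r : ℝ}
    (hr0 : 0 < r) (hk : x₀ ∈ M.elem k) (hν : ‖ν‖ = 1) (hνk : M.elem k ⊆ halfPlane ν x₀)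
    (hνe : ∀ x ∈ segment ℝ (M.src e) (M.tgt e), ⟪ν, x - x₀⟫ = 0)
    (hr : ∀ e' ≠ e, Disjoint (Metric.ball x₀ r) (segment ℝ (M.src e') (M.tgt e'))) :
    Metric.ball x₀ r ∩ M.elem k = Metric.ball x₀ r ∩ halfPlane ν x₀ := by
  refine Subset.antisymm (inter_subset_inter_right _ hνk) ?_
  have hlt : ∀ x ∈ interior (M.elem k), ⟪ν, x - x₀⟫ < 0 := fun x hx =>
    inner_lt_of_mem_interior hν (fun y hy => hνk hy) hx
  set H := Metric.ball x₀ r ∩ {x | ⟪ν, x - x₀⟫ < 0}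
  have hconv : Convex ℝ {x : Plane | ⟪ν, x - x₀⟫ < 0} := by
    intro x hx y hy a b ha hb hab
    have h1 : a • x + b • y - x₀ = a • (x - x₀) + b • (y - x₀) := by
      have : x₀ = a • x₀ + b • x₀ := by rw [← add_smul, hab, one_smul]
      nth_rw 1 [this]; module
    simp only [mem_ofPred_eq] at hx hy ⊢
    rw [h1, inner_add_right, real_inner_smul_right, real_inner_smul_right]
    rcases ha.eq_or_lt with rfl | ha
    · have : b = 1 := by linarith
      subst this; linarith
    · nlinarith [mul_neg_of_pos_of_neg ha hx, mul_nonpos_of_nonneg_of_nonpos hb hy.le]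
  -- The open half-disc is convex, hence connected, and meets no edge, so it lies in the interior of
  -- `k` or off `k`. Since `x₀` is a limit of interior points of `k`, the first case occurs.
  have hH : H ⊆ interior (M.elem k) := by
    refine IsPreconnected.subset_left_of_subset_union isOpen_interior
      (M.isCompact_elem k).isClosed.isOpen_compl
      (disjoint_compl_right.mono_left interior_subset) ?_ ?_
      ((convex_ball x₀ r).inter hconv).isPreconnected
    · intro x hx
      by_cases hxk : x ∈ M.elem k
      · left
        by_contra hi
        obtain ⟨e', -, he'⟩ := exists_edge hxk hi
        by_cases hee : e' = e
        · subst hee; exact hx.2.ne (hνe x he')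
        · exact Set.disjoint_left.1 (hr e' hee) hx.1 he'
      · exact Or.inr hxk
    · rw [← M.closure_interior_elem k] at hk
      obtain ⟨y, hy, hy'⟩ := mem_closure_iff.1 hk _ Metric.isOpen_ball (Metric.mem_ball_self hr0)
      exact ⟨y, ⟨hy, hlt y hy'⟩, hy'⟩
  rintro x ⟨hx, hxn⟩
  refine ⟨hx, ?_⟩
  -- Points on the boundary line are limits from the open half-disc, and the element is closed.
  have h1 : Tendsto (fun t : ℝ => x - t • ν) (𝓝[>] 0) (𝓝 x) := by
    have : Continuous fun t : ℝ => x - t • ν := by fun_prop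
    simpa using (this.tendsto 0).mono_left nhdsWithin_le_nhds
  refine (M.isCompact_elem k).isClosed.mem_of_tendsto h1 ?_
  filter_upwards [h1.eventually (Metric.isOpen_ball.mem_nhds hx), self_mem_nhdsWithin] with t ht ht0
  refine interior_subset (hH ⟨ht, ?_⟩)
  have hxn' : ⟪ν, x - x₀⟫ ≤ 0 := hxn
  have ht0' : (0 : ℝ) < t := ht0
  simp only [mem_ofPred_eq, sub_right_comm x, inner_sub_right _ (x - x₀), real_inner_smul_right,
    real_inner_self_eq_norm_sq, hν]
  linarith

/-- The other edges and the elements away from `e` form a finite union of closed sets, which misses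
`x₀`. -/
theorem exists_ball {e : M.Edge} {x₀ : Plane} (hx₀ : x₀ ∈ openSegment ℝ (M.src e) (M.tgt e))
    (hv : x₀ ∉ M.vertices) : ∃ r, 0 < r ∧
      (∀ e' ≠ e, Disjoint (Metric.ball x₀ r) (segment ℝ (M.src e') (M.tgt e'))) ∧
      ∀ k, e ∉ M.edgesOf k → Disjoint (Metric.ball x₀ r) (M.elem k) := by
  have hseg : ∀ e', IsClosed (segment ℝ (M.src e') (M.tgt e')) := fun e' => by
    rw [segment_eq_image_lineMap]
    exact (isCompact_Icc.image AffineMap.lineMap_continuous).isClosed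
  set A : Set Plane := (⋃ e' ∈ {e' | e' ≠ e}, segment ℝ (M.src e') (M.tgt e')) ∪
    ⋃ k ∈ {k | e ∉ M.edgesOf k}, M.elem k with hA
  have hcl : IsClosed A := by
    refine IsClosed.union ?_ ?_
    · exact (Set.toFinite _).isClosed_biUnion fun e' _ => hseg e'
    · exact (Set.toFinite _).isClosed_biUnion fun k _ => (M.isCompact_elem k).isClosed
  have hxA : x₀ ∉ A := by
    simp only [hA, mem_union, mem_iUnion, not_or, not_exists]
    refine ⟨fun e' hne hx => hne ?_, fun k hk hx => hk (mem_edgesOf_of_mem hx₀ hv hx)⟩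
    exact edge_unique (mem_openSegment_of_notMem_vertices hx hv) hx₀
  obtain ⟨r, hr, hrA⟩ := Metric.isOpen_iff.1 hcl.isOpen_compl x₀ hxA
  refine ⟨r, hr, fun e' hne => Set.disjoint_left.2 fun x hx hx' => hrA hx ?_,
    fun k hk => Set.disjoint_left.2 fun x hx hx' => hrA hx ?_⟩
  · exact Or.inl (mem_biUnion (s := {e' | e' ≠ e}) hne hx')
  · exact Or.inr (mem_biUnion (s := {k | e ∉ M.edgesOf k}) hk hx')

/-- The scalar jump across an edge. -/
def jumpVal (v : M.Elem → Plane → ℝ) (e : M.Edge) : Plane → ℝ :=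
  match M.right e with
  | none => v (M.left e)
  | some k => v (M.left e) - v k

theorem jump_eq (v : M.Elem → Plane → ℝ) (e : M.Edge) (x : Plane) :
    M.jump v e x = jumpVal v e x • M.normal e := by
  unfold jump jumpVal
  split
  · next h => rw [h]
  · next k h => rw [h]; simp only [Pi.sub_apply]; module

theorem IsV.isPoly_jumpVal {q : ℕ} {v : M.Elem → Plane → ℝ} (hv : M.IsV q v) (e : M.Edge) :
    IsPoly q (jumpVal v e) := by
  unfold jumpVal
  split
  · exact hv _
  · exact (hv _).sub (hv _)

/-- The unit tangent of an edge. -/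
def tangent (e : M.Edge) : Plane := (M.len e)⁻¹ • (M.tgt e - M.src e)

theorem norm_tangent (e : M.Edge) : ‖M.tangent e‖ = 1 := by
  have h := M.len_pos e
  rw [tangent, norm_smul, norm_inv, Real.norm_of_nonneg h.le, ← dist_eq_norm, dist_comm]
  exact inv_mul_cancel₀ h.ne'

theorem inner_tangent_normal (e : M.Edge) : ⟪M.tangent e, M.normal e⟫ = 0 := by
  rw [tangent, real_inner_smul_left, real_inner_comm, M.normal_orthogonal, mul_zero]

variable (M) in
/-- The element-wise gradient of `v` is a limit of gradients of test functions, expressed by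
testing with fields that are orthogonal to all of these. -/
def IsLimitGrad (v : M.Elem → Plane → ℝ) : Prop :=
  ∀ ρ : Plane → Plane, Continuous ρ → HasCompactSupport ρ →
    (∀ ψ, IsTest Ω ψ → ∫ x, ⟪gradient ψ x, ρ x⟫ = 0) →
    ∑ k, ∫ x in M.elem k, ⟪M.grad v k x, ρ x⟫ = 0

theorem setIntegral_eq_of_inter_ball {f : Plane → ℝ} {A B : Set Plane} {x₀ : Plane} {r : ℝ}
    (hA : MeasurableSet A) (hB : MeasurableSet B)
    (hf : ∀ x ∉ Metric.ball x₀ r, f x = 0)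
    (h : Metric.ball x₀ r ∩ A = Metric.ball x₀ r ∩ B) : ∫ x in A, f x = ∫ x in B, f x := by
  rw [← integral_indicator hA, ← integral_indicator hB]
  congr 1
  ext1 x
  by_cases hx : x ∈ Metric.ball x₀ r
  · have : x ∈ A ↔ x ∈ B := by simpa [hx] using Set.ext_iff.1 h x
    by_cases hxA : x ∈ A
    · rw [indicator_of_mem hxA, indicator_of_mem (this.1 hxA)]
    · rw [indicator_of_notMem hxA, indicator_of_notMem fun hB => hxA (this.2 hB)]
  · simp [indicator, hf x hx]

/-- If the element-wise gradient is a limit of gradients of test functions, then the jump across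
an edge integrates to zero against tangential derivatives. -/
theorem IsLimitGrad.integral_jumpVal {q : ℕ} {v : M.Elem → Plane → ℝ} (hv : M.IsV q v)
    (hlim : M.IsLimitGrad v) {e : M.Edge} {x₀ : Plane}
    (hx₀ : x₀ ∈ openSegment ℝ (M.src e) (M.tgt e)) {r : ℝ} (hr0 : 0 < r)
    (hr : ∀ e' ≠ e, Disjoint (Metric.ball x₀ r) (segment ℝ (M.src e') (M.tgt e')))
    (hrk : ∀ k, e ∉ M.edgesOf k → Disjoint (Metric.ball x₀ r) (M.elem k))
    {χ : Plane → ℝ} (hχ : ContDiff ℝ ∞ χ) (hχc : HasCompactSupport χ)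
    (hχr : tsupport χ ⊆ Metric.ball x₀ r) :
    ∫ s : ℝ, χ (x₀ + s • M.tangent e) *
      fderiv ℝ (jumpVal v e) (x₀ + s • M.tangent e) (M.tangent e) = 0 := by
  classical
  set d := M.tangent e with hd_def
  set n := M.normal e with hn_def
  have hd : ‖d‖ = 1 := norm_tangent e
  have hn : ‖n‖ = 1 := M.norm_normal e
  have hdn : ⟪d, n⟫ = 0 := inner_tangent_normal e
  have hs₀ := openSegment_subset_segment ℝ _ _ hx₀
  have hsrc : ∀ x, ⟪n, x - x₀⟫ = ⟪n, x - M.src e⟫ := fun x => by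
    rw [← sub_sub_sub_cancel_right x x₀ (M.src e), inner_sub_right, inner_normal_eq_zero hs₀,
      sub_zero]
  have hρ0 : ∀ x ∉ Metric.ball x₀ r, rotGrad d n χ x = 0 := fun x hx =>
    rotGrad_eq_zero d n fun h => hx (hχr h)
  -- The rotated gradient of a bump is an admissible test field because it is orthogonal to all
  -- gradients of test functions.
  have hsum := hlim (rotGrad d n χ) (continuous_rotGrad d n hχ) (hasCompactSupport_rotGrad d n hχc)
    fun ψ hψ => integral_rotGrad hd hn hdn hψ.1 hχ hχc
  have hzero : ∀ k, e ∉ M.edgesOf k → ∫ x in M.elem k, ⟪M.grad v k x, rotGrad d n χ x⟫ = 0 :=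
    fun k hk => by
      refine setIntegral_eq_zero_of_forall_eq_zero fun x hx => ?_
      rw [hρ0 x fun h => Set.disjoint_left.1 (hrk k hk) h hx, inner_zero_right]
  have hmeas : ∀ k, MeasurableSet (M.elem k) := fun k => (M.isCompact_elem k).measurableSet
  have hint : ∀ k, ∀ ν : Plane, ‖ν‖ = 1 → x₀ ∈ M.elem k → M.elem k ⊆ halfPlane ν x₀ →
      (∀ x ∈ segment ℝ (M.src e) (M.tgt e), ⟪ν, x - x₀⟫ = 0) →
      ∫ x in M.elem k, ⟪M.grad v k x, rotGrad d n χ x⟫ =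
        ∫ x in halfPlane ν x₀, ⟪gradient (v k) x, rotGrad d n χ x⟫ := fun k ν h1 h2 h3 h4 =>
    setIntegral_eq_of_inter_ball (hmeas k) (isClosed_halfPlane ν x₀).measurableSet
      (fun x hx => by rw [hρ0 x hx, inner_zero_right]) (ball_inter_elem_eq hr0 h2 h1 h3 h4 hr)
  have hleft := hint (M.left e) n hn (M.segment_subset_left e hs₀)
    (fun x hx => by rw [halfPlane, mem_ofPred_eq, hsrc]; exact M.normal_left e x hx)
    fun x hx => by rw [hsrc]; exact inner_normal_eq_zero hx
  rw [setIntegral_halfPlane_rotGrad hd hn hdn x₀ (hv _).contDiff hχ hχc] at hleft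
  have hline : ∀ k, Integrable fun s : ℝ => χ (x₀ + s • d) * fderiv ℝ (v k) (x₀ + s • d) d :=
    fun k => by
      have h1 : Continuous fun s : ℝ => x₀ + s • d := by fun_prop
      refine Continuous.integrable_of_hasCompactSupport ((hχ.continuous.comp h1).mul
        ((continuous_fderiv_apply ((hv k).contDiff.of_le (by simp)) d).comp h1)) ?_
      exact (hasCompactSupport_comp_line hχc hd x₀).mul_right
  -- On a boundary edge the left element alone contributes; on an interior edge the two boundary
  -- terms have opposite signs and leave the tangential derivative of the jump.
  rcases hright : M.right e with _ | k
  · have h1 : ∑ k, ∫ x in M.elem k, ⟪M.grad v k x, rotGrad d n χ x⟫ =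
        ∫ x in M.elem (M.left e), ⟪M.grad v (M.left e) x, rotGrad d n χ x⟫ := by
      refine Finset.sum_eq_single _ (fun k _ hk => hzero k ?_) (by simp)
      rintro (h | h)
      · exact hk h.symm
      · rw [hright] at h; cases h
    have hj : jumpVal v e = v (M.left e) := by unfold jumpVal; rw [hright]
    rw [h1, hleft] at hsum
    rw [hj]
    linarith
  · have hlr := left_ne_right hright
    have h1 : ∑ k, ∫ x in M.elem k, ⟪M.grad v k x, rotGrad d n χ x⟫ =
        (∫ x in M.elem (M.left e), ⟪M.grad v (M.left e) x, rotGrad d n χ x⟫) +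
          ∫ x in M.elem k, ⟪M.grad v k x, rotGrad d n χ x⟫ := by
      refine Finset.sum_eq_add _ _ hlr (fun k' _ hk => hzero k' ?_) (by simp) (by simp)
      rintro (h | h)
      · exact hk.1 h.symm
      · rw [hright] at h; exact hk.2 (Option.some.inj h).symm
    have h2 := hint k (-n) (by rwa [norm_neg]) (M.segment_subset_right e k hright hs₀)
      (fun x hx => by
        rw [halfPlane, mem_ofPred_eq, inner_neg_left, hsrc]
        linarith [M.normal_right e k hright x hx])
      fun x hx => by rw [inner_neg_left, hsrc, inner_normal_eq_zero hx, neg_zero]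
    rw [setIntegral_halfPlane_neg_rotGrad hd hn hdn x₀ (hv _).contDiff hχ hχc] at h2
    have hj : ∀ x, fderiv ℝ (jumpVal v e) x d = fderiv ℝ (v (M.left e)) x d - fderiv ℝ (v k) x d :=
      fun x => by
        unfold jumpVal
        rw [hright]
        simp only
        rw [fderiv_sub ((hv _).contDiff.differentiable (by simp) x)
          ((hv _).contDiff.differentiable (by simp) x)]
        rfl
    rw [h1, hleft, h2] at hsum
    simp only [hj, mul_sub]
    rw [integral_sub (hline _) (hline _)]
    linarith

/-- The fundamental lemma of the calculus of variations along the edge: otherwise a bump at `x₀`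
would give a nonzero integral. Multiplying by the value at `x₀` treats both signs at once. -/
theorem IsLimitGrad.fderiv_jumpVal {q : ℕ} {v : M.Elem → Plane → ℝ} (hv : M.IsV q v)
    (hlim : M.IsLimitGrad v) {e : M.Edge} {x₀ : Plane}
    (hx₀ : x₀ ∈ openSegment ℝ (M.src e) (M.tgt e)) (hx₀v : x₀ ∉ M.vertices) :
    fderiv ℝ (jumpVal v e) x₀ (M.tangent e) = 0 := by
  by_contra hne
  obtain ⟨r, hr0, hr, hrk⟩ := exists_ball hx₀ hx₀v
  set g : Plane → ℝ := fun x => fderiv ℝ (jumpVal v e) x (M.tangent e)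
  have hg : Continuous g :=
    continuous_fderiv_apply ((hv.isPoly_jumpVal e).contDiff.of_le (by simp)) _
  have hg0 : 0 < g x₀ * g x₀ := mul_self_pos.2 hne
  obtain ⟨r', hr'0, hr'⟩ := Metric.isOpen_iff.1
    (isOpen_lt continuous_const (hg.mul continuous_const : Continuous fun x => g x * g x₀))
    x₀ hg0
  set ρ := min r r' with hρ
  have hρ0 : 0 < ρ := lt_min hr0 hr'0
  let χ : ContDiffBump x₀ := ⟨ρ / 4, ρ / 2, by positivity, by linarith⟩
  have hsupp : tsupport χ ⊆ Metric.ball x₀ ρ := by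
    rw [χ.tsupport_eq]
    exact Metric.closedBall_subset_ball (by change ρ / 2 < ρ; linarith)
  have h0 := hlim.integral_jumpVal hv hx₀ hr0 hr hrk χ.contDiff χ.hasCompactSupport
    (hsupp.trans (Metric.ball_subset_ball (min_le_left _ _)))
  have hline : Continuous fun s : ℝ => x₀ + s • M.tangent e := by fun_prop
  have hpos : 0 < ∫ s : ℝ, (χ (x₀ + s • M.tangent e) * g (x₀ + s • M.tangent e)) * g x₀ := by
    refine Continuous.integral_pos_of_hasCompactSupport_nonneg_nonzero (x := 0)
      (((χ.continuous.comp hline).mul (hg.comp hline)).mul continuous_const)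
      ((hasCompactSupport_comp_line χ.hasCompactSupport (norm_tangent e) x₀).mul_right.mul_right)
      (fun s => ?_) ?_
    · rw [Pi.zero_apply]
      by_cases hs : x₀ + s • M.tangent e ∈ tsupport χ
      · have : 0 < g (x₀ + s • M.tangent e) * g x₀ :=
          hr' (Metric.ball_subset_ball (min_le_right _ _) (hsupp hs))
        rw [mul_assoc]
        exact mul_nonneg χ.nonneg this.le
      · rw [image_eq_zero_of_notMem_tsupport hs]; simp
    · have h1 : χ x₀ = 1 := χ.one_of_mem_closedBall (Metric.mem_closedBall_self χ.rIn_pos.le)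
      simp only [zero_smul, add_zero, h1, one_mul]
      exact hg0.ne'
  rw [integral_mul_const, h0, zero_mul] at hpos
  exact lt_irrefl _ hpos

/-- If the element-wise gradient is a limit of gradients of test functions, then the jumps are
constant along the edges. -/
theorem IsLimitGrad.jumpVal_eq {q : ℕ} {v : M.Elem → Plane → ℝ} (hv : M.IsV q v)
    (hlim : M.IsLimitGrad v) {e : M.Edge} {x : Plane}
    (hx : x ∈ segment ℝ (M.src e) (M.tgt e)) : jumpVal v e x = jumpVal v e (M.src e) := by
  rw [segment_eq_image_lineMap] at hx
  obtain ⟨t, ht, rfl⟩ := hx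
  have hJ := (hv.isPoly_jumpVal e).contDiff
  have hinj : Function.Injective (M.edgePt e) :=
    AffineMap.lineMap_injective ℝ (M.src_ne_tgt e)
  -- The tangential derivative is known to vanish off the vertices only; these are finitely many,
  -- which the fundamental theorem of calculus tolerates.
  have hcount : (M.edgePt e ⁻¹' M.vertices).Countable :=
    (M.finite_vertices.preimage hinj.injOn).countable
  have h1 := integral_eq_of_hasDerivAt_off_countable_of_le
    (fun t => jumpVal v e (M.edgePt e t)) (fun _ => 0) ht.1 hcount
    ((hJ.continuous.comp (M.continuous_edgePt e)).continuousOn) (fun s hs => ?_) (by simp)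
  · simp only [intervalIntegral.integral_zero] at h1
    have h2 : M.edgePt e 0 = M.src e := AffineMap.lineMap_apply_zero _ _
    rw [h2] at h1
    exact (sub_eq_zero.1 h1.symm)
  · have hmem : M.edgePt e s ∈ openSegment ℝ (M.src e) (M.tgt e) := by
      rw [openSegment_eq_image_lineMap]
      exact ⟨s, ⟨hs.1.1, hs.1.2.trans_le ht.2⟩, rfl⟩
    have h2 := hlim.fderiv_jumpVal hv hmem hs.2
    have h3 : fderiv ℝ (jumpVal v e) (M.edgePt e s) (M.tgt e - M.src e) = 0 := by
      rw [tangent, map_smul, smul_eq_mul] at h2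
      exact (mul_eq_zero.1 h2).resolve_left (inv_ne_zero (M.len_pos e).ne')
    have h4 : HasDerivAt (M.edgePt e) (M.tgt e - M.src e) s := AffineMap.hasDerivAt_lineMap
    have h5 := ((hJ.differentiable (by simp)) _).hasFDerivAt.comp_hasDerivAt s h4
    rwa [h3] at h5

/-- Limits of test functions have no jumps, provided that the mean values of the jumps vanish. -/
theorem IsLimitGrad.noJump {q : ℕ} {v : M.Elem → Plane → ℝ} (hv : M.IsV q v)
    (hlim : M.IsLimitGrad v) (hmean : ∀ e, M.edgeInt e (jumpVal v e) = 0) : M.NoJump v := by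
  intro e x hx
  have h1 : M.edgeInt e (jumpVal v e) = M.edgeInt e fun _ => jumpVal v e (M.src e) :=
    edgeInt_congr fun y hy => hlim.jumpVal_eq hv hy
  rw [hmean e, edgeInt_const] at h1
  have h2 := (mul_eq_zero.1 h1.symm).resolve_left (M.len_pos e).ne'
  rw [jump_eq, hlim.jumpVal_eq hv hx, h2, zero_smul]

end Mesh

/-! ### The Poincaré–Friedrichs inequality on `V(h)` -/

/-- A Poincaré inequality on `A` extends to the sum of `A` and a finite-dimensional space if it
holds on the sum of `A` and the kernel of the seminorm. -/
theorem exists_bound_add {V E L Y : Type*} [AddCommGroup V] [Module ℝ V] [FiniteDimensional ℝ V]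
    [NormedAddCommGroup E] [InnerProductSpace ℝ E] [CompleteSpace E] [NormedAddCommGroup L]
    [NormedSpace ℝ L] [NormedAddCommGroup Y] [NormedSpace ℝ Y] (T : V →ₗ[ℝ] E) (I : V →ₗ[ℝ] L)
    (J : V →ₗ[ℝ] Y) (G : Submodule ℝ E) (A : Set (L × E)) (hA : ∀ z ∈ A, z.2 ∈ Gᗮᗮ) {R : ℝ}
    (hR : 0 ≤ R)
    (h : ∀ n, T n ∈ Gᗮᗮ → J n = 0 → ∀ z ∈ A, ‖I n + z.1‖ ≤ R * ‖T n + z.2‖) :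
    ∃ C, 0 < C ∧ ∀ v, ∀ z ∈ A, ‖I v + z.1‖ ≤ C * (‖T v + z.2‖ + ‖J v‖) := by
  let P : E →L[ℝ] Gᗮ := Gᗮ.orthogonalProjectionOnto
  -- The kernel of `S` consists of the vectors to which `h` applies. Projecting onto `Gᗮ` needs no
  -- closedness of `G`.
  let S : V →ₗ[ℝ] Gᗮ × Y := (P.toLinearMap ∘ₗ T).prod J
  obtain ⟨g, hg⟩ := LinearMap.exists_rightInverse_of_surjective S.rangeRestrict
    (LinearMap.range_rangeRestrict S)
  have hgS : ∀ y, S (g y) = y := fun y => congrArg Subtype.val (LinearMap.congr_fun hg y)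
  let A₁ := LinearMap.toContinuousLinearMap (I ∘ₗ g)
  let A₂ := LinearMap.toContinuousLinearMap (T ∘ₗ g)
  -- Split `v` into `g (S v)` and a vector of the kernel. The first part costs `‖A₁‖`; applying `h`
  -- to the second costs `R`, and removing `T (g (S v))` from its gradient costs `R * ‖A₂‖`.
  refine ⟨‖A₁‖ + R * ‖A₂‖ + R + 1, by positivity, fun v z hz => ?_⟩
  let y : LinearMap.range S := ⟨S v, v, rfl⟩
  have hSn : S (v - g y) = 0 := by rw [map_sub, hgS, sub_self]
  have hPn : P (T (v - g y)) = 0 := congrArg Prod.fst hSn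
  have hJn : J (v - g y) = 0 := congrArg Prod.snd hSn
  have h1 := h _ (Submodule.orthogonalProjectionOnto_eq_zero_iff.1 hPn) hJn z hz
  -- The projection does not see the component from `A`, so `S v` is controlled by the full
  -- seminorm.
  have hPv : P (T v) = P (T v + z.2) := by
    rw [map_add, Submodule.orthogonalProjectionOnto_eq_zero_iff.2 (hA z hz), add_zero]
  have hy : ‖y‖ ≤ ‖T v + z.2‖ + ‖J v‖ := by
    have h2 : ‖y‖ = max ‖P (T v)‖ ‖J v‖ := rfl
    rw [h2, hPv]
    exact max_le ((Gᗮ.norm_orthogonalProjectionOnto_apply_le _).trans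
      (le_add_of_nonneg_right (norm_nonneg _))) (le_add_of_nonneg_left (norm_nonneg _))
  have h3 : ‖I (g y)‖ ≤ ‖A₁‖ * ‖y‖ := A₁.le_opNorm y
  have h4 : ‖T (g y)‖ ≤ ‖A₂‖ * ‖y‖ := A₂.le_opNorm y
  have h5 : I v + z.1 = I (g y) + (I (v - g y) + z.1) := by rw [map_sub]; abel
  have h6 : T (v - g y) + z.2 = (T v + z.2) - T (g y) := by rw [map_sub]; abel
  have h7 : ‖I v + z.1‖ ≤ ‖I (g y)‖ + ‖I (v - g y) + z.1‖ := by
    rw [h5]; exact norm_add_le _ _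
  have h8 : ‖T (v - g y) + z.2‖ ≤ ‖T v + z.2‖ + ‖T (g y)‖ := by
    rw [h6]; exact norm_sub_le _ _
  have h9 : 0 ≤ ‖T v + z.2‖ := norm_nonneg _
  have h10 : 0 ≤ ‖J v‖ := norm_nonneg _
  have h11 := mul_le_mul_of_nonneg_left h8 hR
  have h12 := mul_le_mul_of_nonneg_left h4 hR
  have h13 := mul_le_mul_of_nonneg_left hy (norm_nonneg A₁)
  have h14 := mul_le_mul_of_nonneg_left hy (mul_nonneg hR (norm_nonneg A₂))
  have h15 := mul_nonneg hR h10
  nlinarith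

namespace Mesh

variable {Ω : Set Plane} {M : Mesh Ω}

/-- Up to the boundaries of the elements, which are null by convexity, `Ω` is the disjoint union of
the interiors. -/
theorem restrict_eq_sum (M : Mesh Ω) :
    volume.restrict Ω = ∑ k, volume.restrict (M.elem k) := by
  have h1 : (Ω : Set Plane) =ᵐ[volume] ⋃ k, interior (M.elem k) := by
    refine EventuallyLE.antisymm ?_ (iUnion_subset M.interior_elem_subset).eventuallyLE
    rw [ae_le_set]
    refine measure_mono_null (t := ⋃ k, frontier (M.elem k)) ?_
      (measure_iUnion_null fun k => (M.convex_elem k).addHaar_frontier volume)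
    rintro x ⟨hx, hxi⟩
    have : x ∈ ⋃ k, M.elem k := by rw [M.cover]; exact subset_closure hx
    obtain ⟨k, hk⟩ := mem_iUnion.1 this
    exact mem_iUnion.2 ⟨k, subset_closure hk, fun hi => hxi (mem_iUnion.2 ⟨k, hi⟩)⟩
  rw [Measure.restrict_congr_set h1, Measure.restrict_iUnion
    (fun k k' hkk' => M.disjoint_interior k k' hkk') fun k => isOpen_interior.measurableSet,
    Measure.sum_fintype]
  simp only [M.restrict_interior]

theorem restrict_elem_le (M : Mesh Ω) (k : M.Elem) :
    volume.restrict (M.elem k) ≤ volume.restrict Ω := by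
  rw [M.restrict_eq_sum]
  exact Measure.le_iff.2 fun s hs => by
    rw [Measure.finsetSum_apply]
    exact Finset.single_le_sum (f := fun k => volume.restrict (M.elem k) s)
      (fun _ _ => zero_le) (Finset.mem_univ k)

theorem integral_eq_sum (M : Mesh Ω) {f : Plane → ℝ}
    (hf : Integrable f (volume.restrict Ω)) :
    ∫ x in Ω, f x = ∑ k, ∫ x in M.elem k, f x := by
  rw [M.restrict_eq_sum, integral_finsetSum_measure fun k _ =>
    hf.mono_measure (M.restrict_elem_le k)]

theorem glue_ae_eq {F : Type*} [AddCommMonoid F] (f : M.Elem → Plane → F) (k : M.Elem) :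
    M.glue f =ᵐ[volume.restrict (M.elem k)] f k := by
  filter_upwards [M.ae_mem_interior k] with x hx
  exact glue_eq f hx

theorem memLp_glue {F : Type*} [NormedAddCommGroup F] {f : M.Elem → Plane → F}
    (hf : ∀ k, Continuous (f k)) : MemLp (M.glue f) 2 (volume.restrict Ω) := by
  refine MemLp.restrict Ω ?_
  unfold glue
  refine memLp_finsetSum _ fun k _ => ?_
  rw [memLp_indicator_iff_restrict isOpen_interior.measurableSet, M.restrict_interior]
  exact memLp_of_continuous (hf k) (M.isCompact_elem k)

theorem glue_add {F : Type*} [AddCommMonoid F] (f g : M.Elem → Plane → F) :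
    M.glue (f + g) = M.glue f + M.glue g := by
  ext1 x
  simp [glue, indicator_add', Finset.sum_add_distrib]

theorem glue_smul {F : Type*} [AddCommGroup F] [Module ℝ F] (c : ℝ) (f : M.Elem → Plane → F) :
    M.glue (c • f) = c • M.glue f := by
  ext1 x
  simp only [glue, Pi.smul_apply, Finset.smul_sum]
  refine Finset.sum_congr rfl fun k _ => ?_
  exact congrFun (indicator_const_smul _ c (f k)) x

theorem _root_.DG.IsTest.memLp {ψ : Plane → ℝ} (hψ : IsTest Ω ψ) : MemLp ψ 2 (volume.restrict Ω) :=
  hψ.1.continuous.memLp_of_hasCompactSupport hψ.2.1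

theorem gradient_eq_zero {ψ : Plane → ℝ} {x : Plane} (hx : x ∉ tsupport ψ) :
    gradient ψ x = 0 := by
  have : fderiv ℝ ψ x = 0 := image_eq_zero_of_notMem_tsupport fun h =>
    hx (tsupport_fderiv_subset ℝ h)
  simp [gradient, this]

theorem _root_.DG.IsTest.memLp_gradient {ψ : Plane → ℝ} (hψ : IsTest Ω ψ) :
    MemLp (gradient ψ) 2 (volume.restrict Ω) :=
  (continuous_gradient hψ.1).memLp_of_hasCompactSupport
    (HasCompactSupport.intro hψ.2.1 fun _ hx => gradient_eq_zero hx)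

theorem _root_.DG.IsTest.neg {ψ : Plane → ℝ} (hψ : IsTest Ω ψ) : IsTest Ω (-ψ) :=
  ⟨hψ.1.neg, hψ.2.1.neg, by
    have : tsupport (-ψ) = tsupport ψ := by simp [tsupport]
    rw [this]; exact hψ.2.2⟩

theorem memLp_of_isH2H10 {φ : Plane → ℝ} {γ : Plane → Plane} (h : IsH2H10 Ω φ γ) :
    MemLp γ 2 (volume.restrict Ω) := MemLp.of_eval_piLp h.memLp_grad

variable (M)

/-- The piecewise polynomials, with their element-wise gradients as elements of `L²`. -/
def gradLp (q : ℕ) : (M.Elem → polyFun q) →ₗ[ℝ] Lp Plane 2 (volume.restrict Ω) where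
  toFun v := (memLp_glue (IsV.continuous_grad (M := M) (v := fun k => (v k).1)
    fun k => (v k).2)).toLp
  map_add' v w := by
    rw [← MemLp.toLp_add]
    refine MemLp.toLp_congr _ _ (Eventually.of_forall fun x => congrFun ?_ x)
    rw [← glue_add]
    congr 1
    ext1 k
    ext1 x
    simp only [grad, gradient, Pi.add_apply, Submodule.coe_add]
    rw [fderiv_add ((v k).2.contDiff.differentiable (by simp) x)
      ((w k).2.contDiff.differentiable (by simp) x), map_add]
  map_smul' c v := by
    rw [RingHom.id_apply, ← MemLp.toLp_const_smul]
    refine MemLp.toLp_congr _ _ (Eventually.of_forall fun x => congrFun ?_ x)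
    rw [← glue_smul]
    congr 1
    ext1 k
    ext1 x
    simp only [grad, gradient, Pi.smul_apply, Submodule.coe_smul]
    rw [fderiv_const_smul ((v k).2.contDiff.differentiable (by simp) x), map_smul]

/-- The piecewise polynomials as elements of `L²`. -/
def valLp (q : ℕ) : (M.Elem → polyFun q) →ₗ[ℝ] Lp ℝ 2 (volume.restrict Ω) where
  toFun v := (memLp_glue (M := M) (f := fun k => (v k).1) fun k => (v k).2.continuous).toLp
  map_add' v w := by
    rw [← MemLp.toLp_add]
    refine MemLp.toLp_congr _ _ (Eventually.of_forall fun x => congrFun ?_ x)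
    rw [← glue_add]
    rfl
  map_smul' c v := by
    rw [RingHom.id_apply, ← MemLp.toLp_const_smul]
    refine MemLp.toLp_congr _ _ (Eventually.of_forall fun x => congrFun ?_ x)
    rw [← glue_smul]
    rfl

/-- The integrals of the jumps over the edges. -/
def meanJump (q : ℕ) : (M.Elem → polyFun q) →ₗ[ℝ] (M.Edge → ℝ) where
  toFun v e := M.edgeInt e (jumpVal (fun k => (v k).1) e)
  map_add' v w := by
    ext1 e
    rw [Pi.add_apply, ← edgeInt_add
      (IsV.isPoly_jumpVal (v := fun k => (v k).1) (fun k => (v k).2) e).continuous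
      (IsV.isPoly_jumpVal (v := fun k => (w k).1) (fun k => (w k).2) e).continuous]
    refine edgeInt_congr fun x _ => ?_
    unfold jumpVal
    rcases M.right e with _ | k
    · rfl
    · simp only [Pi.add_apply, Submodule.coe_add, Pi.sub_apply]; ring
  map_smul' c v := by
    ext1 e
    rw [Pi.smul_apply, RingHom.id_apply, smul_eq_mul, ← edgeInt_const_mul]
    refine edgeInt_congr fun x _ => ?_
    unfold jumpVal
    rcases M.right e with _ | k
    · rfl
    · simp only [Pi.smul_apply, Submodule.coe_smul, Pi.sub_apply, smul_eq_mul]; ring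

/-- The gradients of test functions as elements of `L²`. -/
def testGrad (Ω : Set Plane) : Submodule ℝ (Lp Plane 2 (volume.restrict Ω)) :=
  Submodule.span ℝ {z | ∃ (ψ : Plane → ℝ) (hψ : IsTest Ω ψ), z = hψ.memLp_gradient.toLp}

variable {M}

theorem inner_toLp {F : Type*} [NormedAddCommGroup F] [InnerProductSpace ℝ F]
    {m : Measure Plane} {f g : Plane → F} (hf : MemLp f 2 m) (hg : MemLp g 2 m) :
    ⟪hf.toLp, hg.toLp⟫ = ∫ x, ⟪f x, g x⟫ ∂m := by
  rw [L2.inner_def]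
  refine integral_congr_ae ?_
  filter_upwards [hf.coeFn_toLp, hg.coeFn_toLp] with x h1 h2
  rw [h1, h2]

theorem integrable_inner_memLp {F : Type*} [NormedAddCommGroup F] [InnerProductSpace ℝ F]
    {m : Measure Plane} {f g : Plane → F} (hf : MemLp f 2 m) (hg : MemLp g 2 m) :
    Integrable (fun x => ⟪f x, g x⟫) m := by
  refine (L2.integrable_inner (𝕜 := ℝ) hf.toLp hg.toLp).congr ?_
  filter_upwards [hf.coeFn_toLp, hg.coeFn_toLp] with x h1 h2
  rw [h1, h2]

/-- A field orthogonal to the gradients of all test functions represents an element of `Gᗮ`, and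
elements of `Gᗮᗮ` are orthogonal to it. -/
theorem isLimitGrad_of_mem {q : ℕ} {v : M.Elem → polyFun q}
    (h : M.gradLp q v ∈ (testGrad Ω)ᗮᗮ) : M.IsLimitGrad fun k => (v k).1 := by
  intro ρ hρ hρc hρt
  have hv : M.IsV q fun k => (v k).1 := fun k => (v k).2
  have hρm : MemLp ρ 2 (volume.restrict Ω) := hρ.memLp_of_hasCompactSupport hρc
  have h1 : hρm.toLp ∈ (testGrad Ω)ᗮ := by
    rw [Submodule.mem_orthogonal]
    intro z hz
    induction hz using Submodule.span_induction with
    | mem z hz =>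
      obtain ⟨ψ, hψ, rfl⟩ := hz
      rw [inner_toLp, ← hρt ψ hψ]
      refine setIntegral_eq_integral_of_forall_compl_eq_zero fun x hx => ?_
      rw [gradient_eq_zero fun h => hx (hψ.2.2 h), inner_zero_left]
    | zero => exact inner_zero_left _
    | add z w _ _ hz hw => rw [inner_add_left, hz, hw, add_zero]
    | smul c z _ hz => rw [real_inner_smul_left, hz, mul_zero]
  have hm := memLp_glue (M := M) (hv.continuous_grad)
  have h2 : ⟪hρm.toLp, hm.toLp⟫ = 0 := (Submodule.mem_orthogonal _ _).1 h _ h1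
  rw [real_inner_comm, inner_toLp, M.integral_eq_sum (integrable_inner_memLp hm hρm)] at h2
  rw [← h2]
  refine Finset.sum_congr rfl fun k _ => integral_congr_ae ?_
  filter_upwards [glue_ae_eq (M.grad fun k => (v k).1) k] with x hx
  rw [hx]

theorem norm_toLp_glue_add_sq {F : Type*} [NormedAddCommGroup F] [InnerProductSpace ℝ F]
    {f : M.Elem → Plane → F} (hf : ∀ k, Continuous (f k)) {g : Plane → F}
    (hg : MemLp g 2 (volume.restrict Ω)) :
    ‖(memLp_glue hf).toLp + hg.toLp‖ ^ 2 = ∑ k, ∫ x in M.elem k, ‖f k x + g x‖ ^ 2 := by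
  have hm := (memLp_glue hf).add hg
  rw [← MemLp.toLp_add, norm_toLp_sq hm, M.integral_eq_sum ((memLp_two_iff_integrable_sq_norm hm.1).1 hm)]
  refine Finset.sum_congr rfl fun k _ => integral_congr_ae ?_
  filter_upwards [glue_ae_eq f k] with x hx
  rw [Pi.add_apply, hx]

theorem tendsto_toLp {E : Type*} [NormedAddCommGroup E] {μ : Measure Plane} {f : Plane → E}
    {g : ℕ → Plane → E} (hg : ∀ m, MemLp (g m) 2 μ) (hf : MemLp f 2 μ)
    (h : Tendsto (fun m => eLpNorm (f - g m) 2 μ) atTop (𝓝 0)) :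
    Tendsto (fun m => (hg m).toLp) atTop (𝓝 hf.toLp) :=
  (Lp.tendsto_Lp_iff_tendsto_eLpNorm'' g hg f hf).2 (h.congr fun _ => eLpNorm_sub_comm _ _ _ _)

/-- Poincaré's inequality on the sum of `H₀¹` and of the limits of test functions in `V_{h,q}`. -/
theorem exists_poincare_kernel (M : Mesh Ω) (hΩ : IsOpen Ω) (q : ℕ) : ∃ R, 0 ≤ R ∧
    ∀ n, M.gradLp q n ∈ (testGrad Ω)ᗮᗮ → M.meanJump q n = 0 →
      ∀ φ γ (h : IsH2H10 Ω φ γ), ‖M.valLp q n + h.memLp.toLp‖ ≤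
        R * ‖M.gradLp q n + (memLp_of_isH2H10 h).toLp‖ := by
  obtain ⟨R, hR, hP⟩ := M.exists_poincare hΩ
  refine ⟨R, hR.le, fun n hn hJ φ γ h => ?_⟩
  have hv : M.IsV q fun k => (n k).1 := fun k => (n k).2
  have hno := (isLimitGrad_of_mem hn).noJump hv fun e => congrFun hJ e
  obtain ⟨ψ, hψ, hψ1, hψ2⟩ := h.approx
  have htest : ∀ m, ‖M.valLp q n + (hψ m).memLp.toLp‖ ≤
      R * ‖M.gradLp q n + (hψ m).memLp_gradient.toLp‖ := fun m => by
    -- The available inequality concerns differences `v - ψ`; the sign is changed to obtain sums.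
    have h1 := hP q _ _ hv hno (hψ m).neg
    have h2 : gradient (-ψ m) = -gradient (ψ m) := by
      ext1 x; simp [gradient, fderiv_neg]
    simp only [h2, Pi.neg_apply, sub_neg_eq_add] at h1
    refine (pow_le_pow_iff_left₀ (norm_nonneg _) (by positivity) two_ne_zero).1 ?_
    rw [mul_pow]
    have h3 := norm_toLp_glue_add_sq (M := M) hv.continuous (hψ m).memLp
    have h4 := norm_toLp_glue_add_sq (M := M) hv.continuous_grad (hψ m).memLp_gradient
    simp only [Real.norm_eq_abs, sq_abs] at h3
    rw [← h3, ← h4] at h1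
    exact h1
  have t1 : Tendsto (fun m => (hψ m).memLp.toLp) atTop (𝓝 h.memLp.toLp) :=
    tendsto_toLp (fun m => (hψ m).memLp) h.memLp hψ1
  have t2 : Tendsto (fun m => (hψ m).memLp_gradient.toLp) atTop
      (𝓝 (memLp_of_isH2H10 h).toLp) :=
    tendsto_toLp (fun m => (hψ m).memLp_gradient) (memLp_of_isH2H10 h) hψ2
  exact le_of_tendsto_of_tendsto' (t1.const_add _).norm ((t2.const_add _).norm.const_mul R) htest

/-- The weak gradient is an `L²` limit of gradients of test functions, and double orthogonal
complements are closed. -/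
theorem toLp_mem_of_isH2H10 {φ : Plane → ℝ} {γ : Plane → Plane} (h : IsH2H10 Ω φ γ) :
    (memLp_of_isH2H10 h).toLp ∈ (testGrad Ω)ᗮᗮ := by
  obtain ⟨ψ, hψ, -, hψ2⟩ := h.approx
  have t2 : Tendsto (fun m => (hψ m).memLp_gradient.toLp) atTop
      (𝓝 (memLp_of_isH2H10 h).toLp) :=
    tendsto_toLp (fun m => (hψ m).memLp_gradient) (memLp_of_isH2H10 h) hψ2
  have h1 : ∀ m, (hψ m).memLp_gradient.toLp ∈ (testGrad Ω)ᗮᗮ := fun m =>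
    Submodule.le_orthogonal_orthogonal _ (Submodule.subset_span ⟨_, hψ m, rfl⟩)
  exact (Submodule.isClosed_orthogonal _).mem_of_tendsto t2 (Eventually.of_forall h1)

/-- The Poincaré–Friedrichs inequality on `V(h)`, in terms of the integrals of the jumps. -/
theorem exists_poincare_add (M : Mesh Ω) (hΩ : IsOpen Ω) (q : ℕ) : ∃ C, 0 < C ∧
    ∀ v φ γ (h : IsH2H10 Ω φ γ), ‖M.valLp q v + h.memLp.toLp‖ ≤
      C * (‖M.gradLp q v + (memLp_of_isH2H10 h).toLp‖ + ‖M.meanJump q v‖) := by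
  have := finiteDimensional_polyFun q
  obtain ⟨R, hR, hP⟩ := M.exists_poincare_kernel hΩ q
  let A : Set (Lp ℝ 2 (volume.restrict Ω) × Lp Plane 2 (volume.restrict Ω)) :=
    {z | ∃ φ γ, ∃ h : IsH2H10 Ω φ γ, z = (h.memLp.toLp, (memLp_of_isH2H10 h).toLp)}
  have hA : ∀ z ∈ A, z.2 ∈ (testGrad Ω)ᗮᗮ := by
    rintro z ⟨φ, γ, h, hz⟩
    rw [hz]
    exact toLp_mem_of_isH2H10 h
  have hPA : ∀ n, M.gradLp q n ∈ (testGrad Ω)ᗮᗮ → M.meanJump q n = 0 → ∀ z ∈ A,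
      ‖M.valLp q n + z.1‖ ≤ R * ‖M.gradLp q n + z.2‖ := by
    rintro n hn hJ z ⟨φ, γ, h, hz⟩
    rw [hz]
    exact hP n hn hJ φ γ h
  obtain ⟨C, hC, h⟩ := exists_bound_add (M.gradLp q) (M.valLp q) (M.meanJump q) (testGrad Ω) A
    hA hR hPA
  refine ⟨C, hC, fun v φ γ hφ => ?_⟩
  exact h v (hφ.memLp.toLp, (memLp_of_isH2H10 hφ).toLp) ⟨φ, γ, hφ, rfl⟩

/-! ### Continuity of the linear form -/

/-- The integral of a jump is controlled by its lifting. -/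
theorem exists_meanJump_bound (M : Mesh Ω) (p : ℕ) (e : M.Edge) : ∃ D, 0 ≤ D ∧
    ∀ v : M.Elem → Plane → ℝ, (∀ k, Continuous (v k)) →
      |M.edgeInt e (jumpVal v e)| ≤ D * M.l2Norm (M.liftREdge p e (M.jump v e)) := by
  classical
  set k₀ := M.left e with hk₀
  -- The normal extended as a constant to the left element only. It belongs to `Σ_{h,p}` even for `p
  -- = 0`, and testing `r^e` with it reads off the integral of the jump.
  let τ : M.Elem → Plane → Plane := fun k => if k = k₀ then fun _ => M.normal e else 0
  have hτ : M.IsSigma p τ :=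
    isSigma_ite (τ := fun _ _ => M.normal e) (fun k i => IsPoly.const p (M.normal e i)) _
  have hm : MemLp (fun _ : Plane => M.normal e) 2 (volume.restrict (M.elem k₀)) :=
    memLp_of_continuous continuous_const (M.isCompact_elem k₀)
  refine ⟨2 * ‖hm.toLp‖, by positivity, fun v hv => ?_⟩
  obtain ⟨hs, hr⟩ := (liftREdge_spec p e (continuous_jump hv e)).1
  have hRm := memLp_of_continuous (hs.continuous k₀) (M.isCompact_elem k₀)
  have h1 := hr τ hτ
  have h2 : M.l2Inner (M.liftREdge p e (M.jump v e)) τ = ⟪hRm.toLp, hm.toLp⟫ := by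
    rw [inner_toLp, l2Inner, Finset.sum_eq_single k₀]
    · simp [τ]
    · intro k _ hk; simp [τ, hk]
    · simp
  have h3 : ‖hRm.toLp‖ ≤ M.l2Norm (M.liftREdge p e (M.jump v e)) := by
    refine (pow_le_pow_iff_left₀ (norm_nonneg _) (l2Norm_nonneg _) two_ne_zero).1 ?_
    rw [norm_toLp_sq]
    exact setIntegral_le_l2Norm_sq _ _
  -- The average is the normal on a boundary edge and half of it on an interior edge; the worse case
  -- explains the factor `2` in the bound.
  obtain ⟨c, hc0, hc⟩ : ∃ c : ℝ, 1 ≤ 2 * c ∧ ∀ x, M.avg τ e x = c • M.normal e := by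
    unfold avg
    rcases hright : M.right e with _ | k
    · exact ⟨1, by norm_num, fun x => by simp [τ, ← hk₀]⟩
    · refine ⟨1 / 2, by norm_num, fun x => ?_⟩
      have : k ≠ k₀ := (left_ne_right hright).symm
      simp [τ, ← hk₀, this]
  have h4 : (M.edgeInt e fun x => ⟪M.jump v e x, M.avg τ e x⟫) =
      c * M.edgeInt e (jumpVal v e) := by
    rw [← edgeInt_const_mul]
    refine edgeInt_congr fun x _ => ?_
    rw [hc, jump_eq, real_inner_smul_left, real_inner_smul_right, real_inner_self_eq_norm_sq,
      M.norm_normal]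
    ring
  rw [h2, h4] at h1
  have h5 : c * |M.edgeInt e (jumpVal v e)| ≤ ‖hRm.toLp‖ * ‖hm.toLp‖ := by
    have h6 := abs_real_inner_le_norm hRm.toLp hm.toLp
    rwa [h1, abs_neg, abs_mul, abs_of_nonneg (by linarith : 0 ≤ c)] at h6
  have h7 := mul_le_mul_of_nonneg_right h3 (norm_nonneg hm.toLp)
  nlinarith [abs_nonneg (M.edgeInt e (jumpVal v e))]

theorem liftREdge_congr {p : ℕ} {e : M.Edge} {φ φ' : Plane → Plane}
    (h : ∀ x ∈ segment ℝ (M.src e) (M.tgt e), φ x = φ' x) :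
    M.liftREdge p e φ = M.liftREdge p e φ' := by
  unfold liftREdge
  congr 1
  ext1 τ
  rw [edgeInt_congr fun x hx => by rw [h x hx]]

/-- The elements of `H² ∩ H₀¹` do not contribute to the jumps. -/
theorem jump_add_eq {φ : Plane → ℝ} {γ : Plane → Plane} (h : IsH2H10 Ω φ γ)
    {w v : M.Elem → Plane → ℝ} (hw : ∀ k x, w k x = v k x + φ x) {e : M.Edge} {x : Plane}
    (hx : x ∈ segment ℝ (M.src e) (M.tgt e)) : M.jump w e x = M.jump v e x := by
  rcases hright : M.right e with _ | k
  · have h0 := h.eq_zero x (M.boundary_edge e hright hx)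
    simp [jump, hright, hw, h0]
  · simp only [jump, hright, hw]
    module

/-- The Cauchy–Schwarz inequality reduces the claim to bounding `‖w‖` in `L²` by the energy norm.
The Poincaré–Friedrichs inequality does this once the edge means are estimated by the liftings. The
constant depends on the mesh, but `f` enters only through its norm. -/
theorem exists_isContinuityConst (q p : ℕ) (M : Mesh Ω) (hΩ : IsOpen Ω) : ∃ CF, 0 < CF ∧
    ∀ f, InL2 Ω f → M.IsContinuityConst q p f CF := by
  obtain ⟨C, hC, hP⟩ := M.exists_poincare_add hΩ q
  choose D hD0 hD using M.exists_meanJump_bound p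
  have hDs : 0 ≤ ∑ e, D e := Finset.sum_nonneg fun e _ => hD0 e
  refine ⟨C * (1 + ∑ e, D e), by positivity, fun f hf => ?_⟩
  rintro w g ⟨v, φ, γ, hv, h, hw, hg⟩
  set EN := M.energyNorm p w g with hEN
  have hEN0 : 0 ≤ EN := energyNorm_nonneg p w g
  have hENsq := energyNorm_sq p w g
  -- The liftings in the energy norm of `w` see only the discrete part `v`, whose edge means have to
  -- be controlled.
  have hlift : ∀ e, M.liftREdge p e (M.jump w e) = M.liftREdge p e (M.jump v e) := fun e =>
    liftREdge_congr fun x hx => jump_add_eq h hw hx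
  simp only [hlift] at hENsq
  let n : M.Elem → polyFun q := fun k => ⟨v k, hv k⟩
  have h1 : ‖M.gradLp q n + (memLp_of_isH2H10 h).toLp‖ ≤ EN := by
    refine (pow_le_pow_iff_left₀ (norm_nonneg _) hEN0 two_ne_zero).1 ?_
    have h2 := norm_toLp_glue_add_sq (M := M) hv.continuous_grad (memLp_of_isH2H10 h)
    rw [hENsq, show ‖M.gradLp q n + (memLp_of_isH2H10 h).toLp‖ ^ 2 = _ from h2, l2Norm_sq]
    simp only [hg]
    exact le_add_of_nonneg_right (Finset.sum_nonneg fun _ _ => sq_nonneg _)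
  have h3 : ∀ e, M.l2Norm (M.liftREdge p e (M.jump v e)) ≤ EN := fun e => by
    refine (pow_le_pow_iff_left₀ (l2Norm_nonneg _) hEN0 two_ne_zero).1 ?_
    rw [hENsq]
    exact (Finset.single_le_sum (f := fun e => M.l2Norm (M.liftREdge p e (M.jump v e)) ^ 2)
      (fun _ _ => sq_nonneg _) (Finset.mem_univ e)).trans (le_add_of_nonneg_left (sq_nonneg _))
  have h4 : ‖M.meanJump q n‖ ≤ (∑ e, D e) * EN := by
    refine (pi_norm_le_iff_of_nonneg (by positivity)).2 fun e => ?_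
    refine ((hD e v hv.continuous).trans (mul_le_mul_of_nonneg_left (h3 e) (hD0 e))).trans ?_
    exact mul_le_mul_of_nonneg_right
      (Finset.single_le_sum (fun e _ => hD0 e) (Finset.mem_univ e)) hEN0
  have h5 : ‖M.valLp q n + h.memLp.toLp‖ ≤ C * (1 + ∑ e, D e) * EN := by
    refine (hP n φ γ h).trans ?_
    rw [mul_assoc]
    refine mul_le_mul_of_nonneg_left ?_ hC.le
    linarith
  have hm : MemLp f 2 (volume.restrict Ω) := hf
  have h6 : ‖hm.toLp‖ = normL2 Ω f := by
    rw [normL2, ← Real.sqrt_sq (norm_nonneg hm.toLp), norm_toLp_sq]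
    simp only [Real.norm_eq_abs, sq_abs]
  have hmv := (memLp_glue (Ω := Ω) hv.continuous).add h.memLp
  have h7 : M.load f w = ⟪hm.toLp, M.valLp q n + h.memLp.toLp⟫ := by
    have h8 : M.valLp q n + h.memLp.toLp = hmv.toLp := (MemLp.toLp_add (memLp_glue hv.continuous) h.memLp).symm
    rw [h8, inner_toLp, M.integral_eq_sum (integrable_inner_memLp hm hmv), load]
    refine Finset.sum_congr rfl fun k _ => integral_congr_ae ?_
    filter_upwards [glue_ae_eq v k] with x hx
    rw [hw, Pi.add_apply, hx]
    simp [mul_comm]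
  rw [h7]
  refine (abs_real_inner_le_norm _ _).trans ?_
  rw [h6]
  have h9 : 0 ≤ normL2 Ω f := Real.sqrt_nonneg _
  calc normL2 Ω f * ‖M.valLp q n + h.memLp.toLp‖
      ≤ normL2 Ω f * (C * (1 + ∑ e, D e) * EN) := mul_le_mul_of_nonneg_left h5 h9
    _ = _ := by ring

end Mesh

end DG

end

theorem lemma6p1 (q p : ℕ) (hq : 1 ≤ q) (hp : p = q ∨ p + 1 = q) :
    -- an upper lifting constant exists, depending only on the shape regularity and the degrees
    (∀ σ : ℝ, 0 < σ → ∃ CR : ℝ, 0 < CR ∧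
      ∀ (Ω : Set DG.Plane) (M : DG.Mesh Ω), IsOpen Ω → M.ShapeRegular σ →
        M.IsLiftConst q p CR) ∧
    -- on every mesh the linear form has a continuity constant that does not depend on `f`
    (∀ (Ω : Set DG.Plane) (M : DG.Mesh Ω), IsOpen Ω → ∃ CF : ℝ, 0 < CF ∧
      ∀ f : DG.Plane → ℝ, DG.InL2 Ω f → M.IsContinuityConst q p f CF) ∧
    -- LDG, for positive penalty parameters
    (∀ (σ lam b μ₀ : ℝ) (N : ℕ), 0 < σ → 0 < lam → 0 ≤ b → 0 < μ₀ →
      ∃ Cco : ℝ, 0 < Cco ∧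
        ∀ (Ω : Set DG.Plane) (M : DG.Mesh Ω) (Lam : ℝ) (a : DG.Plane → ℝ → DG.Plane → DG.Plane)
          (β : M.Edge → DG.Plane) (μ : M.Edge → ℝ),
          IsOpen Ω → M.ShapeRegular σ → M.EdgeBound N → lam ≤ Lam → DG.IsDiffusion Ω lam Lam a →
          (∀ e, ‖β e‖ ≤ b) → (∀ e, μ₀ ≤ μ e) →
          M.IsCoercivityConst q p (M.formLDG p a β μ) Cco ∧
          M.StabilityEstimate q p (M.formLDG p a β μ)) ∧
    -- SIPG, for penalty parameters above `CR² Λ N`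
    (∀ (lam Lam CR μ₀ : ℝ) (N : ℕ), 0 < lam → lam ≤ Lam → 0 < CR → CR ^ 2 * Lam * N < μ₀ →
      ∃ Cco : ℝ, 0 < Cco ∧
        ∀ (Ω : Set DG.Plane) (M : DG.Mesh Ω) (a : DG.Plane → ℝ → DG.Plane → DG.Plane)
          (μ : M.Edge → ℝ),
          IsOpen Ω → M.EdgeBound N → M.IsLiftConst q p CR → DG.IsDiffusion Ω lam Lam a →
          (∀ e, μ₀ ≤ μ e) →
          M.IsCoercivityConst q p (M.formSIPG p a μ) Cco ∧
          M.StabilityEstimate q p (M.formSIPG p a μ)) ∧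
    -- BR2, for stabilization parameters above `N Λ / λ`
    (∀ (lam Lam η₀ : ℝ) (N : ℕ), 0 < lam → lam ≤ Lam → N * (Lam / lam) < η₀ →
      ∃ Cco : ℝ, 0 < Cco ∧
        ∀ (Ω : Set DG.Plane) (M : DG.Mesh Ω) (a : DG.Plane → ℝ → DG.Plane → DG.Plane)
          (η : M.Edge → ℝ),
          IsOpen Ω → M.EdgeBound N → DG.IsDiffusion Ω lam Lam a →
          (∀ e, η₀ ≤ η e) →
          M.IsCoercivityConst q p (M.formBR2 p a η) Cco ∧
          M.StabilityEstimate q p (M.formBR2 p a η)) := by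
  refine ⟨fun σ hσ => ?_, fun Ω M hΩ => M.exists_isContinuityConst q p hΩ,
    fun σ lam b μ₀ N hσ hlam _ hμ₀ => ?_, fun lam Lam CR μ₀ N hlam hLam hCR hμ₀ => ?_,
    fun lam Lam η₀ N hlam hLam hη₀ => ?_⟩
  · obtain ⟨C, hC, h⟩ := DG.Mesh.exists_isTraceConst p hσ
    exact ⟨√(2 * C), Real.sqrt_pos.2 (by positivity),
      fun Ω M _ hM => (h Ω M hM).isLiftConst hC⟩
  · obtain ⟨C, hC, h⟩ := DG.Mesh.exists_isTraceConst p hσ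
    -- The witness is read off from the coercivity lemma. It involves only data fixed before the
    -- mesh, because the trace constant `C` depends on `p` and `σ` alone.
    exact ⟨_, lt_min (half_pos hlam) (div_pos hμ₀ (by positivity)),
      fun Ω M Lam a β μ _ hM hN _ ha hβ hμ =>
        ⟨DG.Mesh.isCoercivityConst_formLDG hlam hC (h Ω M hM) hμ₀ hN ha hβ hμ,
          DG.Mesh.stabilityEstimate q p _⟩⟩
  · have hδ : 0 < μ₀ / CR ^ 2 - Lam * N := by
      rw [sub_pos, lt_div_iff₀ (by positivity)]
      linarith
    exact ⟨_, lt_min (half_pos hlam) (div_pos hδ (by positivity)), fun Ω M a μ _ hN hC ha hμ =>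
      ⟨DG.Mesh.isCoercivityConst_formSIPG hlam hLam hCR hμ₀ hN hC ha hμ,
        DG.Mesh.stabilityEstimate q p _⟩⟩
  · have hδ : 0 < η₀ * lam - Lam * N := by
      have := hη₀
      rw [← mul_div_assoc, div_lt_iff₀ hlam] at this
      linarith
    exact ⟨_, lt_min (half_pos hlam) (div_pos hδ (by positivity)), fun Ω M a η _ hN ha hη =>
      ⟨DG.Mesh.isCoercivityConst_formBR2 hlam hLam hη₀ hN ha hη,
        DG.Mesh.stabilityEstimate q p _⟩⟩
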